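/- Notation. Let $\mathbb F$ be a field and let $q\in\mathbb F^\times$ not be a root of unity (for example $\mathbb F=\mathbb C(q)$ with $q$ an indeterminate). Put $[n]=q^{n-1}+q^{n-3}+\dots+q^{1-n}$, $[n]!=[1]\cdots[n]$ and $\binom{n}{k}_q=\frac{[n]!}{[k]!\,[n-k]!}$. Let $U_q(\mathfrak{sl}_2)$ be the algebra generated by $K^{\pm1},E,F$ with $KK^{-1}=K^{-1}K=1$, $KE=q^2EK$, $KF=q^{-2}FK$, $[E,F]=\frac{K-K^{-1}}{q-q^{-1}}$, acting on tensor products through $\Delta(K^{\pm1})=K^{\pm1}\otimes K^{\pm1}$, $\Delta(E)=E\otimes1+K\otimes E$, $\Delta(F)=F\otimes K^{-1}+1\otimes F$. Let $V(n)$ have basis $v^{n},v^{n-2},\dots,v^{-n}$ with $K^{\pm1}v^w=q^{\pm w}v^w$, $Ev^w=[\tfrac{n-w}2]v^{w+2}$, $Fv^w=[\tfrac{n+w}2]v^{w-2}$. For $s\in\{\pm1\}^n$ let $|s|=\sum_i s_i$, let $\|s\|_+$ (resp. $\|s\|_-$) be the number of pairs $i<j$ with $s_i>s_j$ (resp. $s_i<s_j$),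 and define $$T_n:V(1)^{\otimes n}\to V(n),\quad T_n(v^{s_1}\otimes\cdots\otimes v^{s_n})=q^{\|s\|_+}v^{|s|},$$ $$T_n^*:V(n)\to V(1)^{\otimes n},\quad T_n^*(v^{w})=\binom{n}{(n-w)/2}_q^{-1}\sum_{|s|=w}q^{-\|s\|_-}\,v^{s_1}\otimes\cdots\otimes v^{s_n}.$$ For $a+b=c+d$ let $U_{a,b}^{c,d}=(T_c\otimes T_d)(T_a^*\otimes T_b^*):V(a)\otimes V(b)\to V(c)\otimes V(d)$ and $(U_{a,b}^{c,d})^*=(T_a\otimes T_b)(T_c^*\otimes T_d^*)=U_{c,d}^{a,b}$, and for $-m\le k\le n$ define the cascade operator $$K_{m,n}(k)=(U_{m,n}^{m+k,n-k})^*\,U_{m,n}^{m+k,n-k}\quad\text{on } V(m)\otimes V(n).$$ Let $\delta(1)=v^{-1}\otimes v^{1}-q^{-1}v^{1}\otimes v^{-1}$, let $\varepsilon(v^1\otimes v^{-1})=1$, $\varepsilon(v^{-1}\otimes v^{1})=-q$, $\varepsilon(v^{\pm1}\otimes v^{\pm1})=0$, and let $\delta_\ell:\mathbb F\to V(1)^{\otimes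 2\ell}$, $\varepsilon_\ell:V(1)^{\otimes2\ell}\to\mathbb F$ be $\ell$ nested copies of these arcs. The Temperley–Lieb operators are $$L_{m,n}(\ell)=(T_m\otimes T_n)\bigl(1^{\otimes(m-\ell)}\otimes\delta_\ell\varepsilon_\ell\otimes1^{\otimes(n-\ell)}\bigr)(T_m^*\otimes T_n^*),\qquad 0\le\ell\le\min(m,n).$$ **Quantum case.** The operator $(U_{a,b}^{c,d})^*$ is the adjoint of $U_{a,b}^{c,d}$ for the bilinear forms on $V(m)\otimes V(n)$ in which the vectors $v^{m-2i}\otimes v^{n-2j}$ are orthogonal with values $\bigl(q^{i(m-i)+j(n-j)}\binom mi_q\binom nj_q\bigr)^{-1}$. If $m\ge n$, then $K_{m,n}(0),\dots,K_{m,n}(n)$ is a basis of $\mathrm{End}_{U_q(\mathfrak{sl}_2)}(V(m)\otimes V(n))$, and so is $L_{m,n}(0),\dots,L_{m,n}(n)$. The change of basis is triangular: for $0\le k\le n$, $$K_{m,n}(k)=\sum_{\ell=0}^{k}\frac{\binom m\ell_q\binom k\ell_q}{\binom{m+k}\ell_q}\,L_{m,n}(\ell),$$ and the diagonal coefficients ($\ell=k$)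 are nonzero. **Classical case.** Now let $\mathbb F=\mathbb C$, $q=1$ in all these definitions, and let $SU(2)$ act on $V(n)=\mathbb C^{n+1}$ by $g\mapsto T_n\,g^{\otimes n}\,T_n^*$, that is, as on the symmetric tensors in $(\mathbb C^2)^{\otimes n}$. Then $(U_{a,b}^{c,d})^*$ is the adjoint of $U_{a,b}^{c,d}$ for the Hermitian inner products on $\mathbb C^{m+1}\otimes\mathbb C^{n+1}$ in which the vectors $v^{m-2i}\otimes v^{n-2j}$ are orthogonal with square norms $\binom mi^{-1}\binom nj^{-1}$. If $m\ge n$, then $\{K_{m,n}(k)\}_{k=0}^n$ is a basis of the space of $SU(2)$-intertwiners from $\mathbb C^{m+1}\otimes\mathbb C^{n+1}$ to itself, and so is $\{L_{m,n}(\ell)\}_{\ell=0}^n$, and $K_{m,n}(k)=\sum_{\ell=0}^k\binom m\ell\binom k\ell\binom{m+k}\ell^{-1}L_{m,n}(\ell)$ for $0\le k\le n$. Moreover, if $\tau:\mathbb C^{m+1}\otimes\mathbb C^{n+1}\to\mathbb C^{n+1}\otimes\mathbb C^{m+1}$ is the flip $\tau(v\otimes w)=w\otimes v$, then for all $m,n\in\mathbb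 N$ and $k=-m,\dots,n$, $$\tau^*K_{n,m}(-k)\,\tau=K_{m,n}(k).$$ -/

import Mathlib

open scoped TensorProduct

noncomputable section

namespace Cascade

/-! ## q-numbers -/

section QNumbers
variable {𝕜 : Type*} [Field 𝕜]

/-- `q` is a nonzero element of the field that is not a root of unity; the indeterminate of the
field of rational functions `ℂ(q)` is the basic example, a positive real number `q ≠ 1` another. -/
def Generic (q : 𝕜) : Prop := q ≠ 0 ∧ ∀ j : ℕ, 0 < j → q ^ j ≠ 1

/-- The q-number `[n] = q^(n-1) + q^(n-3) + ⋯ + q^(-n+1)`. -/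
def qNum (q : 𝕜) (n : ℕ) : 𝕜 := ∑ i ∈ Finset.range n, q ^ ((n : ℤ) - 1 - 2 * i)

/-- The q-factorial `[n]! = [1] [2] ⋯ [n]`. -/
def qFact (q : 𝕜) (n : ℕ) : 𝕜 := ∏ i ∈ Finset.range n, qNum q (i + 1)

/-- The q-binomial coefficient `[n]! / ([k]! [n-k]!)` (zero when `n < k`). -/
def qBinom (q : 𝕜) (n k : ℕ) : 𝕜 :=
  if k ≤ n then qFact q n / (qFact q k * qFact q (n - k)) else 0

theorem qNum_zero (q : 𝕜) : qNum q 0 = 0 := by simp [qNum]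

theorem sub_mul_qNum {q : 𝕜} (hq : q ≠ 0) (n : ℕ) :
    (q - q⁻¹) * qNum q n = q ^ (n : ℤ) - q ^ (-(n : ℤ)) := by
  have h : ∀ i : ℕ, (q - q⁻¹) * q ^ ((n : ℤ) - 1 - 2 * i)
      = q ^ ((n : ℤ) - 2 * (i : ℕ)) - q ^ ((n : ℤ) - 2 * ((i + 1 : ℕ) : ℤ)) := by
    intro i
    rw [sub_mul, ← zpow_one_add₀ hq, ← zpow_neg_one, ← zpow_add₀ hq]
    congr 2
    · ring
    · push_cast; ring
  rw [qNum, Finset.mul_sum, Finset.sum_congr rfl fun i _ => h i,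
    Finset.sum_range_sub' (fun i : ℕ => q ^ ((n : ℤ) - 2 * (i : ℕ)))]
  congr 2
  ring

theorem Generic.sub_inv_ne_zero {q : 𝕜} (hq : Generic q) : q - q⁻¹ ≠ 0 := by
  intro h
  refine hq.2 2 two_pos ?_
  have h1 : q = q⁻¹ := sub_eq_zero.mp h
  calc q ^ 2 = q * q := sq q
    _ = q * q⁻¹ := by rw [← h1]
    _ = 1 := mul_inv_cancel₀ hq.1

end QNumbers

/-! ## The quantum group -/

section QuantumGroup
variable {𝕜 : Type*} [Field 𝕜]

/-- Names of the generators `K, K⁻¹, E, F`. -/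
inductive Gen : Type
  | K | Kinv | E | F

open FreeAlgebra in
/-- The defining relations of `U_q(sl₂)`. -/
inductive UqRel (q : 𝕜) : FreeAlgebra 𝕜 Gen → FreeAlgebra 𝕜 Gen → Prop
  | K_Kinv : UqRel q (ι 𝕜 Gen.K * ι 𝕜 Gen.Kinv) 1
  | Kinv_K : UqRel q (ι 𝕜 Gen.Kinv * ι 𝕜 Gen.K) 1
  | K_E : UqRel q (ι 𝕜 Gen.K * ι 𝕜 Gen.E) (q ^ 2 • (ι 𝕜 Gen.E * ι 𝕜 Gen.K))
  | K_F : UqRel q (ι 𝕜 Gen.K * ι 𝕜 Gen.F) ((q ^ 2)⁻¹ • (ι 𝕜 Gen.F * ι 𝕜 Gen.K))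
  | E_F : UqRel q (ι 𝕜 Gen.E * ι 𝕜 Gen.F - ι 𝕜 Gen.F * ι 𝕜 Gen.E)
      ((q - q⁻¹)⁻¹ • (ι 𝕜 Gen.K - ι 𝕜 Gen.Kinv))

/-- The associative algebra `U_q(sl₂)`, by generators and relations. -/
abbrev Uq (q : 𝕜) : Type _ := RingQuot (UqRel q)

/-- The class of a generator in `U_q(sl₂)`. -/
def Uq.gen (q : 𝕜) (x : Gen) : Uq q := RingQuot.mkAlgHom 𝕜 (UqRel q) (FreeAlgebra.ι 𝕜 x)

theorem Uq.K_Kinv (q : 𝕜) : Uq.gen q Gen.K * Uq.gen q Gen.Kinv = 1 := by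
  simpa [Uq.gen] using RingQuot.mkAlgHom_rel 𝕜 (UqRel.K_Kinv (q := q))

theorem Uq.Kinv_K (q : 𝕜) : Uq.gen q Gen.Kinv * Uq.gen q Gen.K = 1 := by
  simpa [Uq.gen] using RingQuot.mkAlgHom_rel 𝕜 (UqRel.Kinv_K (q := q))

theorem Uq.K_E (q : 𝕜) :
    Uq.gen q Gen.K * Uq.gen q Gen.E = q ^ 2 • (Uq.gen q Gen.E * Uq.gen q Gen.K) := by
  simpa [Uq.gen] using RingQuot.mkAlgHom_rel 𝕜 (UqRel.K_E (q := q))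

theorem Uq.K_F (q : 𝕜) :
    Uq.gen q Gen.K * Uq.gen q Gen.F = (q ^ 2)⁻¹ • (Uq.gen q Gen.F * Uq.gen q Gen.K) := by
  simpa [Uq.gen] using RingQuot.mkAlgHom_rel 𝕜 (UqRel.K_F (q := q))

theorem Uq.E_F (q : 𝕜) :
    Uq.gen q Gen.E * Uq.gen q Gen.F - Uq.gen q Gen.F * Uq.gen q Gen.E
      = (q - q⁻¹)⁻¹ • (Uq.gen q Gen.K - Uq.gen q Gen.Kinv) := by
  simpa [Uq.gen] using RingQuot.mkAlgHom_rel 𝕜 (UqRel.E_F (q := q))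

theorem Uq.E_Kinv {q : 𝕜} :
    Uq.gen q Gen.E * Uq.gen q Gen.Kinv = q ^ 2 • (Uq.gen q Gen.Kinv * Uq.gen q Gen.E) := by
  have h := congrArg (fun x => Uq.gen q Gen.Kinv * x * Uq.gen q Gen.Kinv) (Uq.K_E q)
  simp only [mul_smul_comm, smul_mul_assoc] at h
  rw [← mul_assoc, Uq.Kinv_K, one_mul] at h
  rw [h, ← mul_assoc, mul_assoc (_ * _), Uq.K_Kinv, mul_one]

/-- Lifting an assignment of the generators satisfying the relations to `U_q(sl₂)`. -/
def Uq.lift {A : Type*} [Ring A] [Algebra 𝕜 A] (q : 𝕜) (g : Gen → A)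
    (h : ∀ ⦃x y⦄, UqRel q x y → FreeAlgebra.lift 𝕜 g x = FreeAlgebra.lift 𝕜 g y) : Uq q →ₐ[𝕜] A :=
  RingQuot.liftAlgHom 𝕜 ⟨FreeAlgebra.lift 𝕜 g, h⟩

theorem Uq.lift_gen {A : Type*} [Ring A] [Algebra 𝕜 A] (q : 𝕜) (g : Gen → A)
    (h : ∀ ⦃x y⦄, UqRel q x y → FreeAlgebra.lift 𝕜 g x = FreeAlgebra.lift 𝕜 g y) (x : Gen) :
    Uq.lift q g h (Uq.gen q x) = g x := by
  simp [Uq.lift, Uq.gen, RingQuot.liftAlgHom_mkAlgHom_apply]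

/-- The coproduct on generators: `Δ(K^±) = K^± ⊗ K^±`, `Δ(E) = E ⊗ 1 + K ⊗ E`,
`Δ(F) = F ⊗ K⁻¹ + 1 ⊗ F`. -/
def comulGen (q : 𝕜) : Gen → Uq q ⊗[𝕜] Uq q
  | Gen.K => Uq.gen q Gen.K ⊗ₜ Uq.gen q Gen.K
  | Gen.Kinv => Uq.gen q Gen.Kinv ⊗ₜ Uq.gen q Gen.Kinv
  | Gen.E => Uq.gen q Gen.E ⊗ₜ 1 + Uq.gen q Gen.K ⊗ₜ Uq.gen q Gen.E
  | Gen.F => Uq.gen q Gen.F ⊗ₜ Uq.gen q Gen.Kinv + 1 ⊗ₜ Uq.gen q Gen.F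

theorem comulGen_rel {q : 𝕜} (hq : Generic q) ⦃x y : FreeAlgebra 𝕜 Gen⦄ (h : UqRel q x y) :
    FreeAlgebra.lift 𝕜 (comulGen q) x = FreeAlgebra.lift 𝕜 (comulGen q) y := by
  have hq2 : q ^ 2 ≠ 0 := pow_ne_zero 2 hq.1
  cases h with
  | K_Kinv =>
    simp [comulGen, Uq.K_Kinv, Algebra.TensorProduct.one_def]
  | Kinv_K =>
    simp [comulGen, Uq.Kinv_K, Algebra.TensorProduct.one_def]
  | K_E =>
    simp [comulGen, mul_add, add_mul, Uq.K_E, TensorProduct.smul_tmul']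
  | K_F =>
    simp [comulGen, mul_add, add_mul, Uq.K_F, Uq.K_Kinv, Uq.Kinv_K, TensorProduct.smul_tmul']
  | E_F =>
    have e1 : Uq.gen q Gen.E * Uq.gen q Gen.F = Uq.gen q Gen.F * Uq.gen q Gen.E
        + (q - q⁻¹)⁻¹ • (Uq.gen q Gen.K - Uq.gen q Gen.Kinv) := by
      rw [← Uq.E_F]; abel
    simp only [comulGen, map_sub, map_mul, map_smul, FreeAlgebra.lift_ι_apply, mul_add, add_mul,
      Algebra.TensorProduct.tmul_mul_tmul, one_mul, mul_one, e1, Uq.K_F, Uq.E_Kinv]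
    simp only [TensorProduct.add_tmul, TensorProduct.tmul_add, TensorProduct.tmul_smul,
      ← TensorProduct.smul_tmul', TensorProduct.sub_tmul, TensorProduct.tmul_sub, smul_smul,
      smul_sub, mul_inv_cancel₀ hq2, one_smul]
    abel

/-- The coproduct `Δ : U_q(sl₂) → U_q(sl₂) ⊗ U_q(sl₂)`. -/
def comul {q : 𝕜} (hq : Generic q) : Uq q →ₐ[𝕜] Uq q ⊗[𝕜] Uq q :=
  Uq.lift q (comulGen q) (comulGen_rel hq)

variable (𝕜) in
/-- The vector space `V(n)` with basis `v^n, v^(n-2), …, v^(-n)`;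
the `j`-th basis vector is `v^(n-2j)`, so `j` counts the down arrows. -/
abbrev V (n : ℕ) : Type _ := Fin (n + 1) →₀ 𝕜

variable (𝕜) in
/-- The basis vector `v^(n-2j)` of `V(n)`. -/
abbrev vec (n : ℕ) (j : Fin (n + 1)) : V 𝕜 n := Finsupp.single j 1

/-- The generators on `V(n)`: `K^± v^w = q^(±w) v^w`, `E v^w = [(n-w)/2] v^(w+2)`,
`F v^w = [(n+w)/2] v^(w-2)`, where `w = n - 2j`. -/
def repGen (q : 𝕜) (n : ℕ) : Gen → Module.End 𝕜 (V 𝕜 n)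
  | Gen.K => Finsupp.linearCombination 𝕜 fun j => q ^ ((n : ℤ) - 2 * (j : ℕ)) • vec 𝕜 n j
  | Gen.Kinv => Finsupp.linearCombination 𝕜 fun j => q ^ (-((n : ℤ) - 2 * (j : ℕ))) • vec 𝕜 n j
  | Gen.E => Finsupp.linearCombination 𝕜 fun j =>
      if (j : ℕ) = 0 then 0
      else qNum q (j : ℕ) • vec 𝕜 n ⟨(j : ℕ) - 1, lt_of_le_of_lt (Nat.sub_le _ _) j.2⟩
  | Gen.F => Finsupp.linearCombination 𝕜 fun j =>
      if h : (j : ℕ) + 1 < n + 1 then qNum q (n - (j : ℕ)) • vec 𝕜 n ⟨(j : ℕ) + 1, h⟩ else 0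

theorem repGen_K (q : 𝕜) (n : ℕ) (j : Fin (n + 1)) :
    repGen q n Gen.K (vec 𝕜 n j) = q ^ ((n : ℤ) - 2 * (j : ℕ)) • vec 𝕜 n j := by
  rw [repGen, Finsupp.linearCombination_single, one_smul]

theorem repGen_Kinv (q : 𝕜) (n : ℕ) (j : Fin (n + 1)) :
    repGen q n Gen.Kinv (vec 𝕜 n j) = q ^ (-((n : ℤ) - 2 * (j : ℕ))) • vec 𝕜 n j := by
  rw [repGen, Finsupp.linearCombination_single, one_smul]

theorem repGen_E (q : 𝕜) (n : ℕ) (j : Fin (n + 1)) :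
    repGen q n Gen.E (vec 𝕜 n j) = if (j : ℕ) = 0 then 0
      else qNum q (j : ℕ) • vec 𝕜 n ⟨(j : ℕ) - 1, lt_of_le_of_lt (Nat.sub_le _ _) j.2⟩ := by
  rw [repGen, Finsupp.linearCombination_single, one_smul]

theorem repGen_F (q : 𝕜) (n : ℕ) (j : Fin (n + 1)) :
    repGen q n Gen.F (vec 𝕜 n j) = if h : (j : ℕ) + 1 < n + 1 then
      qNum q (n - (j : ℕ)) • vec 𝕜 n ⟨(j : ℕ) + 1, h⟩ else 0 := by
  rw [repGen, Finsupp.linearCombination_single, one_smul]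

theorem end_ext {n : ℕ} {f g : Module.End 𝕜 (V 𝕜 n)} (h : ∀ j, f (vec 𝕜 n j) = g (vec 𝕜 n j)) :
    f = g :=
  Finsupp.lhom_ext' fun j => LinearMap.ext_ring (h j)

theorem qNum_comm {q : 𝕜} (hq : Generic q) (a b : ℕ) :
    qNum q a * qNum q (b + 1) - qNum q b * qNum q (a + 1)
      = (q - q⁻¹)⁻¹ * (q ^ ((a : ℤ) - b) - q ^ (-((a : ℤ) - b))) := by
  have hq0 := hq.1
  have hs := hq.sub_inv_ne_zero
  apply mul_left_cancel₀ (mul_ne_zero hs hs)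
  have h1 := sub_mul_qNum hq0 a
  have h2 := sub_mul_qNum hq0 b
  have h3 := sub_mul_qNum hq0 (a + 1)
  have h4 := sub_mul_qNum hq0 (b + 1)
  calc _ = ((q - q⁻¹) * qNum q a) * ((q - q⁻¹) * qNum q (b + 1))
        - ((q - q⁻¹) * qNum q b) * ((q - q⁻¹) * qNum q (a + 1)) := by ring
    _ = (q - q⁻¹) * (q ^ ((a : ℤ) - b) - q ^ (-((a : ℤ) - b))) := by
        rw [h1, h2, h3, h4]
        push_cast
        simp only [neg_sub, neg_add, zpow_add₀ hq0, zpow_sub₀ hq0, zpow_neg, zpow_one]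
        have ha : q ^ (a : ℤ) ≠ 0 := zpow_ne_zero _ hq0
        have hb : q ^ (b : ℤ) ≠ 0 := zpow_ne_zero _ hq0
        field_simp
        ring
    _ = _ := by rw [mul_assoc, mul_inv_cancel_left₀ hs]

theorem repGen_rel {q : 𝕜} (hq : Generic q) (n : ℕ) ⦃x y : FreeAlgebra 𝕜 Gen⦄
    (h : UqRel q x y) :
    FreeAlgebra.lift 𝕜 (repGen q n) x = FreeAlgebra.lift 𝕜 (repGen q n) y := by
  have hq0 := hq.1
  cases h <;> refine end_ext fun j => ?_ <;>
    simp only [map_mul, map_smul, map_sub, map_one, FreeAlgebra.lift_ι_apply, Module.End.mul_apply,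
      LinearMap.smul_apply, LinearMap.sub_apply, Module.End.one_apply]
  case K_Kinv =>
    rw [repGen_Kinv, map_smul, repGen_K, smul_smul, ← zpow_add₀ hq0, neg_add_cancel, zpow_zero,
      one_smul]
  case Kinv_K =>
    rw [repGen_K, map_smul, repGen_Kinv, smul_smul, ← zpow_add₀ hq0, add_neg_cancel, zpow_zero,
      one_smul]
  case K_E =>
    rw [repGen_K, map_smul, repGen_E]
    split_ifs with hj
    · simp
    · rw [map_smul, repGen_K, smul_smul, smul_smul, smul_smul]
      congr 1
      have : (((j : ℕ) - 1 : ℕ) : ℤ) = (j : ℕ) - 1 := by omega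
      rw [this, mul_comm, ← zpow_natCast, ← zpow_add₀ hq0]
      congr 2; push_cast; ring
  case K_F =>
    rw [repGen_K, map_smul, repGen_F]
    split_ifs with hj
    · rw [map_smul, repGen_K, smul_smul, smul_smul, smul_smul]
      congr 1
      rw [mul_comm, ← zpow_natCast, ← zpow_neg, ← zpow_add₀ hq0]
      congr 2; push_cast; ring
    · simp
  case E_F =>
    have hjn : (j : ℕ) ≤ n := Nat.lt_succ_iff.mp j.2
    have hEF : (repGen q n Gen.E) ((repGen q n Gen.F) (vec 𝕜 n j))
        = (qNum q (n - (j : ℕ)) * qNum q ((j : ℕ) + 1)) • vec 𝕜 n j := by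
      rw [repGen_F]
      split_ifs with hj
      · rw [map_smul, repGen_E, if_neg (Nat.succ_ne_zero _), smul_smul]
        rfl
      · have : n - (j : ℕ) = 0 := by omega
        rw [this, qNum_zero, zero_mul, zero_smul, map_zero]
    have hFE : (repGen q n Gen.F) ((repGen q n Gen.E) (vec 𝕜 n j))
        = (qNum q (j : ℕ) * qNum q (n - (j : ℕ) + 1)) • vec 𝕜 n j := by
      rw [repGen_E]
      split_ifs with hj
      · rw [hj, qNum_zero, zero_mul, zero_smul, map_zero]
      · have h1 : (j : ℕ) - 1 + 1 = (j : ℕ) := by omega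
        have h2 : n - ((j : ℕ) - 1) = n - (j : ℕ) + 1 := by omega
        rw [map_smul, repGen_F, dif_pos (show (j : ℕ) - 1 + 1 < n + 1 by omega), smul_smul]
        simp only [h1, h2]
    rw [hEF, hFE, repGen_K, repGen_Kinv, ← sub_smul, ← sub_smul, smul_smul, qNum_comm hq]
    have hc : ((n - (j : ℕ) : ℕ) : ℤ) - (j : ℕ) = (n : ℤ) - 2 * (j : ℕ) := by omega
    rw [hc]

/-- The representation `V(n)` of `U_q(sl₂)`. -/
def rep {q : 𝕜} (hq : Generic q) (n : ℕ) : Uq q →ₐ[𝕜] Module.End 𝕜 (V 𝕜 n) :=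
  Uq.lift q (repGen q n) (repGen_rel hq n)

/-- The action of `U_q(sl₂)` on `V(m) ⊗ V(n)` through the coproduct. -/
def tensorRep {q : 𝕜} (hq : Generic q) (m n : ℕ) :
    Uq q →ₐ[𝕜] Module.End 𝕜 (V 𝕜 m ⊗[𝕜] V 𝕜 n) :=
  ((Module.endTensorEndAlgHom (R := 𝕜) (S := 𝕜) (A := 𝕜) (M := V 𝕜 m) (N := V 𝕜 n)).comp
    (Algebra.TensorProduct.map (rep hq m) (rep hq n))).comp (comul hq)

/-- The space of intertwiners `End_{U_q(sl₂)}(V(m) ⊗ V(n))`. -/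
def intertwiners {q : 𝕜} (hq : Generic q) (m n : ℕ) :
    Submodule 𝕜 (Module.End 𝕜 (V 𝕜 m ⊗[𝕜] V 𝕜 n)) :=
  (Subalgebra.centralizer 𝕜 (Set.range (tensorRep hq m n))).toSubmodule

end QuantumGroup

/-! ## Symmetrizers, the cascade operators and the Temperley-Lieb operators -/

section Diagrams
variable {𝕜 : Type*} [Field 𝕜]

/-- The basis of `V(1)^{⊗n}` consisting of the vectors `v^{s₁} ⊗ ⋯ ⊗ v^{sₙ}`; the value
`0` of `s i : Fin 2` stands for `v^1` (up arrow), the value `1` for `v^{-1}` (down arrow). -/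
def spinBasis (𝕜 : Type*) [Field 𝕜] (n : ℕ) : Module.Basis (Fin n → Fin 2) 𝕜 (⨂[𝕜]^n (V 𝕜 1)) :=
  Basis.piTensorProduct fun _ => Finsupp.basisSingleOne

/-- The number of down arrows in `s`. -/
def downs {n : ℕ} (s : Fin n → Fin 2) : ℕ := ∑ i, (s i : ℕ)

theorem downs_lt {n : ℕ} (s : Fin n → Fin 2) : downs s < n + 1 := by
  have : downs s ≤ ∑ _i : Fin n, 1 := Finset.sum_le_sum fun i _ => by omega
  simp at this
  omega

/-- `‖s‖₊`: the number of pairs `i < j` with an up arrow at `i` and a down arrow at `j`. -/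
def normPlus {n : ℕ} (s : Fin n → Fin 2) : ℕ :=
  (Finset.univ.filter fun p : Fin n × Fin n => p.1 < p.2 ∧ s p.1 = 0 ∧ s p.2 = 1).card

/-- `‖s‖₋`: the number of pairs `i < j` with a down arrow at `i` and an up arrow at `j`. -/
def normMinus {n : ℕ} (s : Fin n → Fin 2) : ℕ :=
  (Finset.univ.filter fun p : Fin n × Fin n => p.1 < p.2 ∧ s p.1 = 1 ∧ s p.2 = 0).card

/-- `T_n : V(1)^{⊗n} → V(n)`, `v^{s₁} ⊗ ⋯ ⊗ v^{sₙ} ↦ q^{‖s‖₊} v^{|s|}`. -/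
def T (q : 𝕜) (n : ℕ) : ⨂[𝕜]^n (V 𝕜 1) →ₗ[𝕜] V 𝕜 n :=
  (spinBasis 𝕜 n).constr 𝕜 fun s => q ^ normPlus s • vec 𝕜 n ⟨downs s, downs_lt s⟩

/-- `T_n^* : V(n) → V(1)^{⊗n}`, which sends the vector `v^{n-2j}` to
`[n choose j]⁻¹ ∑ q^{-‖s‖₋} v^{s₁} ⊗ ⋯ ⊗ v^{sₙ}`, the sum being over the `s` with `j` down arrows. -/
def Tstar (q : 𝕜) (n : ℕ) : V 𝕜 n →ₗ[𝕜] ⨂[𝕜]^n (V 𝕜 1) :=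
  Finsupp.linearCombination 𝕜 fun j : Fin (n + 1) =>
    (qBinom q n j)⁻¹ • ∑ s : Fin n → Fin 2 with downs s = j,
      q ^ (-(normMinus s : ℤ)) • spinBasis 𝕜 n s

/-- The identification of `V(1)^{⊗a} ⊗ V(1)^{⊗b}` with `V(1)^{⊗c} ⊗ V(1)^{⊗d}` for
`a + b = c + d`, which keeps the left-to-right order of the tensor factors. -/
def regroup (𝕜 : Type*) [Field 𝕜] {a b c d : ℕ} (h : a + b = c + d) :
    (⨂[𝕜]^a (V 𝕜 1)) ⊗[𝕜] (⨂[𝕜]^b (V 𝕜 1)) ≃ₗ[𝕜] (⨂[𝕜]^c (V 𝕜 1)) ⊗[𝕜] (⨂[𝕜]^d (V 𝕜 1)) :=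
  TensorPower.mulEquiv ≪≫ₗ TensorPower.cast 𝕜 (V 𝕜 1) h ≪≫ₗ TensorPower.mulEquiv.symm

/-- `U_{a,b}^{c,d} = (T_c ⊗ T_d) (T_a^* ⊗ T_b^*) : V(a) ⊗ V(b) → V(c) ⊗ V(d)`. -/
def U (q : 𝕜) {a b c d : ℕ} (h : a + b = c + d) : V 𝕜 a ⊗[𝕜] V 𝕜 b →ₗ[𝕜] V 𝕜 c ⊗[𝕜] V 𝕜 d :=
  TensorProduct.map (T q c) (T q d) ∘ₗ (regroup 𝕜 h).toLinearMap ∘ₗ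
    TensorProduct.map (Tstar q a) (Tstar q b)

/-- The symmetric bilinear form on `V(m) ⊗ V(n)` for which the vectors `v^{m-2i} ⊗ v^{n-2j}` are
orthogonal with values `q^{-i(m-i)} [m choose i]⁻¹ q^{-j(n-j)} [n choose j]⁻¹`. These are the weights
for which `T_n^*` is the adjoint of `T_n` when the vectors `v^{s₁} ⊗ ⋯ ⊗ v^{sₙ}` are orthonormal. -/
def tensorForm (q : 𝕜) (m n : ℕ) (x y : V 𝕜 m ⊗[𝕜] V 𝕜 n) : 𝕜 :=
  ∑ i : Fin (m + 1), ∑ j : Fin (n + 1),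
    finsuppTensorFinsupp' 𝕜 _ _ x (i, j) * finsuppTensorFinsupp' 𝕜 _ _ y (i, j) /
      (q ^ ((i : ℕ) * (m - i)) * qBinom q m i * (q ^ ((j : ℕ) * (n - j)) * qBinom q n j))

theorem add_eq_toNat {m n : ℕ} {k : ℤ} (h : -(m : ℤ) ≤ k ∧ k ≤ n) :
    m + n = ((m : ℤ) + k).toNat + ((n : ℤ) - k).toNat := by omega

/-- The cascade operator `K_{m,n}(k) = (U_{m,n}^{m+k,n-k})^* U_{m,n}^{m+k,n-k}` on `V(m) ⊗ V(n)`,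
for `-m ≤ k ≤ n` (outside of this range, where it is not defined, the value is `0`).
The `*` turns the diagram upside down, `((T_c ⊗ T_d) (T_a^* ⊗ T_b^*))^* = (T_a ⊗ T_b) (T_c^* ⊗ T_d^*)`,
so `(U_{a,b}^{c,d})^* = U_{c,d}^{a,b}`; that this is the adjoint with respect to the forms
`tensorForm` (and `tensorInner` in the classical case) is a part of the theorem. -/
def cascade (q : 𝕜) (m n : ℕ) (k : ℤ) : Module.End 𝕜 (V 𝕜 m ⊗[𝕜] V 𝕜 n) :=
  if h : -(m : ℤ) ≤ k ∧ k ≤ n then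
    U q (add_eq_toNat h).symm ∘ₗ U q (add_eq_toNat h)
  else 0

/-- Coefficient of `v^s ⊗ v^t` in `δ(1) = v^{-1} ⊗ v^1 - q⁻¹ v^1 ⊗ v^{-1}`. -/
def cupCoeff (q : 𝕜) (s t : Fin 2) : 𝕜 :=
  if s = 1 ∧ t = 0 then 1 else if s = 0 ∧ t = 1 then -q⁻¹ else 0

/-- The value `ε(v^s ⊗ v^t)`: `ε(v^1 ⊗ v^{-1}) = 1`, `ε(v^{-1} ⊗ v^1) = -q`, and `0` otherwise. -/
def capCoeff (q : 𝕜) (s t : Fin 2) : 𝕜 :=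
  if s = 0 ∧ t = 1 then 1 else if s = 1 ∧ t = 0 then -q else 0

/-- `l` nested arcs `V(0) → V(1)^{⊗l} ⊗ V(1)^{⊗l}`, each arc being a copy of `δ`: position `i` of the
left factor is joined to position `l-1-i` of the right factor. -/
def nestedDelta (q : 𝕜) (l : ℕ) : (⨂[𝕜]^l (V 𝕜 1)) ⊗[𝕜] (⨂[𝕜]^l (V 𝕜 1)) :=
  ∑ s : Fin l → Fin 2, ∑ t : Fin l → Fin 2,
    (∏ i, cupCoeff q (s i) (t i.rev)) • (spinBasis 𝕜 l s ⊗ₜ[𝕜] spinBasis 𝕜 l t)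

/-- `l` nested arcs `V(1)^{⊗l} ⊗ V(1)^{⊗l} → V(0)`, each arc being a copy of `ε`. -/
def nestedEpsilon (q : 𝕜) (l : ℕ) : (⨂[𝕜]^l (V 𝕜 1)) ⊗[𝕜] (⨂[𝕜]^l (V 𝕜 1)) →ₗ[𝕜] 𝕜 :=
  ((spinBasis 𝕜 l).tensorProduct (spinBasis 𝕜 l)).constr 𝕜 fun p =>
    ∏ i, capCoeff q (p.1 i) (p.2 i.rev)

/-- Cut the strands of `V(1)^{⊗m} ⊗ V(1)^{⊗n}` into groups of `m-l`, `l`, `l`, `n-l`, with the two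
middle groups put together. -/
def cut (𝕜 : Type*) [Field 𝕜] {m n l : ℕ} (hm : l ≤ m) (hn : l ≤ n) :
    (⨂[𝕜]^m (V 𝕜 1)) ⊗[𝕜] (⨂[𝕜]^n (V 𝕜 1)) ≃ₗ[𝕜]
      (⨂[𝕜]^(m - l) (V 𝕜 1)) ⊗[𝕜]
        (((⨂[𝕜]^l (V 𝕜 1)) ⊗[𝕜] (⨂[𝕜]^l (V 𝕜 1))) ⊗[𝕜] (⨂[𝕜]^(n - l) (V 𝕜 1))) :=
  TensorProduct.congr
      (TensorPower.cast 𝕜 (V 𝕜 1) (Nat.sub_add_cancel hm).symm ≪≫ₗ TensorPower.mulEquiv.symm)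
      (TensorPower.cast 𝕜 (V 𝕜 1) (Nat.add_sub_cancel' hn).symm ≪≫ₗ TensorPower.mulEquiv.symm) ≪≫ₗ
    TensorProduct.assoc 𝕜 _ _ _ ≪≫ₗ
    TensorProduct.congr (LinearEquiv.refl 𝕜 _) (TensorProduct.assoc 𝕜 _ _ _).symm

/-- The Temperley-Lieb diagram `1^{⊗(m-l)} ⊗ (δ_l ε_l) ⊗ 1^{⊗(n-l)}` with `l` nested arcs at the top,
`l` nested arcs at the bottom and straight lines elsewhere, as an operator. -/
def arcs (q : 𝕜) {m n l : ℕ} (hm : l ≤ m) (hn : l ≤ n) :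
    Module.End 𝕜 ((⨂[𝕜]^m (V 𝕜 1)) ⊗[𝕜] (⨂[𝕜]^n (V 𝕜 1))) :=
  (cut 𝕜 hm hn).symm.toLinearMap ∘ₗ
    TensorProduct.map LinearMap.id
      (TensorProduct.map ((nestedEpsilon q l).smulRight (nestedDelta q l)) LinearMap.id) ∘ₗ
    (cut 𝕜 hm hn).toLinearMap

/-- The element with `l` arcs of the Temperley-Lieb basis of the intertwiners of `V(m) ⊗ V(n)`, that
is, `(T_m ⊗ T_n) (1^{⊗(m-l)} ⊗ (δ_l ε_l) ⊗ 1^{⊗(n-l)}) (T_m^* ⊗ T_n^*)`, for `l ≤ min(m, n)`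
(outside of this range, where it is not defined, the value is `0`). -/
def temperleyLieb (q : 𝕜) (m n l : ℕ) : Module.End 𝕜 (V 𝕜 m ⊗[𝕜] V 𝕜 n) :=
  if h : l ≤ m ∧ l ≤ n then
    TensorProduct.map (T q m) (T q n) ∘ₗ arcs q h.1 h.2 ∘ₗ
      TensorProduct.map (Tstar q m) (Tstar q n)
  else 0

/-- The coefficient `[m choose l] [k choose l] / [m+k choose l]`. -/
def changeCoeff (q : 𝕜) (m k l : ℕ) : 𝕜 := qBinom q m l * qBinom q k l / qBinom q (m + k) l

end Diagrams

/-! ## The classical case: `SU(2)` acting on `ℂ^{n+1}` -/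

section Classical

/-- The group `SU(2)`. -/
abbrev SU2 : Type := Matrix.specialUnitaryGroup (Fin 2) ℂ

/-- The defining representation of `SU(2)` on `ℂ² = V(1)`. -/
def defRep : Representation ℂ SU2 (V ℂ 1) where
  toFun g := Matrix.toLin (Finsupp.basisSingleOne (R := ℂ) (ι := Fin 2))
    (Finsupp.basisSingleOne (R := ℂ) (ι := Fin 2)) (g : Matrix (Fin 2) (Fin 2) ℂ)
  map_one' := by simp; rfl
  map_mul' g h := by
    simp only [Submonoid.coe_mul]
    rw [Matrix.toLin_mul (Finsupp.basisSingleOne (R := ℂ) (ι := Fin 2))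
      (Finsupp.basisSingleOne (R := ℂ) (ι := Fin 2))]
    rfl

/-- The diagonal action `g ⊗ ⋯ ⊗ g` of `SU(2)` on `(ℂ²)^{⊗n}`. -/
def powMap (n : ℕ) (g : SU2) : Module.End ℂ (⨂[ℂ]^n (V ℂ 1)) :=
  PiTensorProduct.map fun _ => defRep g

theorem qFact_one (n : ℕ) : qFact (1 : ℂ) n = n.factorial := by
  simp [qFact, qNum, ← Finset.prod_range_add_one_eq_factorial]

theorem qBinom_one (n k : ℕ) : qBinom (1 : ℂ) n k = n.choose k := by
  unfold qBinom
  split_ifs with h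
  · rw [qFact_one, qFact_one, qFact_one, Nat.cast_choose ℂ h]
  · rw [Nat.choose_eq_zero_of_lt (not_le.mp h), Nat.cast_zero]

theorem downs_eq_card {n : ℕ} (s : Fin n → Fin 2) :
    downs s = (Finset.univ.filter fun i => s i = 1).card := by
  rw [downs, Finset.card_filter]
  refine Finset.sum_congr rfl fun i _ => ?_
  generalize s i = a
  fin_cases a <;> rfl

theorem card_downs (n j : ℕ) :
    (Finset.univ.filter fun s : Fin n → Fin 2 => downs s = j).card = n.choose j := by
  have h : (Finset.powersetCard j (Finset.univ : Finset (Fin n))).card = n.choose j := by simp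
  rw [← h]
  refine Finset.card_bij' (fun s _ => Finset.univ.filter fun i => s i = 1)
    (fun S _ i => if i ∈ S then 1 else 0) ?_ ?_ ?_ ?_
  · intro s hs
    simpa [Finset.mem_powersetCard, downs_eq_card] using hs
  · intro S hS
    simpa [Finset.mem_powersetCard, downs_eq_card] using hS
  · intro s _
    funext i
    simp only [Finset.mem_filter, Finset.mem_univ, true_and]
    generalize s i = a
    fin_cases a <;> rfl
  · intro S _
    ext i
    simp

theorem exists_perm_of_downs_eq {n : ℕ} {s t : Fin n → Fin 2} (h : downs s = downs t) :
    ∃ e : Equiv.Perm (Fin n), ∀ i, t (e i) = s i := by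
  have h1 : (Finset.univ.filter fun i => s i = 1).card
      = (Finset.univ.filter fun i => t i = 1).card := by
    rw [← downs_eq_card, ← downs_eq_card, h]
  have h0 : ∀ r : Fin n → Fin 2, (Finset.univ.filter fun i => r i = 0).card
      = n - (Finset.univ.filter fun i => r i = 1).card := by
    intro r
    have h2 := Finset.card_filter_add_card_filter_not (s := (Finset.univ : Finset (Fin n)))
      (fun i => r i = 1)
    have h3 : (Finset.univ.filter fun i => ¬ r i = 1) = Finset.univ.filter fun i => r i = 0 := by
      refine Finset.filter_congr fun i _ => ?_
      generalize r i = a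
      fin_cases a <;> simp
    rw [h3, Finset.card_univ, Fintype.card_fin] at h2
    omega
  have hc : ∀ c : Fin 2, Fintype.card {i // s i = c} = Fintype.card {i // t i = c} := by
    intro c
    rw [Fintype.card_subtype, Fintype.card_subtype]
    fin_cases c
    · exact (h0 s).trans ((congrArg (n - ·) h1).trans (h0 t).symm)
    · exact h1
  exact ⟨Equiv.ofFiberEquiv fun c => Fintype.equivOfCardEq (hc c),
    fun i => Equiv.ofFiberEquiv_map _ i⟩

theorem T_spinBasis (n : ℕ) (s : Fin n → Fin 2) :
    T (1 : ℂ) n (spinBasis ℂ n s) = vec ℂ n ⟨downs s, downs_lt s⟩ := by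
  rw [T, Module.Basis.constr_basis, one_pow, one_smul]

theorem Tstar_vec (n : ℕ) (j : Fin (n + 1)) :
    Tstar (1 : ℂ) n (vec ℂ n j) = ((n.choose j : ℕ) : ℂ)⁻¹ •
      ∑ s : Fin n → Fin 2 with downs s = j, spinBasis ℂ n s := by
  rw [Tstar, Finsupp.linearCombination_single, one_smul, qBinom_one]
  simp only [one_zpow, one_smul]

theorem T_reindex (n : ℕ) (e : Equiv.Perm (Fin n)) (x : Fin n → V ℂ 1) :
    T (1 : ℂ) n (PiTensorProduct.tprod ℂ fun i => x (e i)) = T 1 n (PiTensorProduct.tprod ℂ x) := by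
  have h : T (1 : ℂ) n ∘ₗ (PiTensorProduct.reindex ℂ (fun _ => V ℂ 1) e.symm).toLinearMap
      = T 1 n := by
    refine (spinBasis ℂ n).ext fun s => ?_
    have h1 : PiTensorProduct.reindex ℂ (fun _ => V ℂ 1) e.symm (spinBasis ℂ n s)
        = spinBasis ℂ n (fun i => s (e i)) := by
      simp only [spinBasis, Basis.piTensorProduct_apply]
      exact PiTensorProduct.reindex_tprod _ _
    rw [LinearMap.comp_apply, LinearEquiv.coe_coe, h1, T_spinBasis, T_spinBasis]
    congr 2
    exact Equiv.sum_comp e fun i => (s i : ℕ)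
  rw [← LinearMap.congr_fun h (PiTensorProduct.tprod ℂ x), LinearMap.comp_apply,
    LinearEquiv.coe_coe]
  congr 1
  exact (PiTensorProduct.reindex_tprod (R := ℂ) (s := fun _ : Fin n => V ℂ 1) e.symm x).symm

theorem choose_ne_zero {n : ℕ} (j : Fin (n + 1)) : ((n.choose j : ℕ) : ℂ) ≠ 0 :=
  Nat.cast_ne_zero.mpr (Nat.choose_pos (Nat.lt_succ_iff.mp j.2)).ne'

theorem T_Tstar (n : ℕ) : T (1 : ℂ) n ∘ₗ Tstar 1 n = LinearMap.id := by
  refine end_ext fun j => ?_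
  rw [LinearMap.comp_apply, Tstar_vec, map_smul, map_sum,
    Finset.sum_congr rfl fun s hs => (T_spinBasis n s).trans
      (congrArg (vec ℂ n) (Fin.ext (a := ⟨downs s, downs_lt s⟩) (Finset.mem_filter.mp hs).2)),
    Finset.sum_const, card_downs, ← Nat.cast_smul_eq_nsmul ℂ, smul_smul,
    inv_mul_cancel₀ (choose_ne_zero j), one_smul, LinearMap.id_apply]

theorem T_powMap_proj (n : ℕ) (g : SU2) :
    T (1 : ℂ) n ∘ₗ powMap n g ∘ₗ Tstar 1 n ∘ₗ T 1 n = T 1 n ∘ₗ powMap n g := by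
  refine (spinBasis ℂ n).ext fun s => ?_
  have key : ∀ t : Fin n → Fin 2, downs t = downs s →
      T (1 : ℂ) n (powMap n g (spinBasis ℂ n t)) = T 1 n (powMap n g (spinBasis ℂ n s)) := by
    intro t ht
    obtain ⟨e, he⟩ := exists_perm_of_downs_eq ht.symm
    simp only [spinBasis, Basis.piTensorProduct_apply, powMap, PiTensorProduct.map_tprod]
    rw [← T_reindex n e]
    simp only [he]
  change T 1 n (powMap n g (Tstar 1 n (T 1 n (spinBasis ℂ n s))))
    = T 1 n (powMap n g (spinBasis ℂ n s))
  rw [T_spinBasis, Tstar_vec, map_smul, map_smul, map_sum, map_sum,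
    Finset.sum_congr rfl fun t ht => key t (Finset.mem_filter.mp ht).2, Finset.sum_const,
    card_downs, ← Nat.cast_smul_eq_nsmul ℂ, smul_smul, inv_mul_cancel₀, one_smul]
  exact choose_ne_zero ⟨downs s, downs_lt s⟩

/-- The irreducible representation of `SU(2)` on `V(n) = ℂ^{n+1}`, identified with the space of
symmetric tensors in `(ℂ²)^{⊗n}` by means of `T_n` and `T_n^*` (at `q = 1`):
`g` acts by `T_n (g ⊗ ⋯ ⊗ g) T_n^*`. -/
def su2Rep (n : ℕ) : Representation ℂ SU2 (V ℂ n) where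
  toFun g := T (1 : ℂ) n ∘ₗ powMap n g ∘ₗ Tstar 1 n
  map_one' := by
    have : powMap n 1 = LinearMap.id := by
      rw [powMap, map_one]
      exact PiTensorProduct.map_id
    rw [this, LinearMap.id_comp, T_Tstar]
    rfl
  map_mul' g h := by
    have : powMap n (g * h) = powMap n g ∘ₗ powMap n h := by
      rw [powMap, map_mul]
      exact PiTensorProduct.map_comp _ _
    rw [this]
    refine LinearMap.ext fun x => ?_
    exact (LinearMap.congr_fun (T_powMap_proj n g) (powMap n h (Tstar 1 n x))).symm

/-- The space of `SU(2)`-intertwiners from `ℂ^{m+1} ⊗ ℂ^{n+1}` to itself. -/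
def su2Intertwiners (m n : ℕ) : Submodule ℂ (Module.End ℂ (V ℂ m ⊗[ℂ] V ℂ n)) :=
  (Subalgebra.centralizer ℂ (Set.range ((su2Rep m).tprod (su2Rep n)))).toSubmodule

/-- The Hermitian inner product on `ℂ^{m+1} ⊗ ℂ^{n+1}` (conjugate-linear in the first argument) for
which the vectors `v^{m-2i} ⊗ v^{n-2j}` are orthogonal and have square norm
`(m choose i)⁻¹ (n choose j)⁻¹`, so that `T_n^*` is the adjoint of `T_n` if the vectors
`v^{s₁} ⊗ ⋯ ⊗ v^{sₙ}` are orthonormal. -/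
def tensorInner (m n : ℕ) (x y : V ℂ m ⊗[ℂ] V ℂ n) : ℂ :=
  ∑ i : Fin (m + 1), ∑ j : Fin (n + 1),
    starRingEnd ℂ (finsuppTensorFinsupp' ℂ _ _ x (i, j)) * finsuppTensorFinsupp' ℂ _ _ y (i, j) /
      ((m.choose i : ℂ) * (n.choose j : ℂ))

/-- The flip `τ : ℂ^{m+1} ⊗ ℂ^{n+1} → ℂ^{n+1} ⊗ ℂ^{m+1}`, `τ (v ⊗ w) = w ⊗ v`. It is unitary, its
adjoint `τ^*` being the inverse `τ.symm`. -/
def flip (m n : ℕ) : V ℂ m ⊗[ℂ] V ℂ n ≃ₗ[ℂ] V ℂ n ⊗[ℂ] V ℂ m :=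
  TensorProduct.comm ℂ (V ℂ m) (V ℂ n)

end Classical

end Cascade

end

/-!
The two halves of the theorem, generic `q` and `q = 1`, share all computations: they are carried out
for a `q` that is `Regular`, i.e. nonzero and with nonzero q-numbers `[n]`, `n > 0`.

*Adjoints and flip.* The matrix entries of `U_{a,b}^{c,d}` are sums over the words of
`a + b = c + d` arrows, cut after `a` and after `c` letters (`coord_U`). Since `‖s‖₊ + ‖s‖₋` depends only on the
numbers of arrows of each kind, the weights of the forms make these sums symmetric in the two cuts;
therefore `U_{a,b}^{c,d}` and `U_{c,d}^{a,b}` are adjoint (`coord_U_symm`, `tensorForm_U`,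
`tensorInner_U`). At `q = 1` reversing all words gives the statement on the flip (`flip_cascade`).

*Intertwiners.* The cascade and Temperley–Lieb operators are composed of `T`, `T^*`, the arcs and
regroupings of tensor factors. Each of these commutes with `K`, `K⁻¹`, `E`, `F` (`intertwines_T`,
`intertwines_Tstar`, `intertwines_arcs`), where the action on words is that of the iterated
coproduct; at `q = 1` each commutes with `g ⊗ ⋯ ⊗ g` for `g ∈ SU(2)` (`semiconj_T`,
`semiconj_Tstar`, `semiconj_arcs`). For the arcs the reason is that a cup and a cap are invariant,
and for `T_n^*` at `q = 1` that its image consists of the symmetric tensors.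

*Bases.* Let `n ≤ m`. The tensor product `v^m ⊗ v^{-n}` of a highest and a lowest weight vector is
cyclic in `V(m) ⊗ V(n)`, so an intertwiner is determined by its value there. By weights this value
lies in the span of the `n + 1` vectors `v_i ⊗ v_{n-i}`, and `ev` records its coordinates
(`quantum_eq_zero`, `su2_eq_zero`). Cyclicity is proved by applying `E` and then `F` in the quantum
case. For `SU(2)`, the vectors `g v^m ⊗ g v^{-n}` have coordinates which are distinct monomials in
`z` and its conjugate, up to nonzero factors, and these monomials are linearly independent as
functions of `z`. The vectors `ev K(k)` and `ev L(l)` are known in closed form (`ev_cascade`, `ev_temperleyLieb`) and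
triangular with nonzero diagonal entries; hence both families are bases of the space of intertwiners
(`exists_basis_of_triangular`), with no need to compute its dimension beforehand. Finally, the
change of basis is an identity between values of `ev`, which reduces to the q-Vandermonde convolution
(`ev_sum_temperleyLieb`).
-/

namespace Cascade

/-! ### q-numbers and q-binomial coefficients -/

section QBinomials
variable {𝕜 : Type*} [Field 𝕜]

/-- The condition on `q` under which the q-binomial coefficients behave as the ordinary ones:
`q` and all q-numbers `[n]`, `n ≥ 1`, are nonzero. It covers the generic `q` as well as `q = 1` in
characteristic zero. -/
def Regular (q : 𝕜) : Prop := q ≠ 0 ∧ ∀ n : ℕ, qNum q (n + 1) ≠ 0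

theorem Generic.zpow_ne_one {q : 𝕜} (hq : Generic q) {z : ℤ} (hz : z ≠ 0) : q ^ z ≠ 1 := by
  intro h
  obtain ⟨n, rfl | rfl⟩ := Int.eq_nat_or_neg z
  · exact hq.2 n (by omega) (by exact_mod_cast h)
  · rw [zpow_neg, inv_eq_one, zpow_natCast] at h
    exact hq.2 n (by omega) h

theorem Generic.regular {q : 𝕜} (hq : Generic q) : Regular q := by
  refine ⟨hq.1, fun n h => ?_⟩
  have h1 := sub_mul_qNum hq.1 (n + 1)
  rw [h, mul_zero, eq_comm, sub_eq_zero] at h1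
  refine hq.zpow_ne_one (z := 2 * ((n + 1 : ℕ) : ℤ)) (by omega) ?_
  rw [two_mul, zpow_add₀ hq.1]
  nth_rewrite 1 [h1]
  rw [← zpow_add₀ hq.1, neg_add_cancel, zpow_zero]

theorem regular_one : Regular (1 : ℂ) := by
  refine ⟨one_ne_zero, fun n => ?_⟩
  simp only [qNum, one_zpow, Finset.sum_const, Finset.card_range, nsmul_eq_mul, mul_one]
  exact_mod_cast n.succ_ne_zero

theorem qNum_one (q : 𝕜) : qNum q 1 = 1 := by simp [qNum]

theorem qNum_add {q : 𝕜} (hq : q ≠ 0) (a b : ℕ) :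
    qNum q (a + b) = q ^ (b : ℤ) * qNum q a + q ^ (-(a : ℤ)) * qNum q b := by
  simp only [qNum, Finset.sum_range_add, Finset.mul_sum, ← zpow_add₀ hq]
  congr 1 <;> refine Finset.sum_congr rfl fun i _ => ?_ <;> congr 1 <;> push_cast <;> ring

theorem qFact_succ (q : 𝕜) (n : ℕ) : qFact q (n + 1) = qFact q n * qNum q (n + 1) := by
  rw [qFact, Finset.prod_range_succ, ← qFact]

theorem qFact_zero (q : 𝕜) : qFact q 0 = 1 := by simp [qFact]

theorem Regular.qFact_ne_zero {q : 𝕜} (hq : Regular q) (n : ℕ) : qFact q n ≠ 0 :=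
  Finset.prod_ne_zero_iff.mpr fun i _ => hq.2 i

theorem qBinom_of_lt (q : 𝕜) {n k : ℕ} (h : n < k) : qBinom q n k = 0 :=
  if_neg (not_le.mpr h)

theorem qBinom_add (q : 𝕜) (k r : ℕ) :
    qBinom q (k + r) k = qFact q (k + r) / (qFact q k * qFact q r) := by
  rw [qBinom, if_pos (Nat.le_add_right _ _), Nat.add_sub_cancel_left]

theorem qBinom_symm (q : 𝕜) {n k : ℕ} (h : k ≤ n) : qBinom q n (n - k) = qBinom q n k := by
  obtain ⟨r, rfl⟩ := Nat.exists_eq_add_of_le h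
  rw [Nat.add_sub_cancel_left, qBinom_add, Nat.add_comm, qBinom_add, mul_comm]

theorem Regular.qBinom_ne_zero {q : 𝕜} (hq : Regular q) {n k : ℕ} (h : k ≤ n) :
    qBinom q n k ≠ 0 := by
  rw [qBinom, if_pos h]
  exact div_ne_zero (hq.qFact_ne_zero _) (mul_ne_zero (hq.qFact_ne_zero _) (hq.qFact_ne_zero _))

theorem Regular.qBinom_zero {q : 𝕜} (hq : Regular q) (n : ℕ) : qBinom q n 0 = 1 := by
  rw [qBinom, if_pos n.zero_le, qFact_zero, one_mul, Nat.sub_zero, div_self (hq.qFact_ne_zero n)]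

theorem Regular.qBinom_self {q : 𝕜} (hq : Regular q) (n : ℕ) : qBinom q n n = 1 := by
  rw [← qBinom_symm q le_rfl, Nat.sub_self, hq.qBinom_zero]

theorem Regular.pascal {q : 𝕜} (hq : Regular q) (n k : ℕ) :
    qBinom q (n + 1) (k + 1)
      = q ^ (-(k : ℤ) - 1) * qBinom q n (k + 1) + q ^ ((n : ℤ) - k) * qBinom q n k := by
  rcases lt_trichotomy n k with h | rfl | h
  · rw [qBinom_of_lt q (by omega), qBinom_of_lt q (by omega), qBinom_of_lt q h]; simp
  · rw [qBinom_of_lt q (Nat.lt_succ_self n), hq.qBinom_self, hq.qBinom_self]; simp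
  · obtain ⟨r, rfl⟩ := Nat.exists_eq_add_of_le (Nat.succ_le_of_lt h)
    have e1 := qBinom_add q (k + 1) (r + 1)
    have e2 := qBinom_add q (k + 1) r
    have e3 := qBinom_add q k (r + 1)
    rw [show k + (r + 1) = k + 1 + r by omega] at e3
    rw [show k + 1 + (r + 1) = k + 1 + r + 1 by omega] at e1
    have h1 := hq.qFact_ne_zero k
    have h2 := hq.qFact_ne_zero r
    have h3 := hq.2 k
    have h4 := hq.2 r
    have h5 : qNum q (k + 1 + r + 1) = q ^ (-(k : ℤ) - 1) * qNum q (r + 1)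
        + q ^ ((r : ℤ) + 1) * qNum q (k + 1) := by
      rw [show k + 1 + r + 1 = k + 1 + (r + 1) by omega, qNum_add hq.1, add_comm]
      congr 3
      push_cast; ring
    rw [Nat.succ_eq_add_one, e1, e2, e3, qFact_succ q (k + 1 + r), qFact_succ q k, qFact_succ q r,
      h5]
    have e : ((k + 1 + r : ℕ) : ℤ) - k = r + 1 := by push_cast; ring
    rw [e]
    field_simp

/-- A q-analogue of the Chu–Vandermonde identity, in the form of the `K`-th finite difference of
a q-binomial coefficient. -/
theorem Regular.sum_qBinom_mul_qBinom {q : 𝕜} (hq : Regular q) (K M i : ℕ) :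
    ∑ p ∈ Finset.range (K + 1), (-1) ^ p * q ^ (-((i : ℤ) + 1) * p) * qBinom q K p
        * qBinom q (M + K - p) (K + i)
      = q ^ ((K : ℤ) * ((M : ℤ) - i)) * qBinom q M i := by
  induction K generalizing M i with
  | zero => simp [hq.qBinom_zero]
  | succ K ih =>
    -- The Pascal rule for `qBinom q (K + 1) p` splits the sum into those for `(K, M + 1, i + 1)`
    -- and `(K, M, i + 1)`, and on the right-hand side it is applied to `qBinom q (M + 1) (i + 1)`.
    have key : ∀ p : ℕ, qBinom q (K + 1) (p + 1)
        = q ^ (-(p : ℤ) - 1) * qBinom q K (p + 1) + q ^ ((K : ℤ) - p) * qBinom q K p :=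
      fun p => hq.pascal K p
    rw [Finset.sum_range_succ']
    simp only [key, mul_add, add_mul, Finset.sum_add_distrib]
    have hA : ∑ p ∈ Finset.range (K + 1), (-1) ^ p * q ^ (-(((i + 1 : ℕ) : ℤ) + 1) * p)
        * qBinom q K p * qBinom q (M + 1 + K - p) (K + (i + 1))
        = ∑ p ∈ Finset.range (K + 1), (-1) ^ (p + 1) * q ^ (-((i : ℤ) + 1) * ((p + 1 : ℕ) : ℤ))
            * (q ^ (-(p : ℤ) - 1) * qBinom q K (p + 1))
            * qBinom q (M + (K + 1) - (p + 1)) (K + 1 + i)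
          + (-1) ^ 0 * q ^ (-((i : ℤ) + 1) * ((0 : ℕ) : ℤ)) * qBinom q (K + 1) 0
            * qBinom q (M + (K + 1) - 0) (K + 1 + i) := by
      rw [Finset.sum_range_succ', Finset.sum_range_succ _ K, qBinom_of_lt q (Nat.lt_succ_self K)]
      simp only [mul_zero, zero_mul, add_zero]
      congr 1
      · refine Finset.sum_congr rfl fun p _ => ?_
        have e : q ^ (-(((i + 1 : ℕ) : ℤ) + 1) * ((p + 1 : ℕ) : ℤ))
            = q ^ (-((i : ℤ) + 1) * ((p + 1 : ℕ) : ℤ)) * q ^ (-(p : ℤ) - 1) := by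
          rw [← zpow_add₀ hq.1]; congr 1; push_cast; ring
        rw [e, show M + 1 + K - (p + 1) = M + (K + 1) - (p + 1) by omega,
          show K + (i + 1) = K + 1 + i by omega]
        ring
      · rw [hq.qBinom_zero, hq.qBinom_zero, show M + 1 + K - 0 = M + (K + 1) - 0 by omega,
          show K + (i + 1) = K + 1 + i by omega]
        simp
    have hB : ∑ p ∈ Finset.range (K + 1), (-1) ^ (p + 1)
          * q ^ (-((i : ℤ) + 1) * ((p + 1 : ℕ) : ℤ))
            * (q ^ ((K : ℤ) - p) * qBinom q K p)
            * qBinom q (M + (K + 1) - (p + 1)) (K + 1 + i)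
        = -q ^ ((K : ℤ) - i - 1) * ∑ p ∈ Finset.range (K + 1), (-1) ^ p
          * q ^ (-(((i + 1 : ℕ) : ℤ) + 1) * p)
        * qBinom q K p * qBinom q (M + K - p) (K + (i + 1)) := by
      rw [Finset.mul_sum]
      refine Finset.sum_congr rfl fun p _ => ?_
      have e : q ^ (-((i : ℤ) + 1) * ((p + 1 : ℕ) : ℤ)) * q ^ ((K : ℤ) - p)
          = q ^ ((K : ℤ) - i - 1) * q ^ (-(((i + 1 : ℕ) : ℤ) + 1) * p) := by
        rw [← zpow_add₀ hq.1, ← zpow_add₀ hq.1]; congr 1; push_cast; ring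
      rw [show M + (K + 1) - (p + 1) = M + K - p by omega,
        show K + (i + 1) = K + 1 + i by omega]
      calc _ = (-1) ^ (p + 1) * (q ^ (-((i : ℤ) + 1) * ((p + 1 : ℕ) : ℤ)) * q ^ ((K : ℤ) - p))
            * qBinom q K p * qBinom q (M + K - p) (K + 1 + i) := by ring
        _ = _ := by rw [e]; ring
    rw [add_right_comm, ← hA, hB, ih, ih, hq.pascal]
    have e1 : q ^ ((K : ℤ) * (((M + 1 : ℕ) : ℤ) - ((i + 1 : ℕ) : ℤ))) * q ^ ((M : ℤ) - i)
        = q ^ (((K + 1 : ℕ) : ℤ) * ((M : ℤ) - i)) := by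
      rw [← zpow_add₀ hq.1]; congr 1; push_cast; ring
    have e2 : q ^ ((K : ℤ) * (((M + 1 : ℕ) : ℤ) - ((i + 1 : ℕ) : ℤ))) * q ^ (-(i : ℤ) - 1)
        = q ^ ((K : ℤ) - i - 1) * q ^ ((K : ℤ) * ((M : ℤ) - ((i + 1 : ℕ) : ℤ))) := by
      rw [← zpow_add₀ hq.1, ← zpow_add₀ hq.1]; congr 1; push_cast; ring
    rw [← e1]
    linear_combination (qBinom q M (i + 1)) * e2

end QBinomials

/-! ### Words of arrows -/

section Words

theorem downs_le {n : ℕ} (s : Fin n → Fin 2) : downs s ≤ n := Nat.lt_succ_iff.mp (downs_lt s)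

theorem downs_append {a b : ℕ} (s : Fin a → Fin 2) (t : Fin b → Fin 2) :
    downs (Fin.append s t) = downs s + downs t := by
  simp [downs, Fin.sum_univ_add]

theorem sum_ite_eq_one {n : ℕ} (s : Fin n → Fin 2) : (∑ i, if s i = 1 then 1 else 0) = downs s := by
  rw [downs_eq_card, Finset.card_filter]

theorem sum_ite_eq_zero {n : ℕ} (s : Fin n → Fin 2) :
    (∑ i, if s i = 0 then 1 else 0) = n - downs s := by
  have h : (∑ i, if s i = 0 then 1 else 0) + (∑ i, if s i = 1 then 1 else 0) = n := by
    rw [← Finset.sum_add_distrib, Finset.sum_congr rfl (g := fun _ => 1)]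
    · simp
    · intro i _
      generalize s i = a
      fin_cases a <;> rfl
  rw [sum_ite_eq_one] at h
  omega

theorem sum_mul_ite {a b : ℕ} (s : Fin a → Fin 2) (t : Fin b → Fin 2) (x y : Fin 2) :
    (∑ i, ∑ j, if s i = x ∧ t j = y then 1 else 0)
      = (∑ i, if s i = x then 1 else 0) * ∑ j, if t j = y then 1 else 0 := by
  rw [Finset.sum_mul_sum]
  refine Finset.sum_congr rfl fun i _ => Finset.sum_congr rfl fun j _ => ?_
  by_cases h1 : s i = x <;> by_cases h2 : t j = y <;> simp [h1, h2]

theorem normPlus_eq_sum {n : ℕ} (s : Fin n → Fin 2) :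
    normPlus s = ∑ i, ∑ j, if i < j ∧ s i = 0 ∧ s j = 1 then 1 else 0 := by
  rw [normPlus, Finset.card_filter, Fintype.sum_prod_type]

theorem normMinus_eq_sum {n : ℕ} (s : Fin n → Fin 2) :
    normMinus s = ∑ i, ∑ j, if i < j ∧ s i = 1 ∧ s j = 0 then 1 else 0 := by
  rw [normMinus, Finset.card_filter, Fintype.sum_prod_type]

theorem not_natAdd_lt_castAdd {a b : ℕ} (i : Fin a) (j : Fin b) :
    ¬ Fin.natAdd a j < Fin.castAdd b i := by
  simp only [Fin.lt_def, Fin.val_natAdd, Fin.val_castAdd]; omega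

theorem castAdd_lt_natAdd' {a b : ℕ} (i : Fin a) (j : Fin b) :
    Fin.castAdd b i < Fin.natAdd a j := by
  simp only [Fin.lt_def, Fin.val_natAdd, Fin.val_castAdd]; omega

theorem castAdd_lt_castAdd' {a b : ℕ} (i j : Fin a) :
    Fin.castAdd b i < Fin.castAdd b j ↔ i < j := by
  simp only [Fin.lt_def, Fin.val_castAdd]

theorem natAdd_lt_natAdd' {a b : ℕ} (i j : Fin b) :
    Fin.natAdd a i < Fin.natAdd a j ↔ i < j := by
  simp only [Fin.lt_def, Fin.val_natAdd]; omega

theorem normPlus_append {a b : ℕ} (s : Fin a → Fin 2) (t : Fin b → Fin 2) :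
    normPlus (Fin.append s t) = normPlus s + normPlus t + (a - downs s) * downs t := by
  simp only [normPlus_eq_sum, Fin.sum_univ_add, Fin.append_left, Fin.append_right,
    castAdd_lt_castAdd', natAdd_lt_natAdd', castAdd_lt_natAdd', not_natAdd_lt_castAdd, true_and,
    false_and, if_false, Finset.sum_const_zero, Finset.sum_add_distrib, sum_mul_ite,
    sum_ite_eq_zero, sum_ite_eq_one]
  ring

theorem normMinus_append {a b : ℕ} (s : Fin a → Fin 2) (t : Fin b → Fin 2) :
    normMinus (Fin.append s t) = normMinus s + normMinus t + downs s * (b - downs t) := by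
  simp only [normMinus_eq_sum, Fin.sum_univ_add, Fin.append_left, Fin.append_right,
    castAdd_lt_castAdd', natAdd_lt_natAdd', castAdd_lt_natAdd', not_natAdd_lt_castAdd, true_and,
    false_and, if_false, Finset.sum_const_zero, Finset.sum_add_distrib, sum_mul_ite,
    sum_ite_eq_zero, sum_ite_eq_one]
  ring

theorem downs_singleton (a : Fin 2) : downs ![a] = a := by simp [downs]

theorem normPlus_of_subsingleton (s : Fin 1 → Fin 2) : normPlus s = 0 := by
  simp [normPlus_eq_sum]

theorem normMinus_of_subsingleton (s : Fin 1 → Fin 2) : normMinus s = 0 := by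
  simp [normMinus_eq_sum]

theorem snoc_eq_append {n : ℕ} (s : Fin n → Fin 2) (a : Fin 2) :
    (Fin.snoc s a : Fin (n + 1) → Fin 2) = Fin.append s ![a] := by
  rw [Fin.append_right_eq_snoc]; rfl

theorem downs_snoc {n : ℕ} (s : Fin n → Fin 2) (a : Fin 2) :
    downs (Fin.snoc s a : Fin (n + 1) → Fin 2) = downs s + a := by
  rw [snoc_eq_append, downs_append, downs_singleton]

theorem normPlus_snoc {n : ℕ} (s : Fin n → Fin 2) (a : Fin 2) :
    normPlus (Fin.snoc s a : Fin (n + 1) → Fin 2) = normPlus s + (n - downs s) * a := by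
  rw [snoc_eq_append, normPlus_append, downs_singleton, normPlus_of_subsingleton, add_zero]

theorem normMinus_snoc {n : ℕ} (s : Fin n → Fin 2) (a : Fin 2) :
    normMinus (Fin.snoc s a : Fin (n + 1) → Fin 2) = normMinus s + downs s * (1 - a) := by
  rw [snoc_eq_append, normMinus_append, downs_singleton, normMinus_of_subsingleton, add_zero]

theorem normPlus_add_normMinus {n : ℕ} (s : Fin n → Fin 2) :
    normPlus s + normMinus s = downs s * (n - downs s) := by
  induction s using Fin.snocInduction with
  | elim0 => simp [normPlus_eq_sum, normMinus_eq_sum, downs]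
  | snoc s a ih =>
    rename_i n
    have hd := downs_le s
    obtain ⟨u, hu⟩ := Nat.exists_eq_add_of_le hd
    rw [normPlus_snoc, normMinus_snoc, downs_snoc]
    have e : n - downs s = u := by omega
    rw [e] at ih ⊢
    fin_cases a
    · simp only [mul_zero, add_zero, Nat.sub_zero, mul_one]
      rw [show n + 1 - downs s = u + 1 by omega, ← add_assoc, ih]; ring
    · simp only [mul_one, Nat.sub_self, mul_zero, add_zero]
      rw [show n + 1 - (downs s + 1) = u by omega, add_right_comm, ih]; ring

theorem sum_snoc {M : Type*} [AddCommMonoid M] {n : ℕ} (f : (Fin (n + 1) → Fin 2) → M) :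
    ∑ s, f s = ∑ s : Fin n → Fin 2, (f (Fin.snoc s 0) + f (Fin.snoc s 1)) := by
  rw [← (Fin.snocEquiv fun _ => Fin 2).sum_comp, Fintype.sum_prod_type, Fin.sum_univ_two,
    ← Finset.sum_add_distrib]
  rfl

theorem sum_append {M : Type*} [AddCommMonoid M] {a b : ℕ} (f : (Fin (a + b) → Fin 2) → M) :
    ∑ s, f s = ∑ s : Fin a → Fin 2, ∑ t : Fin b → Fin 2, f (Fin.append s t) := by
  rw [← (Fin.appendEquiv a b).sum_comp, Fintype.sum_prod_type]
  rfl

variable {𝕜 : Type*} [Field 𝕜]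

/-- The number of words with `j` down arrows, counted with the weights `q^{‖s‖₊-‖s‖₋}`, is a
q-binomial coefficient. -/
theorem Regular.sum_zpow_norm {q : 𝕜} (hq : Regular q) (n j : ℕ) :
    ∑ s : Fin n → Fin 2 with downs s = j, q ^ ((normPlus s : ℤ) - normMinus s) = qBinom q n j := by
  induction n generalizing j with
  | zero =>
    cases j with
    | zero => simp [hq.qBinom_zero, downs, normPlus_eq_sum, normMinus_eq_sum]
    | succ j => simp [qBinom_of_lt q (Nat.succ_pos j), downs]
  | succ n ih =>
    rw [Finset.sum_filter, sum_snoc, Finset.sum_add_distrib]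
    simp only [downs_snoc, normPlus_snoc, normMinus_snoc, Fin.val_zero, Fin.val_one, add_zero,
      mul_zero, Nat.sub_zero, mul_one, Nat.sub_self]
    cases j with
    | zero =>
      have h := ih 0
      rw [Finset.sum_filter] at h
      rw [hq.qBinom_zero, ← hq.qBinom_zero n, ← h]
      simp only [Nat.add_eq_zero_iff, one_ne_zero, and_false, if_false, Finset.sum_const_zero,
        add_zero]
      refine Finset.sum_congr rfl fun s _ => ?_
      split_ifs with hs
      · rw [hs, add_zero]
      · rfl
    | succ j =>
      rw [hq.pascal, ← ih, ← ih, Finset.sum_filter, Finset.sum_filter, Finset.mul_sum,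
        Finset.mul_sum]
      congr 1 <;> refine Finset.sum_congr rfl fun s _ => ?_
      · split_ifs with hs
        · rw [hs, ← zpow_add₀ hq.1]; congr 1; push_cast; ring
        · simp
      · simp only [add_left_inj]
        split_ifs with hs
        · have := downs_le s
          rw [hs, ← zpow_add₀ hq.1]; congr 1
          rw [hs] at this
          push_cast [Nat.cast_sub this]; ring
        · simp

end Words

/-! ### The bases of words -/

section SpinBasis
variable {𝕜 : Type*} [Field 𝕜]

theorem spinBasis_eq {n : ℕ} (s : Fin n → Fin 2) :
    spinBasis 𝕜 n s = PiTensorProduct.tprod 𝕜 fun i => vec 𝕜 1 (s i) := by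
  simp [spinBasis, Basis.piTensorProduct_apply]

theorem mulEquiv_spinBasis {a b : ℕ} (s : Fin a → Fin 2) (t : Fin b → Fin 2) :
    TensorPower.mulEquiv (spinBasis 𝕜 a s ⊗ₜ[𝕜] spinBasis 𝕜 b t)
      = spinBasis 𝕜 (a + b) (Fin.append s t) := by
  rw [spinBasis_eq, spinBasis_eq, spinBasis_eq]
  refine (TensorPower.tprod_mul_tprod 𝕜 _ _).trans ?_
  congr 1
  funext i
  refine Fin.addCases (fun i => ?_) (fun i => ?_) i <;> simp

theorem mulEquiv_symm_spinBasis {a b : ℕ} (s : Fin a → Fin 2) (t : Fin b → Fin 2) :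
    TensorPower.mulEquiv.symm (spinBasis 𝕜 (a + b) (Fin.append s t))
      = spinBasis 𝕜 a s ⊗ₜ[𝕜] spinBasis 𝕜 b t := by
  rw [LinearEquiv.symm_apply_eq, mulEquiv_spinBasis]

theorem cast_spinBasis {a b : ℕ} (h : a = b) (s : Fin a → Fin 2) :
    TensorPower.cast 𝕜 (V 𝕜 1) h (spinBasis 𝕜 a s)
      = spinBasis 𝕜 b (s ∘ Fin.cast h.symm) := by
  subst h
  rw [TensorPower.cast_refl]; rfl

theorem T_word (q : 𝕜) {n : ℕ} (s : Fin n → Fin 2) :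
    T q n (spinBasis 𝕜 n s) = q ^ normPlus s • vec 𝕜 n ⟨downs s, downs_lt s⟩ := by
  rw [T, Module.Basis.constr_basis]

theorem Tstar_basis (q : 𝕜) {n : ℕ} (j : Fin (n + 1)) :
    Tstar q n (vec 𝕜 n j) = (qBinom q n j)⁻¹ • ∑ s : Fin n → Fin 2 with downs s = j,
      q ^ (-(normMinus s : ℤ)) • spinBasis 𝕜 n s := by
  rw [Tstar, Finsupp.linearCombination_single, one_smul]

theorem tensor_ext {m n : ℕ} {M : Type*} [AddCommMonoid M] [Module 𝕜 M]
    {f g : V 𝕜 m ⊗[𝕜] V 𝕜 n →ₗ[𝕜] M}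
    (h : ∀ i j, f (vec 𝕜 m i ⊗ₜ vec 𝕜 n j) = g (vec 𝕜 m i ⊗ₜ vec 𝕜 n j)) : f = g :=
  (Finsupp.basisSingleOne.tensorProduct Finsupp.basisSingleOne).ext fun p => by
    rw [Module.Basis.tensorProduct_apply']; exact h p.1 p.2

theorem words_ext {a b : ℕ} {M : Type*} [AddCommMonoid M] [Module 𝕜 M]
    {f g : (⨂[𝕜]^a (V 𝕜 1)) ⊗[𝕜] (⨂[𝕜]^b (V 𝕜 1)) →ₗ[𝕜] M}
    (h : ∀ s t, f (spinBasis 𝕜 a s ⊗ₜ spinBasis 𝕜 b t) = g (spinBasis 𝕜 a s ⊗ₜ spinBasis 𝕜 b t)) :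
    f = g :=
  ((spinBasis 𝕜 a).tensorProduct (spinBasis 𝕜 b)).ext fun p => by
    rw [Module.Basis.tensorProduct_apply']; exact h p.1 p.2

end SpinBasis

/-! ### Matrix entries of `U`, adjoints and the flip -/

section Entries
variable {𝕜 : Type*} [Field 𝕜]

/-- The coordinates of a vector of `V(m) ⊗ V(n)` with respect to the vectors `v_i ⊗ v_j`. -/
noncomputable abbrev coord {m n : ℕ} (x : V 𝕜 m ⊗[𝕜] V 𝕜 n) (p : Fin (m + 1) × Fin (n + 1)) : 𝕜 :=
  finsuppTensorFinsupp' 𝕜 _ _ x p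

theorem coord_vec {m n : ℕ} (i k : Fin (m + 1)) (j l : Fin (n + 1)) :
    coord (vec 𝕜 m i ⊗ₜ[𝕜] vec 𝕜 n j) (k, l) = if i = k ∧ j = l then 1 else 0 := by
  rw [coord, finsuppTensorFinsupp'_single_tmul_single, Finsupp.single_apply, mul_one]
  simp only [Prod.mk.injEq]

theorem coord_ext {m n : ℕ} {x y : V 𝕜 m ⊗[𝕜] V 𝕜 n} (h : ∀ i j, coord x (i, j) = coord y (i, j)) :
    x = y :=
  (finsuppTensorFinsupp' 𝕜 _ _).injective (Finsupp.ext fun p => h p.1 p.2)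

theorem coord_map {m n m' n' : ℕ} (f : V 𝕜 m ⊗[𝕜] V 𝕜 n →ₗ[𝕜] V 𝕜 m' ⊗[𝕜] V 𝕜 n')
    (x : V 𝕜 m ⊗[𝕜] V 𝕜 n) (p : Fin (m' + 1) × Fin (n' + 1)) :
    coord (f x) p = ∑ i, ∑ j, coord x (i, j) * coord (f (vec 𝕜 m i ⊗ₜ vec 𝕜 n j)) p := by
  let g : V 𝕜 m ⊗[𝕜] V 𝕜 n →ₗ[𝕜] 𝕜 :=
    Finsupp.lapply p ∘ₗ (finsuppTensorFinsupp' 𝕜 _ _).toLinearMap ∘ₗ f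
  let g' : V 𝕜 m ⊗[𝕜] V 𝕜 n →ₗ[𝕜] 𝕜 := ∑ i, ∑ j, (Finsupp.lapply (i, j) ∘ₗ
    (finsuppTensorFinsupp' 𝕜 _ _).toLinearMap).smulRight (coord (f (vec 𝕜 m i ⊗ₜ vec 𝕜 n j)) p)
  have h : g = g' := by
    refine tensor_ext fun i j => ?_
    have e : g' (vec 𝕜 m i ⊗ₜ vec 𝕜 n j) = ∑ i', ∑ j', coord (vec 𝕜 m i ⊗ₜ[𝕜] vec 𝕜 n j) (i', j')
        * coord (f (vec 𝕜 m i' ⊗ₜ vec 𝕜 n j')) p := by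
      simp only [g', LinearMap.sum_apply, LinearMap.smulRight_apply, smul_eq_mul]
      rfl
    rw [e]
    simp only [coord_vec, ite_mul, one_mul, zero_mul, ite_and]
    simp [g]
  have e := LinearMap.congr_fun h x
  simp only [g', LinearMap.sum_apply, LinearMap.smulRight_apply, smul_eq_mul] at e
  exact e

/-- The first `a` letters of a word. -/
abbrev fstWord {a b : ℕ} (s : Fin (a + b) → Fin 2) : Fin a → Fin 2 := fun i => s (Fin.castAdd b i)

/-- The last `b` letters of a word. -/
abbrev sndWord {a b : ℕ} (s : Fin (a + b) → Fin 2) : Fin b → Fin 2 := fun i => s (Fin.natAdd a i)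

theorem append_fstWord_sndWord {a b : ℕ} (s : Fin (a + b) → Fin 2) :
    Fin.append (fstWord s) (sndWord s) = s := Fin.append_castAdd_natAdd

theorem fstWord_append {a b : ℕ} (s : Fin a → Fin 2) (t : Fin b → Fin 2) :
    fstWord (Fin.append s t) = s := by
  funext i; simp [fstWord]

theorem sndWord_append {a b : ℕ} (s : Fin a → Fin 2) (t : Fin b → Fin 2) :
    sndWord (Fin.append s t) = t := by
  funext i; simp [sndWord]

theorem Tstar_tmul_Tstar (q : 𝕜) {a b : ℕ} (i : Fin (a + 1)) (j : Fin (b + 1)) :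
    Tstar q a (vec 𝕜 a i) ⊗ₜ[𝕜] Tstar q b (vec 𝕜 b j)
      = ((qBinom q a i)⁻¹ * (qBinom q b j)⁻¹) • ∑ s : Fin (a + b) → Fin 2,
        if downs (fstWord s) = i ∧ downs (sndWord s) = j then
          (q ^ (-(normMinus (fstWord s) : ℤ)) * q ^ (-(normMinus (sndWord s) : ℤ))) •
            (spinBasis 𝕜 a (fstWord s) ⊗ₜ[𝕜] spinBasis 𝕜 b (sndWord s)) else 0 := by
  rw [Tstar_basis, Tstar_basis, TensorProduct.smul_tmul_smul, sum_append, Finset.sum_filter,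
    Finset.sum_filter, TensorProduct.sum_tmul]
  congr 1
  refine Finset.sum_congr rfl fun s _ => ?_
  rw [TensorProduct.tmul_sum]
  refine Finset.sum_congr rfl fun t _ => ?_
  rw [fstWord_append, sndWord_append, ite_and]
  split_ifs
  · rw [TensorProduct.smul_tmul_smul]
  · rw [TensorProduct.tmul_zero]
  · rw [TensorProduct.zero_tmul]
  · rw [TensorProduct.zero_tmul]

theorem regroup_spinBasis {a b c d : ℕ} (h : a + b = c + d) (s : Fin (a + b) → Fin 2) :
    regroup 𝕜 h (spinBasis 𝕜 a (fstWord s) ⊗ₜ[𝕜] spinBasis 𝕜 b (sndWord s))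
      = spinBasis 𝕜 c (fstWord (s ∘ Fin.cast h.symm))
        ⊗ₜ[𝕜] spinBasis 𝕜 d (sndWord (s ∘ Fin.cast h.symm)) := by
  rw [regroup, LinearEquiv.trans_apply, LinearEquiv.trans_apply, mulEquiv_spinBasis,
    append_fstWord_sndWord, cast_spinBasis, ← mulEquiv_symm_spinBasis, append_fstWord_sndWord]

/-- The matrix entries of `U` as sums over words: a word contributes when its cuts after `a` and
after `c` letters have the prescribed numbers of down arrows. -/
theorem coord_U (q : 𝕜) {a b c d : ℕ} (h : a + b = c + d) (i : Fin (a + 1)) (j : Fin (b + 1))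
    (k : Fin (c + 1)) (l : Fin (d + 1)) :
    coord (U q h (vec 𝕜 a i ⊗ₜ vec 𝕜 b j)) (k, l)
      = ((qBinom q a i)⁻¹ * (qBinom q b j)⁻¹) * ∑ s : Fin (a + b) → Fin 2,
        if (downs (fstWord s) = i ∧ downs (sndWord s) = j) ∧
          (downs (fstWord (s ∘ Fin.cast h.symm)) = k ∧ downs (sndWord (s ∘ Fin.cast h.symm)) = l)
        then q ^ (-(normMinus (fstWord s) : ℤ)) * q ^ (-(normMinus (sndWord s) : ℤ)) *
          (q ^ normPlus (fstWord (s ∘ Fin.cast h.symm))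
            * q ^ normPlus (sndWord (s ∘ Fin.cast h.symm))) else 0 := by
  rw [U, LinearMap.comp_apply, LinearMap.comp_apply, TensorProduct.map_tmul, Tstar_tmul_Tstar,
    map_smul, map_smul, map_sum, map_sum, coord, map_smul, map_sum, Finsupp.smul_apply, smul_eq_mul,
    Finsupp.finsetSum_apply]
  congr 1
  refine Finset.sum_congr rfl fun s _ => ?_
  by_cases h1 : downs (fstWord s) = i ∧ downs (sndWord s) = j
  · rw [if_pos h1, if_congr (and_iff_right h1) rfl rfl, map_smul, LinearEquiv.coe_coe,
      regroup_spinBasis, map_smul, TensorProduct.map_tmul, T_word, T_word,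
      TensorProduct.smul_tmul_smul, map_smul, map_smul,
      Finsupp.smul_apply, Finsupp.smul_apply, smul_eq_mul, smul_eq_mul]
    have := coord_vec (𝕜 := 𝕜) (⟨_, downs_lt (fstWord (s ∘ Fin.cast h.symm))⟩ : Fin (c + 1)) k
      (⟨_, downs_lt (sndWord (s ∘ Fin.cast h.symm))⟩ : Fin (d + 1)) l
    rw [coord] at this
    rw [this]
    simp only [Fin.ext_iff]
    split_ifs <;> simp
  · rw [if_neg h1, if_neg fun h2 => h1 h2.1]; simp

/-- The weight `q^{i(m-i)} [m choose i]` of the forms. -/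
noncomputable def weight (q : 𝕜) (m i : ℕ) : 𝕜 := q ^ (i * (m - i)) * qBinom q m i

theorem zpow_normPlus_div_weight {q : 𝕜} (hq : Regular q) {n : ℕ} (s : Fin n → Fin 2) :
    q ^ normPlus s * (weight q n (downs s))⁻¹
      = (qBinom q n (downs s))⁻¹ * q ^ (-(normMinus s : ℤ)) := by
  rw [weight, ← normPlus_add_normMinus, mul_inv, pow_add, zpow_neg, zpow_natCast]
  have := hq.1
  field_simp

/-- Divided by the weight of the target vector, the matrix of `U` is symmetric under turning the
diagram upside down. -/
theorem coord_U_symm {q : 𝕜} (hq : Regular q) {a b c d : ℕ} (h : a + b = c + d) (i : Fin (a + 1))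
    (j : Fin (b + 1)) (k : Fin (c + 1)) (l : Fin (d + 1)) :
    coord (U q h (vec 𝕜 a i ⊗ₜ vec 𝕜 b j)) (k, l) / (weight q c k * weight q d l)
      = coord (U q h.symm (vec 𝕜 c k ⊗ₜ vec 𝕜 d l)) (i, j) / (weight q a i * weight q b j) := by
  -- The weights turn `q ^ ‖·‖₊` into `q ^ (-‖·‖₋)`, which makes the roles of the cuts after `a` and
  -- after `c` letters equal.
  have key : ∀ {a b c d : ℕ} (h : a + b = c + d) (i : Fin (a + 1))
      (j : Fin (b + 1)) (k : Fin (c + 1)) (l : Fin (d + 1)),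
      coord (U q h (vec 𝕜 a i ⊗ₜ vec 𝕜 b j)) (k, l) / (weight q c k * weight q d l)
      = ((qBinom q a i)⁻¹ * (qBinom q b j)⁻¹ * ((qBinom q c k)⁻¹ * (qBinom q d l)⁻¹)) *
        ∑ s : Fin (a + b) → Fin 2,
        if (downs (fstWord s) = i ∧ downs (sndWord s) = j) ∧
          (downs (fstWord (s ∘ Fin.cast h.symm)) = k ∧ downs (sndWord (s ∘ Fin.cast h.symm)) = l)
        then q ^ (-(normMinus (fstWord s) : ℤ)) * q ^ (-(normMinus (sndWord s) : ℤ)) *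
          (q ^ (-(normMinus (fstWord (s ∘ Fin.cast h.symm)) : ℤ))
            * q ^ (-(normMinus (sndWord (s ∘ Fin.cast h.symm)) : ℤ))) else 0 := by
    intro a b c d h i j k l
    rw [coord_U, div_eq_mul_inv, mul_assoc (_ * _) (Finset.sum _ _), Finset.sum_mul,
      mul_assoc (_ * _) ((qBinom q c k)⁻¹ * _), Finset.mul_sum _ _ ((qBinom q c k)⁻¹ * _)]
    congr 1
    refine Finset.sum_congr rfl fun s _ => ?_
    split_ifs with hs
    · obtain ⟨-, h1, h2⟩ := hs
      have e1 := zpow_normPlus_div_weight hq (fstWord (s ∘ Fin.cast h.symm))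
      have e2 := zpow_normPlus_div_weight hq (sndWord (s ∘ Fin.cast h.symm))
      rw [h1] at e1
      rw [h2] at e2
      have aux : ∀ A p₁ p₂ w₁ w₂ b₁ b₂ n₁ n₂ : 𝕜, p₁ * w₁ = b₁ * n₁ → p₂ * w₂ = b₂ * n₂ →
          A * (p₁ * p₂) * (w₁ * w₂) = b₁ * b₂ * (A * (n₁ * n₂)) := by
        intro A p₁ p₂ w₁ w₂ b₁ b₂ n₁ n₂ h₁ h₂
        linear_combination A * p₂ * w₂ * h₁ + A * b₁ * n₁ * h₂
      rw [mul_inv]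
      exact aux _ _ _ _ _ _ _ _ _ e1 e2
    · simp
  rw [key, key]
  congr 1
  · ring
  · refine Fintype.sum_equiv ((finCongr h).arrowCongr (Equiv.refl _)) _ _ fun s => ?_
    have e : ((finCongr h).arrowCongr (Equiv.refl (Fin 2))) s = s ∘ Fin.cast h.symm := rfl
    have e' : (s ∘ Fin.cast h.symm) ∘ Fin.cast h = s := rfl
    rw [e, e']
    refine if_congr and_comm ?_ rfl
    ring

/-- A sesquilinear form with the weights of `tensorForm` has `U` and `U^*` as adjoints, if the
matrix entries of `U` are fixed by the conjugation. -/
theorem sesquilinear_adjoint {q : 𝕜} (hq : Regular q) (σ : 𝕜 →+* 𝕜) {a b c d : ℕ}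
    (h : a + b = c + d) (hσ : ∀ i j p, σ (coord (U q h (vec 𝕜 a i ⊗ₜ vec 𝕜 b j)) p)
      = coord (U q h (vec 𝕜 a i ⊗ₜ vec 𝕜 b j)) p)
    (x : V 𝕜 a ⊗[𝕜] V 𝕜 b) (y : V 𝕜 c ⊗[𝕜] V 𝕜 d) :
    ∑ k : Fin (c + 1), ∑ l : Fin (d + 1), σ (coord (U q h x) (k, l)) * coord y (k, l) /
        (weight q c k * weight q d l)
      = ∑ i : Fin (a + 1), ∑ j : Fin (b + 1), σ (coord x (i, j)) * coord (U q h.symm y) (i, j) /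
        (weight q a i * weight q b j) := by
  have e1 : ∀ p, coord (U q h x) p
      = ∑ r : Fin (a + 1) × Fin (b + 1), coord x r * coord (U q h (vec 𝕜 a r.1 ⊗ₜ vec 𝕜 b r.2)) p :=
    fun p => by rw [coord_map, Fintype.sum_prod_type]
  have e2 : ∀ p, coord (U q h.symm y) p
      = ∑ r : Fin (c + 1) × Fin (d + 1), coord y r
        * coord (U q h.symm (vec 𝕜 c r.1 ⊗ₜ vec 𝕜 d r.2)) p :=
    fun p => by rw [coord_map, Fintype.sum_prod_type]
  rw [← Fintype.sum_prod_type (f := fun r : Fin (c + 1) × Fin (d + 1) => σ (coord (U q h x) r)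
      * coord y r / (weight q c r.1 * weight q d r.2)),
    ← Fintype.sum_prod_type (f := fun r : Fin (a + 1) × Fin (b + 1) => σ (coord x r)
      * coord (U q h.symm y) r / (weight q a r.1 * weight q b r.2))]
  simp only [e1, e2, map_sum, map_mul, hσ, Finset.sum_mul, Finset.mul_sum, Finset.sum_div]
  rw [Finset.sum_comm]
  refine Finset.sum_congr rfl fun r _ => Finset.sum_congr rfl fun p _ => ?_
  have := coord_U_symm hq h r.1 r.2 p.1 p.2
  simp only [Prod.mk.eta] at this
  calc _ = σ (coord x r) * coord y p *
        (coord (U q h (vec 𝕜 a r.1 ⊗ₜ vec 𝕜 b r.2)) p / (weight q c p.1 * weight q d p.2)) := by ring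
    _ = _ := by rw [this]; ring

theorem tensorForm_U {q : 𝕜} (hq : Regular q) {a b c d : ℕ} (h : a + b = c + d)
    (x : V 𝕜 a ⊗[𝕜] V 𝕜 b) (y : V 𝕜 c ⊗[𝕜] V 𝕜 d) :
    tensorForm q c d (U q h x) y = tensorForm q a b x (U q h.symm y) :=
  sesquilinear_adjoint hq (RingHom.id 𝕜) h (fun _ _ _ => rfl) x y

/-- Replaces the intermediate space `V(c) ⊗ V(d)` by one with propositionally equal `c` and `d`. -/
theorem U_comp_congr (q : 𝕜) {a b c d c' d' : ℕ} (hc : c = c') (hd : d = d') (h : a + b = c + d)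
    (h' : a + b = c' + d') :
    U q h.symm ∘ₗ U q h = U q h'.symm ∘ₗ U q h' := by
  subst hc hd; rfl

end Entries

section EntriesClassical

theorem weight_one (m i : ℕ) : weight (1 : ℂ) m i = m.choose i := by
  rw [weight, one_pow, one_mul, qBinom_one]

theorem tensorInner_U {a b c d : ℕ} (h : a + b = c + d)
    (x : V ℂ a ⊗[ℂ] V ℂ b) (y : V ℂ c ⊗[ℂ] V ℂ d) :
    tensorInner c d (U 1 h x) y = tensorInner a b x (U 1 h.symm y) := by
  have := sesquilinear_adjoint regular_one (starRingEnd ℂ) h (fun i j p => by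
    rw [← Prod.mk.eta (p := p), coord_U, map_mul, map_mul, map_inv₀, map_inv₀, map_sum, qBinom_one,
      qBinom_one, Complex.conj_natCast, Complex.conj_natCast]
    congr 1
    refine Finset.sum_congr rfl fun s _ => ?_
    split_ifs <;> simp) x y
  simp only [weight_one] at this
  exact this

theorem downs_comp_rev {n : ℕ} (s : Fin n → Fin 2) : downs (s ∘ Fin.rev) = downs s :=
  Equiv.sum_comp Fin.revPerm fun i => (s i : ℕ)

/-- Read backwards, `U_{a,b}^{c,d}` becomes `U_{b,a}^{d,c}`: at `q = 1` only the numbers of down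
arrows matter, and these do not change when a word is reversed. -/
theorem coord_U_flip {a b c d : ℕ} (h : a + b = c + d) (h' : b + a = d + c) (i : Fin (a + 1))
    (j : Fin (b + 1)) (k : Fin (c + 1)) (l : Fin (d + 1)) :
    coord (U (1 : ℂ) h (vec ℂ a i ⊗ₜ vec ℂ b j)) (k, l)
      = coord (U (1 : ℂ) h' (vec ℂ b j ⊗ₜ vec ℂ a i)) (l, k) := by
  rw [coord_U, coord_U]
  congr 1
  · ring
  · simp only [one_zpow, one_pow, mul_one]
    let e : Fin (b + a) ≃ Fin (a + b) := (finCongr (add_comm b a)).trans Fin.revPerm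
    refine (Fintype.sum_equiv (e.arrowCongr (Equiv.refl (Fin 2))) _ _ fun s => ?_).symm
    have e0 : ∀ x, e.arrowCongr (Equiv.refl (Fin 2)) s x
      = s (Fin.cast (add_comm a b) (Fin.rev x)) := fun x => rfl
    generalize e.arrowCongr (Equiv.refl (Fin 2)) s = t at e0
    have e1 : fstWord t = sndWord s ∘ Fin.rev := by
      funext x; simp only [fstWord, sndWord, Function.comp, e0]
      congr 1; ext; simp; omega
    have e2 : sndWord t = fstWord s ∘ Fin.rev := by
      funext x; simp only [fstWord, sndWord, Function.comp, e0]
      congr 1; ext; simp; omega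
    have e3 : fstWord (t ∘ Fin.cast h.symm) = sndWord (s ∘ Fin.cast h'.symm) ∘ Fin.rev := by
      funext x; simp only [fstWord, sndWord, Function.comp, e0]
      congr 1; ext; simp; omega
    have e4 : sndWord (t ∘ Fin.cast h.symm) = fstWord (s ∘ Fin.cast h'.symm) ∘ Fin.rev := by
      funext x; simp only [fstWord, sndWord, Function.comp, e0]
      congr 1; ext; simp; omega
    rw [e1, e2, e3, e4]
    simp only [downs_comp_rev]
    exact if_congr (and_congr and_comm and_comm) rfl rfl

theorem coord_flip {m n : ℕ} (x : V ℂ m ⊗[ℂ] V ℂ n) (i : Fin (m + 1)) (j : Fin (n + 1)) :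
    coord (flip m n x) (j, i) = coord x (i, j) := by
  induction x using TensorProduct.induction_on with
  | zero => simp only [coord, map_zero, Finsupp.zero_apply]
  | tmul x y => simp [flip, mul_comm]
  | add x y hx hy => simp only [coord, map_add, Finsupp.add_apply] at *; rw [hx, hy]

theorem flip_U {a b c d : ℕ} (h : a + b = c + d) (h' : b + a = d + c) (x : V ℂ a ⊗[ℂ] V ℂ b) :
    flip c d (U 1 h x) = U 1 h' (flip a b x) := by
  refine coord_ext fun l k => ?_
  rw [coord_flip, coord_map, coord_map, Finset.sum_comm]
  refine Finset.sum_congr rfl fun j _ => Finset.sum_congr rfl fun i _ => ?_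
  rw [coord_flip, coord_U_flip h h']

theorem flip_cascade (m n : ℕ) (k : ℤ) (h1 : -(m : ℤ) ≤ k) (h2 : k ≤ n) :
    (flip m n).symm.toLinearMap ∘ₗ cascade (1 : ℂ) n m (-k) ∘ₗ (flip m n).toLinearMap
      = cascade 1 m n k := by
  have hk : -(m : ℤ) ≤ k ∧ k ≤ n := ⟨h1, h2⟩
  have hk' : -(n : ℤ) ≤ -k ∧ -k ≤ m := ⟨by omega, by omega⟩
  rw [cascade, cascade, dif_pos hk, dif_pos hk']
  have e := U_comp_congr (1 : ℂ) (a := n) (b := m) (c := ((n : ℤ) + -k).toNat)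
    (d := ((m : ℤ) - -k).toNat) (c' := ((n : ℤ) - k).toNat) (d' := ((m : ℤ) + k).toNat)
    (by congr 1) (by congr 1; ring)
    (add_eq_toNat hk') (by omega)
  rw [e]
  refine LinearMap.ext fun x => ?_
  simp only [LinearMap.comp_apply, LinearEquiv.coe_coe]
  rw [LinearEquiv.symm_apply_eq, flip_U _ (by omega), flip_U _ (by omega)]

end EntriesClassical

/-! ### Operators named after the generators, and maps commuting with them -/

section Intertwines
variable {𝕜 : Type*} [Field 𝕜]
variable {A B C D : Type*} [AddCommMonoid A] [Module 𝕜 A] [AddCommMonoid B] [Module 𝕜 B]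
  [AddCommMonoid C] [Module 𝕜 C] [AddCommMonoid D] [Module 𝕜 D]

/-- The action of the generators on a tensor product, according to the coproduct. The four
operators on each factor need not satisfy the relations of `U_q(sl₂)`. -/
noncomputable def tensorGen (g : Gen → Module.End 𝕜 A) (h : Gen → Module.End 𝕜 B) :
    Gen → Module.End 𝕜 (A ⊗[𝕜] B)
  | Gen.K => TensorProduct.map (g Gen.K) (h Gen.K)
  | Gen.Kinv => TensorProduct.map (g Gen.Kinv) (h Gen.Kinv)
  | Gen.E => TensorProduct.map (g Gen.E) LinearMap.id + TensorProduct.map (g Gen.K) (h Gen.E)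
  | Gen.F => TensorProduct.map (g Gen.F) (h Gen.Kinv) + TensorProduct.map LinearMap.id (h Gen.F)

/-- The linear map `f` commutes with the four operators named after the generators. -/
def Intertwines (g : Gen → Module.End 𝕜 A) (h : Gen → Module.End 𝕜 B) (f : A →ₗ[𝕜] B) : Prop :=
  ∀ x v, f (g x v) = h x (f v)

variable {g : Gen → Module.End 𝕜 A} {h : Gen → Module.End 𝕜 B} {k : Gen → Module.End 𝕜 C}
  {l : Gen → Module.End 𝕜 D}

theorem Intertwines.id : Intertwines g g LinearMap.id := fun _ _ => rfl

theorem Intertwines.comp {f : A →ₗ[𝕜] B} {f' : B →ₗ[𝕜] C} (hf' : Intertwines h k f')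
    (hf : Intertwines g h f) : Intertwines g k (f' ∘ₗ f) := fun x v => by
  rw [LinearMap.comp_apply, hf, hf', LinearMap.comp_apply]

theorem Intertwines.symm {f : A ≃ₗ[𝕜] B} (hf : Intertwines g h f.toLinearMap) :
    Intertwines h g f.symm.toLinearMap := fun x v => by
  have := hf x (f.symm v)
  simp only [LinearEquiv.coe_coe, LinearEquiv.apply_symm_apply] at this ⊢
  rw [← this, LinearEquiv.symm_apply_apply]

theorem Intertwines.map {f : A →ₗ[𝕜] B} {f' : C →ₗ[𝕜] D} (hf : Intertwines g h f)
    (hf' : Intertwines k l f') :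
    Intertwines (tensorGen g k) (tensorGen h l) (TensorProduct.map f f') := fun x v => by
  induction v using TensorProduct.induction_on with
  | zero => simp
  | tmul a c => cases x <;> simp [tensorGen, hf _ _, hf' _ _]
  | add v w hv hw => simp only [map_add, hv, hw]

theorem Intertwines.assoc :
    Intertwines (tensorGen (tensorGen g h) k) (tensorGen g (tensorGen h k))
      (TensorProduct.assoc 𝕜 A B C).toLinearMap := fun x v => by
  refine LinearMap.congr_fun
    (f := (TensorProduct.assoc 𝕜 A B C).toLinearMap ∘ₗ tensorGen (tensorGen g h) k x)
    (g := tensorGen g (tensorGen h k) x ∘ₗ (TensorProduct.assoc 𝕜 A B C).toLinearMap) ?_ v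
  refine TensorProduct.ext_threefold fun a b c => ?_
  cases x <;> simp [tensorGen, TensorProduct.add_tmul, TensorProduct.tmul_add, add_assoc]

theorem Intertwines.congr {f : A ≃ₗ[𝕜] B} {f' : C ≃ₗ[𝕜] D} (hf : Intertwines g h f.toLinearMap)
    (hf' : Intertwines k l f'.toLinearMap) :
    Intertwines (tensorGen g k) (tensorGen h l) (TensorProduct.congr f f').toLinearMap :=
  hf.map hf'

/-- The scalars by which the generators act on the trivial representation. -/
def counitGen : Gen → 𝕜
  | Gen.K => 1
  | Gen.Kinv => 1
  | Gen.E => 0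
  | Gen.F => 0

/-- An operator of rank one which factors through the trivial representation. -/
theorem Intertwines.smulRight {e : A →ₗ[𝕜] 𝕜} {d : A} (he : ∀ x v, e (g x v) = counitGen x * e v)
    (hd : ∀ x, g x d = counitGen (𝕜 := 𝕜) x • d) : Intertwines g g (e.smulRight d) := fun x v => by
  rw [LinearMap.smulRight_apply, LinearMap.smulRight_apply, he, map_smul, hd, smul_smul, mul_comm]

end Intertwines

/-! ### The action of the generators on words -/

section WordAction

/-- The weight `|s|` of a word. -/
def wt {n : ℕ} (s : Fin n → Fin 2) : ℤ := ∑ j, (1 - 2 * ((s j : ℕ) : ℤ))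

/-- The weight of the letters before position `i`. -/
def wtLt {n : ℕ} (s : Fin n → Fin 2) (i : Fin n) : ℤ :=
  ∑ j, if j < i then (1 - 2 * ((s j : ℕ) : ℤ)) else 0

/-- The weight of the letters after position `i`. -/
def wtGt {n : ℕ} (s : Fin n → Fin 2) (i : Fin n) : ℤ :=
  ∑ j, if i < j then (1 - 2 * ((s j : ℕ) : ℤ)) else 0

theorem wt_eq {n : ℕ} (s : Fin n → Fin 2) : wt s = n - 2 * downs s := by
  simp [wt, downs, Finset.mul_sum]

theorem wt_append {a b : ℕ} (s : Fin a → Fin 2) (t : Fin b → Fin 2) :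
    wt (Fin.append s t) = wt s + wt t := by
  simp only [wt, Fin.sum_univ_add, Fin.append_left, Fin.append_right]

theorem wtLt_append_castAdd {a b : ℕ} (s : Fin a → Fin 2) (t : Fin b → Fin 2) (i : Fin a) :
    wtLt (Fin.append s t) (Fin.castAdd b i) = wtLt s i := by
  simp only [wtLt, Fin.sum_univ_add, Fin.append_left, Fin.append_right, castAdd_lt_castAdd',
    not_natAdd_lt_castAdd, if_false, Finset.sum_const_zero, add_zero]

theorem wtLt_append_natAdd {a b : ℕ} (s : Fin a → Fin 2) (t : Fin b → Fin 2) (i : Fin b) :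
    wtLt (Fin.append s t) (Fin.natAdd a i) = wt s + wtLt t i := by
  simp only [wt, wtLt, Fin.sum_univ_add, Fin.append_left, Fin.append_right, castAdd_lt_natAdd',
    natAdd_lt_natAdd', if_true]

theorem wtGt_append_castAdd {a b : ℕ} (s : Fin a → Fin 2) (t : Fin b → Fin 2) (i : Fin a) :
    wtGt (Fin.append s t) (Fin.castAdd b i) = wtGt s i + wt t := by
  simp only [wt, wtGt, Fin.sum_univ_add, Fin.append_left, Fin.append_right, castAdd_lt_natAdd',
    castAdd_lt_castAdd', if_true]

theorem wtGt_append_natAdd {a b : ℕ} (s : Fin a → Fin 2) (t : Fin b → Fin 2) (i : Fin b) :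
    wtGt (Fin.append s t) (Fin.natAdd a i) = wtGt t i := by
  simp only [wtGt, Fin.sum_univ_add, Fin.append_left, Fin.append_right, natAdd_lt_natAdd',
    not_natAdd_lt_castAdd, if_false, Finset.sum_const_zero, zero_add]

theorem wtLt_snoc_castSucc {n : ℕ} (s : Fin n → Fin 2) (a : Fin 2) (i : Fin n) :
    wtLt (Fin.snoc s a : Fin (n + 1) → Fin 2) i.castSucc = wtLt s i := by
  rw [snoc_eq_append]; exact wtLt_append_castAdd s ![a] i

theorem wtLt_snoc_last {n : ℕ} (s : Fin n → Fin 2) (a : Fin 2) :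
    wtLt (Fin.snoc s a : Fin (n + 1) → Fin 2) (Fin.last n) = wt s := by
  rw [snoc_eq_append]
  refine (wtLt_append_natAdd s ![a] 0).trans ?_
  simp [wtLt]

theorem wtGt_snoc_castSucc {n : ℕ} (s : Fin n → Fin 2) (a : Fin 2) (i : Fin n) :
    wtGt (Fin.snoc s a : Fin (n + 1) → Fin 2) i.castSucc = wtGt s i + (1 - 2 * ((a : ℕ) : ℤ)) := by
  rw [snoc_eq_append]
  refine (wtGt_append_castAdd s ![a] i).trans ?_
  simp [wt]

theorem wtGt_snoc_last {n : ℕ} (s : Fin n → Fin 2) (a : Fin 2) :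
    wtGt (Fin.snoc s a : Fin (n + 1) → Fin 2) (Fin.last n) = 0 := by
  rw [snoc_eq_append]
  refine (wtGt_append_natAdd s ![a] 0).trans ?_
  simp [wtGt]

theorem wtLt_update {n : ℕ} (s : Fin n → Fin 2) (i : Fin n) (x : Fin 2) :
    wtLt (Function.update s i x) i = wtLt s i := by
  refine Finset.sum_congr rfl fun j _ => ?_
  split_ifs with h
  · rw [Function.update_of_ne h.ne]
  · rfl

theorem wtGt_update {n : ℕ} (s : Fin n → Fin 2) (i : Fin n) (x : Fin 2) :
    wtGt (Function.update s i x) i = wtGt s i := by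
  refine Finset.sum_congr rfl fun j _ => ?_
  split_ifs with h
  · rw [Function.update_of_ne h.ne']
  · rfl

theorem downs_update_zero {n : ℕ} {s : Fin n → Fin 2} {i : Fin n} (h : s i = 1) :
    downs (Function.update s i 0) + 1 = downs s := by
  rw [downs, downs, ← Finset.add_sum_erase _ _ (Finset.mem_univ i),
    ← Finset.add_sum_erase _ (fun j => (s j : ℕ)) (Finset.mem_univ i), h,
    Finset.sum_congr rfl fun j hj => by rw [Function.update_of_ne (Finset.ne_of_mem_erase hj)]]
  simp [add_comm]

theorem downs_update_one {n : ℕ} {s : Fin n → Fin 2} {i : Fin n} (h : s i = 0) :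
    downs (Function.update s i 1) = downs s + 1 := by
  have := downs_update_zero (s := Function.update s i 1) (i := i) (Function.update_self ..)
  rw [← this, Function.update_idem, ← h, Function.update_eq_self]

/-- Words with letter `x` at position `i` correspond to words with letter `y` at position `i`. -/
theorem sum_ite_update {M : Type*} [AddCommMonoid M] {n : ℕ} (i : Fin n) (x y : Fin 2)
    (f : (Fin n → Fin 2) → M) :
    (∑ s, if s i = x then f s else 0) = ∑ s, if s i = y then f (Function.update s i x) else 0 := by
  rw [← Finset.sum_filter, ← Finset.sum_filter]
  refine Finset.sum_bij' (fun s _ => Function.update s i y) (fun s _ => Function.update s i x)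
    ?_ ?_ ?_ ?_ ?_
  · intro s _; simp
  · intro s _; simp
  · intro s hs; rw [Function.update_idem, ← (Finset.mem_filter.mp hs).2, Function.update_eq_self]
  · intro s hs; rw [Function.update_idem, ← (Finset.mem_filter.mp hs).2, Function.update_eq_self]
  · intro s hs; rw [Function.update_idem, ← (Finset.mem_filter.mp hs).2, Function.update_eq_self]

variable {𝕜 : Type*} [Field 𝕜]

/-- The generators on `V(1)^{⊗n}`, in the form given by the iterated coproduct: `E` turns one arrow
up at a time and acts by `K` on all arrows before it, while `F` turns one arrow down and acts by
`K⁻¹` on all arrows after it. -/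
noncomputable def wordGen (q : 𝕜) (n : ℕ) : Gen → Module.End 𝕜 (⨂[𝕜]^n (V 𝕜 1))
  | Gen.K => (spinBasis 𝕜 n).constr 𝕜 fun s => q ^ wt s • spinBasis 𝕜 n s
  | Gen.Kinv => (spinBasis 𝕜 n).constr 𝕜 fun s => q ^ (-wt s) • spinBasis 𝕜 n s
  | Gen.E => (spinBasis 𝕜 n).constr 𝕜 fun s =>
      ∑ i, if s i = 1 then q ^ wtLt s i • spinBasis 𝕜 n (Function.update s i 0) else 0
  | Gen.F => (spinBasis 𝕜 n).constr 𝕜 fun s =>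
      ∑ i, if s i = 0 then q ^ (-wtGt s i) • spinBasis 𝕜 n (Function.update s i 1) else 0

theorem wordGen_K (q : 𝕜) {n : ℕ} (s : Fin n → Fin 2) :
    wordGen q n Gen.K (spinBasis 𝕜 n s) = q ^ wt s • spinBasis 𝕜 n s :=
  Module.Basis.constr_basis ..

theorem wordGen_Kinv (q : 𝕜) {n : ℕ} (s : Fin n → Fin 2) :
    wordGen q n Gen.Kinv (spinBasis 𝕜 n s) = q ^ (-wt s) • spinBasis 𝕜 n s :=
  Module.Basis.constr_basis ..

theorem wordGen_E (q : 𝕜) {n : ℕ} (s : Fin n → Fin 2) :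
    wordGen q n Gen.E (spinBasis 𝕜 n s)
      = ∑ i, if s i = 1 then q ^ wtLt s i • spinBasis 𝕜 n (Function.update s i 0) else 0 :=
  Module.Basis.constr_basis ..

theorem wordGen_F (q : 𝕜) {n : ℕ} (s : Fin n → Fin 2) :
    wordGen q n Gen.F (spinBasis 𝕜 n s)
      = ∑ i, if s i = 0 then q ^ (-wtGt s i) • spinBasis 𝕜 n (Function.update s i 1) else 0 :=
  Module.Basis.constr_basis ..

theorem append_update_left {a b : ℕ} (s : Fin a → Fin 2) (t : Fin b → Fin 2) (i : Fin a)
    (x : Fin 2) : Fin.append (Function.update s i x) t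
      = Function.update (Fin.append s t) (Fin.castAdd b i) x := by
  funext j
  refine Fin.addCases (fun j => ?_) (fun j => ?_) j
  · rw [Fin.append_left]
    by_cases h : j = i
    · subst h; simp
    · rw [Function.update_of_ne h, Function.update_of_ne, Fin.append_left]
      exact fun e => h (Fin.castAdd_injective _ _ e)
  · rw [Fin.append_right, Function.update_of_ne (castAdd_lt_natAdd' i j).ne', Fin.append_right]

theorem append_update_right {a b : ℕ} (s : Fin a → Fin 2) (t : Fin b → Fin 2) (i : Fin b)
    (x : Fin 2) : Fin.append s (Function.update t i x)
      = Function.update (Fin.append s t) (Fin.natAdd a i) x := by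
  funext j
  refine Fin.addCases (fun j => ?_) (fun j => ?_) j
  · rw [Fin.append_left, Function.update_of_ne (castAdd_lt_natAdd' j i).ne, Fin.append_left]
  · rw [Fin.append_right]
    by_cases h : j = i
    · subst h; simp
    · rw [Function.update_of_ne h, Function.update_of_ne, Fin.append_right]
      exact fun e => h (Fin.natAdd_injective _ _ e)

/-- Coassociativity: concatenation of words is compatible with the coproduct. -/
theorem intertwines_mulEquiv {q : 𝕜} (hq : q ≠ 0) (a b : ℕ) :
    Intertwines (tensorGen (wordGen q a) (wordGen q b)) (wordGen q (a + b))
      (TensorPower.mulEquiv (R := 𝕜) (M := V 𝕜 1) (n := a) (m := b)).toLinearMap := fun x v => by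
  refine LinearMap.congr_fun
    (f := TensorPower.mulEquiv.toLinearMap ∘ₗ tensorGen (wordGen q a) (wordGen q b) x)
    (g := wordGen q (a + b) x ∘ₗ TensorPower.mulEquiv.toLinearMap) ?_ v
  refine words_ext fun s t => ?_
  simp only [LinearMap.comp_apply, LinearEquiv.coe_coe, mulEquiv_spinBasis]
  cases x with
  | K =>
    rw [tensorGen, TensorProduct.map_tmul, wordGen_K, wordGen_K, wordGen_K,
      TensorProduct.smul_tmul_smul, map_smul, mulEquiv_spinBasis, wt_append, zpow_add₀ hq]
  | Kinv =>
    rw [tensorGen, TensorProduct.map_tmul, wordGen_Kinv, wordGen_Kinv, wordGen_Kinv,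
      TensorProduct.smul_tmul_smul, map_smul, mulEquiv_spinBasis, wt_append, neg_add, zpow_add₀ hq]
  | E =>
    rw [tensorGen, LinearMap.add_apply, TensorProduct.map_tmul, TensorProduct.map_tmul, wordGen_E,
      wordGen_K, wordGen_E, wordGen_E, Fin.sum_univ_add, map_add, TensorProduct.sum_tmul,
      TensorProduct.tmul_sum, map_sum, map_sum]
    congr 1 <;> refine Finset.sum_congr rfl fun i _ => ?_
    · rw [Fin.append_left, wtLt_append_castAdd, ← append_update_left]
      split_ifs
      · rw [← TensorProduct.smul_tmul', map_smul, LinearMap.id_apply, mulEquiv_spinBasis]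
      · rw [TensorProduct.zero_tmul, map_zero]
    · rw [Fin.append_right, wtLt_append_natAdd, ← append_update_right]
      split_ifs
      · rw [TensorProduct.smul_tmul_smul, map_smul, mulEquiv_spinBasis, zpow_add₀ hq]
      · rw [TensorProduct.tmul_zero, map_zero]
  | F =>
    rw [tensorGen, LinearMap.add_apply, TensorProduct.map_tmul, TensorProduct.map_tmul, wordGen_F,
      wordGen_Kinv, wordGen_F, wordGen_F, Fin.sum_univ_add, map_add, TensorProduct.sum_tmul,
      TensorProduct.tmul_sum, map_sum, map_sum]
    congr 1 <;> refine Finset.sum_congr rfl fun i _ => ?_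
    · rw [Fin.append_left, wtGt_append_castAdd, ← append_update_left]
      split_ifs
      · rw [TensorProduct.smul_tmul_smul, map_smul, mulEquiv_spinBasis, neg_add, zpow_add₀ hq]
      · rw [TensorProduct.zero_tmul, map_zero]
    · rw [Fin.append_right, wtGt_append_natAdd, ← append_update_right]
      split_ifs
      · rw [TensorProduct.tmul_smul, map_smul, LinearMap.id_apply, mulEquiv_spinBasis]
      · rw [TensorProduct.tmul_zero, map_zero]

theorem intertwines_cast (q : 𝕜) {a b : ℕ} (h : a = b) :
    Intertwines (wordGen q a) (wordGen q b) (TensorPower.cast 𝕜 (V 𝕜 1) h).toLinearMap := by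
  subst h
  rw [TensorPower.cast_refl]
  exact Intertwines.id

theorem intertwines_regroup {q : 𝕜} (hq : q ≠ 0) {a b c d : ℕ} (h : a + b = c + d) :
    Intertwines (tensorGen (wordGen q a) (wordGen q b)) (tensorGen (wordGen q c) (wordGen q d))
      (regroup 𝕜 h).toLinearMap :=
  (intertwines_mulEquiv hq c d).symm.comp
    ((intertwines_cast q h).comp (intertwines_mulEquiv hq a b))

theorem intertwines_cut {q : 𝕜} (hq : q ≠ 0) {m n l : ℕ} (hm : l ≤ m) (hn : l ≤ n) :
    Intertwines (tensorGen (wordGen q m) (wordGen q n))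
      (tensorGen (wordGen q (m - l)) (tensorGen (tensorGen (wordGen q l) (wordGen q l))
        (wordGen q (n - l)))) (cut 𝕜 hm hn).toLinearMap := by
  have h1 := Intertwines.map
    ((intertwines_mulEquiv hq (m - l) l).symm.comp (intertwines_cast q (Nat.sub_add_cancel hm).symm))
    ((intertwines_mulEquiv hq l (n - l)).symm.comp (intertwines_cast q (Nat.add_sub_cancel' hn).symm))
  have h2 := Intertwines.assoc (g := wordGen q (m - l)) (h := wordGen q l)
    (k := tensorGen (wordGen q l) (wordGen q (n - l)))
  have h3 := Intertwines.congr (f := LinearEquiv.refl 𝕜 _) (Intertwines.id (g := wordGen q (m - l)))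
    (Intertwines.assoc (g := wordGen q l) (h := wordGen q l) (k := wordGen q (n - l))).symm
  exact h3.comp (h2.comp h1)

end WordAction

/-! ### The symmetrizers commute with the generators -/

section Symmetrizers
variable {𝕜 : Type*} [Field 𝕜]

/-- The scalar by which `T_n E` acts on the word `s`: each down arrow is turned up, with the weight
of `T_n` on the resulting word. It agrees with that of `E T_n`. -/
theorem sum_E_normPlus {q : 𝕜} (hq : q ≠ 0) {n : ℕ} (s : Fin n → Fin 2) :
    (∑ i, if s i = 1 then q ^ wtLt s i * q ^ (normPlus (Function.update s i 0) : ℤ) else 0)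
      = qNum q (downs s) * q ^ (normPlus s : ℤ) := by
  induction s using Fin.snocInduction with
  | elim0 => simp [downs, qNum_zero]
  | snoc s a ih =>
    rename_i n
    rw [Fin.sum_univ_castSucc]
    simp only [Fin.snoc_castSucc, Fin.snoc_last, wtLt_snoc_castSucc, wtLt_snoc_last,
      ← Fin.snoc_update, Fin.update_snoc_last, normPlus_snoc, downs_snoc]
    have hd := downs_le s
    obtain rfl | rfl : a = 0 ∨ a = 1 := by omega
    · simpa using ih
    · have e : (∑ i, if s i = 1 then q ^ wtLt s i * q ^ ((normPlus (Function.update s i 0) +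
          (n - downs (Function.update s i 0)) * 1 : ℕ) : ℤ) else 0)
          = (∑ i, if s i = 1 then q ^ wtLt s i * q ^ (normPlus (Function.update s i 0) : ℤ) else 0)
            * q ^ ((n : ℤ) - downs s + 1) := by
        rw [Finset.sum_mul]
        refine Finset.sum_congr rfl fun i _ => ?_
        split_ifs with hi
        · have h1 := downs_update_zero hi
          rw [mul_assoc, ← zpow_add₀ hq, ← zpow_add₀ hq, ← zpow_add₀ hq]
          congr 1
          push_cast [Nat.cast_sub (show downs (Function.update s i 0) ≤ n by omega), ← h1]
          ring
        · rw [zero_mul]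
      simp only [Fin.val_one, Fin.val_zero, mul_zero, add_zero, if_true] at e ⊢
      rw [e, ih, qNum_add hq, qNum_one, wt_eq, mul_one, add_mul, mul_one]
      congr 1
      · rw [mul_assoc, ← zpow_add₀ hq, mul_comm (q ^ _), mul_assoc, ← zpow_add₀ hq]
        congr 2
        push_cast [Nat.cast_sub hd]; ring
      · rw [← zpow_add₀ hq, ← zpow_add₀ hq]
        congr 1
        push_cast [Nat.cast_sub hd]; ring

/-- The scalar by which `T_n F` acts on the word `s`; it agrees with that of `F T_n`. -/
theorem sum_F_normPlus {q : 𝕜} (hq : q ≠ 0) {n : ℕ} (s : Fin n → Fin 2) :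
    (∑ i, if s i = 0 then q ^ (-wtGt s i) * q ^ (normPlus (Function.update s i 1) : ℤ) else 0)
      = qNum q (n - downs s) * q ^ (normPlus s : ℤ) := by
  induction s using Fin.snocInduction with
  | elim0 => simp [downs, qNum_zero]
  | snoc s a ih =>
    rename_i n
    rw [Fin.sum_univ_castSucc]
    simp only [Fin.snoc_castSucc, Fin.snoc_last, wtGt_snoc_castSucc, wtGt_snoc_last,
      ← Fin.snoc_update, Fin.update_snoc_last, normPlus_snoc, downs_snoc]
    have hd := downs_le s
    have e : (∑ i, if s i = 0 then q ^ (-(wtGt s i + (1 - 2 * ((a : ℕ) : ℤ)))) *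
        q ^ ((normPlus (Function.update s i 1) +
          (n - downs (Function.update s i 1)) * (a : ℕ) : ℕ) : ℤ) else 0)
        = (∑ i, if s i = 0 then q ^ (-wtGt s i) * q ^ (normPlus (Function.update s i 1) : ℤ) else 0)
          * q ^ (2 * (a : ℕ) - 1 + ((n : ℤ) - downs s - 1) * (a : ℕ)) := by
      rw [Finset.sum_mul]
      refine Finset.sum_congr rfl fun i _ => ?_
      split_ifs with hi
      · have h1 := downs_update_one hi
        have h2 := downs_le (Function.update s i 1)
        rw [h1] at h2 ⊢
        rw [mul_assoc, ← zpow_add₀ hq, ← zpow_add₀ hq, ← zpow_add₀ hq]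
        congr 1
        push_cast [Nat.cast_sub h2]
        ring
      · rw [zero_mul]
    rw [e, ih]
    obtain rfl | rfl : a = 0 ∨ a = 1 := by omega
    · simp only [Fin.val_zero, mul_zero, add_zero, if_true, neg_zero, zpow_zero,
        one_mul]
      rw [show n + 1 - downs s = 1 + (n - downs s) by omega, qNum_add hq, qNum_one]
      have e1 : q ^ (normPlus s : ℤ) * q ^ (-1 : ℤ)
          = q ^ (-((1 : ℕ) : ℤ)) * q ^ (normPlus s : ℤ) := by
        rw [mul_comm]; rfl
      have e2 : q ^ ((normPlus s + (n - downs s) : ℕ) : ℤ)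
          = q ^ ((n - downs s : ℕ) : ℤ) * q ^ (normPlus s : ℤ) := by
        rw [← zpow_add₀ hq]; congr 1; push_cast; ring
      simp only [Fin.val_one, Nat.cast_zero, mul_one, mul_zero, zero_sub, add_zero]
      linear_combination qNum q (n - downs s) * e1 + e2
    · simp only [Fin.val_one, one_ne_zero, if_false, add_zero, mul_one]
      rw [show n + 1 - (downs s + 1) = n - downs s by omega, mul_assoc, ← zpow_add₀ hq]
      congr 2
      push_cast [Nat.cast_sub hd]; ring

/-- The coefficient of the word `s` in `E T_n^*`, up to a q-binomial coefficient: `s` arises under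
`E` from the words in which one of its up arrows is turned down. -/
theorem sum_E_normMinus {q : 𝕜} (hq : q ≠ 0) {n : ℕ} (s : Fin n → Fin 2) :
    (∑ i, if s i = 0 then q ^ wtLt s i * q ^ (-(normMinus (Function.update s i 1) : ℤ)) else 0)
      = qNum q (n - downs s) * q ^ (-(normMinus s : ℤ)) := by
  induction s using Fin.snocInduction with
  | elim0 => simp [downs, qNum_zero]
  | snoc s a ih =>
    rename_i n
    rw [Fin.sum_univ_castSucc]
    simp only [Fin.snoc_castSucc, Fin.snoc_last, wtLt_snoc_castSucc, wtLt_snoc_last,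
      ← Fin.snoc_update, Fin.update_snoc_last, normMinus_snoc, downs_snoc]
    have hd := downs_le s
    have e : (∑ i, if s i = 0 then q ^ wtLt s i *
        q ^ (-((normMinus (Function.update s i 1) +
          downs (Function.update s i 1) * (1 - (a : ℕ)) : ℕ) : ℤ)) else 0)
        = (∑ i, if s i = 0 then q ^ wtLt s i * q ^ (-(normMinus (Function.update s i 1) : ℤ)) else 0)
          * q ^ (-(((downs s + 1) * (1 - (a : ℕ)) : ℕ) : ℤ)) := by
      rw [Finset.sum_mul]
      refine Finset.sum_congr rfl fun i _ => ?_
      split_ifs with hi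
      · rw [mul_assoc, ← zpow_add₀ hq, ← zpow_add₀ hq, ← zpow_add₀ hq, downs_update_one hi]
        congr 1
        push_cast
        ring
      · rw [zero_mul]
    rw [e, ih]
    obtain rfl | rfl : a = 0 ∨ a = 1 := by omega
    · simp only [Fin.val_zero, add_zero, if_true, Nat.sub_zero, mul_one]
      rw [show n + 1 - downs s = 1 + (n - downs s) by omega, qNum_add hq, qNum_one, wt_eq]
      have e1 : q ^ (-(normMinus s : ℤ)) * q ^ (-((downs s + 1 : ℕ) : ℤ))
          = q ^ (-((1 : ℕ) : ℤ)) * q ^ (-((normMinus s + downs s : ℕ) : ℤ)) := by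
        rw [← zpow_add₀ hq, ← zpow_add₀ hq]; congr 1; push_cast; ring
      have e2 : q ^ ((n : ℤ) - 2 * downs s) * q ^ (-(normMinus s : ℤ))
          = q ^ ((n - downs s : ℕ) : ℤ) * q ^ (-((normMinus s + downs s : ℕ) : ℤ)) := by
        rw [← zpow_add₀ hq, ← zpow_add₀ hq]; congr 1; push_cast [Nat.cast_sub hd]; ring
      linear_combination qNum q (n - downs s) * e1 + e2
    · simp only [Fin.val_one, one_ne_zero, if_false, add_zero, Nat.sub_self, mul_zero]
      rw [show n + 1 - (downs s + 1) = n - downs s by omega]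
      simp

/-- The coefficient of the word `s` in `F T_n^*`, up to a q-binomial coefficient: `s` arises under
`F` from the words in which one of its down arrows is turned up. -/
theorem sum_F_normMinus {q : 𝕜} (hq : q ≠ 0) {n : ℕ} (s : Fin n → Fin 2) :
    (∑ i, if s i = 1 then q ^ (-wtGt s i) * q ^ (-(normMinus (Function.update s i 0) : ℤ)) else 0)
      = qNum q (downs s) * q ^ (-(normMinus s : ℤ)) := by
  induction s using Fin.snocInduction with
  | elim0 => simp [downs, qNum_zero]
  | snoc s a ih =>
    rename_i n
    rw [Fin.sum_univ_castSucc]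
    simp only [Fin.snoc_castSucc, Fin.snoc_last, wtGt_snoc_castSucc, wtGt_snoc_last,
      ← Fin.snoc_update, Fin.update_snoc_last, normMinus_snoc, downs_snoc]
    have e : (∑ i, if s i = 1 then q ^ (-(wtGt s i + (1 - 2 * ((a : ℕ) : ℤ)))) *
        q ^ (-((normMinus (Function.update s i 0) +
          downs (Function.update s i 0) * (1 - (a : ℕ)) : ℕ) : ℤ)) else 0)
        = (∑ i, if s i = 1 then q ^ (-wtGt s i) * q ^ (-(normMinus (Function.update s i 0) : ℤ))
            else 0)
          * q ^ (2 * (a : ℕ) - 1 - ((downs s : ℤ) - 1) * ((1 - (a : ℕ) : ℕ) : ℤ)) := by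
      rw [Finset.sum_mul]
      refine Finset.sum_congr rfl fun i _ => ?_
      split_ifs with hi
      · have h1 := downs_update_zero hi
        rw [mul_assoc, ← zpow_add₀ hq, ← zpow_add₀ hq, ← zpow_add₀ hq]
        congr 1
        push_cast [← h1]
        ring
      · rw [zero_mul]
    rw [e, ih]
    obtain rfl | rfl : a = 0 ∨ a = 1 := by omega
    · simp only [Fin.val_zero, add_zero, Nat.sub_zero, mul_one, zero_ne_one, if_false]
      rw [mul_assoc, ← zpow_add₀ hq]
      congr 2
      push_cast; ring
    · simp only [Fin.val_one, if_true, Nat.sub_self, mul_zero, Fin.val_zero,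
        Nat.sub_zero, mul_one, add_zero]
      rw [qNum_add hq, qNum_one, add_mul, mul_one, neg_zero, zpow_zero, one_mul, mul_assoc,
        mul_comm (q ^ _) (qNum q _), mul_assoc, ← zpow_add₀ hq, ← zpow_add₀ hq, ← zpow_add₀ hq]
      congr 2
      · congr 1; push_cast; ring
      · push_cast; ring

theorem intertwines_T {q : 𝕜} (hq : q ≠ 0) (n : ℕ) :
    Intertwines (wordGen q n) (repGen q n) (T q n) := fun x v => by
  refine LinearMap.congr_fun (f := T q n ∘ₗ wordGen q n x) (g := repGen q n x ∘ₗ T q n) ?_ v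
  refine (spinBasis 𝕜 n).ext fun s => ?_
  simp only [LinearMap.comp_apply, T_word, map_smul]
  cases x with
  | K => rw [wordGen_K, map_smul, T_word, repGen_K, wt_eq, smul_comm]
  | Kinv => rw [wordGen_Kinv, map_smul, T_word, repGen_Kinv, wt_eq, smul_comm]
  | E =>
    rw [wordGen_E, map_sum, repGen_E, ← zpow_natCast]
    split_ifs with h0
    · rw [smul_zero]
      refine Finset.sum_eq_zero fun i _ => ?_
      rw [if_neg, map_zero]
      intro hi
      have := downs_update_zero hi
      simp only at h0
      omega
    · rw [smul_smul, mul_comm, ← sum_E_normPlus hq, Finset.sum_smul]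
      refine Finset.sum_congr rfl fun i _ => ?_
      split_ifs with hi
      · rw [map_smul, T_word, smul_smul, zpow_natCast]
        congr 3
        exact Nat.eq_sub_of_add_eq (downs_update_zero hi)
      · rw [zero_smul, map_zero]
  | F =>
    rw [wordGen_F, map_sum, repGen_F, ← zpow_natCast]
    split_ifs with h0
    · rw [smul_smul, mul_comm, ← sum_F_normPlus hq, Finset.sum_smul]
      refine Finset.sum_congr rfl fun i _ => ?_
      split_ifs with hi
      · rw [map_smul, T_word, smul_smul, zpow_natCast]
        congr 3
        exact downs_update_one hi
      · rw [zero_smul, map_zero]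
    · rw [smul_zero]
      refine Finset.sum_eq_zero fun i _ => ?_
      rw [if_neg, map_zero]
      intro hi
      have := downs_update_one hi
      have := downs_le (Function.update s i 1)
      simp only at h0
      omega

theorem Regular.qNum_mul_inv_qBinom {q : 𝕜} (hq : Regular q) {n k : ℕ} (h : k + 1 ≤ n) :
    qNum q (n - k) * (qBinom q n (k + 1))⁻¹ = qNum q (k + 1) * (qBinom q n k)⁻¹ := by
  obtain ⟨r, rfl⟩ := Nat.exists_eq_add_of_le h
  have e2 : qBinom q (k + 1 + r) k = qFact q (k + 1 + r) / (qFact q k * qFact q (r + 1)) := by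
    rw [show k + 1 + r = k + (r + 1) by omega, qBinom_add]
  rw [qBinom_add, e2, qFact_succ q k, qFact_succ q r, show k + 1 + r - k = r + 1 by omega]
  have h1 := hq.qFact_ne_zero k
  have h2 := hq.qFact_ne_zero r
  have h3 := hq.2 k
  have h4 := hq.2 r
  have h5 := hq.qFact_ne_zero (k + 1 + r)
  field_simp

theorem intertwines_Tstar {q : 𝕜} (hq : Regular q) (n : ℕ) :
    Intertwines (repGen q n) (wordGen q n) (Tstar q n) := fun x v => by
  refine LinearMap.congr_fun (f := Tstar q n ∘ₗ repGen q n x) (g := wordGen q n x ∘ₗ Tstar q n) ?_ v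
  refine Finsupp.basisSingleOne.ext fun j => ?_
  rw [Finsupp.coe_basisSingleOne]
  simp only [LinearMap.comp_apply]
  have hj : (j : ℕ) ≤ n := Nat.lt_succ_iff.mp j.2
  cases x with
  | K =>
    rw [repGen_K, map_smul, Tstar_basis, map_smul, map_sum, smul_comm, Finset.smul_sum]
    congr 1
    refine Finset.sum_congr rfl fun s hs => ?_
    rw [map_smul, wordGen_K, wt_eq, (Finset.mem_filter.mp hs).2, smul_comm]
  | Kinv =>
    rw [repGen_Kinv, map_smul, Tstar_basis, map_smul, map_sum, smul_comm, Finset.smul_sum]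
    congr 1
    refine Finset.sum_congr rfl fun s hs => ?_
    rw [map_smul, wordGen_Kinv, wt_eq, (Finset.mem_filter.mp hs).2, smul_comm]
  | E =>
    -- Collect the coefficient of each word `t`, which has one down arrow less than those of
    -- `T_n^* v_j`.
    have key : wordGen q n Gen.E (Tstar q n (vec 𝕜 n j)) = (qBinom q n j)⁻¹ •
        ∑ t : Fin n → Fin 2, if downs t + 1 = j then
          (qNum q (n - downs t) * q ^ (-(normMinus t : ℤ))) • spinBasis 𝕜 n t else 0 := by
      rw [Tstar_basis, map_smul, map_sum, Finset.sum_filter]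
      congr 1
      have e1 : ∀ s : Fin n → Fin 2, (if downs s = j then
          wordGen q n Gen.E (q ^ (-(normMinus s : ℤ)) • spinBasis 𝕜 n s) else 0)
          = ∑ i, if s i = 1 then (if downs s = j then (q ^ wtLt s i * q ^ (-(normMinus s : ℤ))) •
            spinBasis 𝕜 n (Function.update s i 0) else 0) else 0 := by
        intro s
        rw [map_smul, wordGen_E, Finset.smul_sum]
        by_cases h : downs s = j
        · simp only [if_pos h]
          refine Finset.sum_congr rfl fun i _ => ?_
          split_ifs
          · rw [smul_smul, mul_comm]
          · rw [smul_zero]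
        · simp [h]
      rw [Finset.sum_congr rfl fun s _ => e1 s, Finset.sum_comm,
        Finset.sum_congr rfl fun i _ => sum_ite_update i 1 0 _, Finset.sum_comm]
      refine Finset.sum_congr rfl fun t _ => ?_
      by_cases h : downs t + 1 = j
      · rw [if_pos h, ← sum_E_normMinus hq.1, Finset.sum_smul]
        refine Finset.sum_congr rfl fun i _ => ?_
        split_ifs with hi h'
        · rw [wtLt_update, Function.update_idem, ← hi, Function.update_eq_self]
        · exact absurd ((downs_update_one hi).trans h) h'
        · rw [zero_smul]
      · rw [if_neg h]
        refine Finset.sum_eq_zero fun i _ => ?_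
        split_ifs with hi h'
        · exact absurd ((downs_update_one hi).symm.trans h') h
        · rfl
        · rfl
    rw [key, repGen_E]
    split_ifs with h0
    · rw [map_zero, Finset.sum_eq_zero, smul_zero]
      intro t _
      rw [if_neg]; omega
    · rw [map_smul, Tstar_basis, Finset.sum_filter, Finset.smul_sum, Finset.smul_sum,
        Finset.smul_sum]
      refine Finset.sum_congr rfl fun t _ => ?_
      by_cases h : downs t + 1 = j
      · have h' : downs t = (j : ℕ) - 1 := by omega
        rw [if_pos h, if_pos h', smul_smul, smul_smul, smul_smul, ← mul_assoc,
          mul_comm _ (qNum q (n - downs t))]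
        congr 2
        have := hq.qNum_mul_inv_qBinom (n := n) (k := downs t) (by omega)
        simp only [← h, Nat.add_sub_cancel]
        exact this.symm
      · have h' : ¬ downs t = (j : ℕ) - 1 := by omega
        rw [if_neg h, if_neg h', smul_zero, smul_zero, smul_zero]
  | F =>
    -- Collect the coefficient of each word `t`, which has one down arrow more than those of
    -- `T_n^* v_j`.
    have key : wordGen q n Gen.F (Tstar q n (vec 𝕜 n j)) = (qBinom q n j)⁻¹ •
        ∑ t : Fin n → Fin 2, if downs t = j + 1 then
          (qNum q (downs t) * q ^ (-(normMinus t : ℤ))) • spinBasis 𝕜 n t else 0 := by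
      rw [Tstar_basis, map_smul, map_sum, Finset.sum_filter]
      congr 1
      have e1 : ∀ s : Fin n → Fin 2, (if downs s = j then
          wordGen q n Gen.F (q ^ (-(normMinus s : ℤ)) • spinBasis 𝕜 n s) else 0)
          = ∑ i, if s i = 0 then (if downs s = j then (q ^ (-wtGt s i) * q ^ (-(normMinus s : ℤ))) •
            spinBasis 𝕜 n (Function.update s i 1) else 0) else 0 := by
        intro s
        rw [map_smul, wordGen_F, Finset.smul_sum]
        by_cases h : downs s = j
        · simp only [if_pos h]
          refine Finset.sum_congr rfl fun i _ => ?_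
          split_ifs
          · rw [smul_smul, mul_comm]
          · rw [smul_zero]
        · simp [h]
      rw [Finset.sum_congr rfl fun s _ => e1 s, Finset.sum_comm,
        Finset.sum_congr rfl fun i _ => sum_ite_update i 0 1 _, Finset.sum_comm]
      refine Finset.sum_congr rfl fun t _ => ?_
      by_cases h : downs t = j + 1
      · rw [if_pos h, ← sum_F_normMinus hq.1, Finset.sum_smul]
        refine Finset.sum_congr rfl fun i _ => ?_
        split_ifs with hi h'
        · rw [wtGt_update, Function.update_idem, ← hi, Function.update_eq_self]
        · exact absurd (by have := downs_update_zero hi; omega) h'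
        · rw [zero_smul]
      · rw [if_neg h]
        refine Finset.sum_eq_zero fun i _ => ?_
        split_ifs with hi h'
        · exact absurd (by have := downs_update_zero hi; omega) h
        · rfl
        · rfl
    rw [key, repGen_F]
    split_ifs with h0
    · rw [map_smul, Tstar_basis, Finset.sum_filter, Finset.smul_sum, Finset.smul_sum,
        Finset.smul_sum]
      refine Finset.sum_congr rfl fun t _ => ?_
      by_cases h : downs t = (j : ℕ) + 1
      · simp only [if_pos h]
        rw [smul_smul, smul_smul, smul_smul, ← mul_assoc, mul_comm _ (qNum q (downs t)), h]
        congr 2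
        exact hq.qNum_mul_inv_qBinom (by omega)
      · simp only [if_neg h, smul_zero]
    · rw [map_zero, Finset.sum_eq_zero, smul_zero]
      intro t _
      rw [if_neg]
      have := downs_le t
      omega

end Symmetrizers

/-! ### Nested arcs commute with the generators -/

section NestedArcs
variable {𝕜 : Type*} [Field 𝕜]

theorem nestedEpsilon_spinBasis (q : 𝕜) {l : ℕ} (s t : Fin l → Fin 2) :
    nestedEpsilon q l (spinBasis 𝕜 l s ⊗ₜ spinBasis 𝕜 l t) = ∏ i, capCoeff q (s i) (t i.rev) := by
  rw [nestedEpsilon, ← Module.Basis.tensorProduct_apply, Module.Basis.constr_basis]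

theorem wt_split {n : ℕ} (s : Fin n → Fin 2) (i : Fin n) :
    wt s = wtLt s i + wtGt s i + (1 - 2 * ((s i : ℕ) : ℤ)) := by
  have h : 1 - 2 * ((s i : ℕ) : ℤ) = ∑ j, if j = i then 1 - 2 * ((s j : ℕ) : ℤ) else 0 := by simp
  rw [wt, wtLt, wtGt, h, ← Finset.sum_add_distrib, ← Finset.sum_add_distrib]
  refine Finset.sum_congr rfl fun j _ => ?_
  rcases lt_trichotomy j i with h | h | h
  · simp [h, h.ne, not_lt.mpr h.le]
  · simp [h]
  · simp [h, h.ne', not_lt.mpr h.le]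

/-- Letter `j` of `s` is joined by an arc to letter `j.rev` of `t`. If all arcs but the `i`-th join
opposite arrows, then the weights enclosed by the `i`-th arc cancel. -/
theorem wtLt_rev {n : ℕ} {s t : Fin n → Fin 2} {i : Fin n}
    (h : ∀ j ≠ i, (s j : ℕ) + (t j.rev : ℕ) = 1) : wtLt t i.rev = -wtGt s i := by
  rw [wtLt, wtGt, ← Finset.sum_neg_distrib, ← Equiv.sum_comp Fin.revPerm]
  refine Finset.sum_congr rfl fun j _ => ?_
  simp only [Fin.revPerm_apply, Fin.rev_lt_rev]
  split_ifs with hj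
  · have := h j hj.ne'
    omega
  · rfl

/-- As in `wtLt_rev`, for the letters which are not enclosed by the `i`-th arc. -/
theorem wtGt_rev {n : ℕ} {s t : Fin n → Fin 2} {i : Fin n}
    (h : ∀ j ≠ i, (s j : ℕ) + (t j.rev : ℕ) = 1) : wtGt t i.rev = -wtLt s i := by
  rw [wtLt, wtGt, ← Finset.sum_neg_distrib, ← Equiv.sum_comp Fin.revPerm]
  refine Finset.sum_congr rfl fun j _ => ?_
  simp only [Fin.revPerm_apply, Fin.rev_lt_rev]
  split_ifs with hj
  · have := h j hj.ne
    omega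
  · rfl

theorem wt_rev {n : ℕ} {s t : Fin n → Fin 2}
    (h : ∀ j, (s j : ℕ) + (t j.rev : ℕ) = 1) : wt t = -wt s := by
  rw [wt, wt, ← Finset.sum_neg_distrib, ← Equiv.sum_comp Fin.revPerm]
  refine Finset.sum_congr rfl fun j _ => ?_
  have := h j
  simp only [Fin.revPerm_apply]
  omega

theorem prod_arcs_update_left (f : Fin 2 → Fin 2 → 𝕜) {l : ℕ} (s t : Fin l → Fin 2) (i : Fin l)
    (x : Fin 2) : ∏ j, f (Function.update s i x j) (t j.rev)
      = f x (t i.rev) * ∏ j ∈ Finset.univ.erase i, f (s j) (t j.rev) := by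
  rw [← Finset.mul_prod_erase _ _ (Finset.mem_univ i), Function.update_self]
  congr 1
  refine Finset.prod_congr rfl fun j hj => ?_
  rw [Function.update_of_ne (Finset.ne_of_mem_erase hj)]

theorem prod_arcs_update_right (f : Fin 2 → Fin 2 → 𝕜) {l : ℕ} (s t : Fin l → Fin 2) (i : Fin l)
    (x : Fin 2) : ∏ j : Fin l, f (s j) (Function.update t i.rev x j.rev)
      = f (s i) x * ∏ j ∈ Finset.univ.erase i, f (s j) (t j.rev) := by
  rw [← Finset.mul_prod_erase _ _ (Finset.mem_univ i), Function.update_self]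
  congr 1
  refine Finset.prod_congr rfl fun j hj => ?_
  rw [Function.update_of_ne (fun h => Finset.ne_of_mem_erase hj (Fin.rev_injective h))]

theorem add_eq_one_of_ne_zero {f : Fin 2 → Fin 2 → 𝕜} (hf : ∀ a, f a a = 0) {a b : Fin 2}
    (h : f a b ≠ 0) : (a : ℕ) + (b : ℕ) = 1 := by
  have : a ≠ b := fun e => h (e ▸ hf a)
  omega

theorem capCoeff_self (q : 𝕜) (a : Fin 2) : capCoeff q a a = 0 := by
  fin_cases a <;> simp [capCoeff]

theorem cupCoeff_self (q : 𝕜) (a : Fin 2) : cupCoeff q a a = 0 := by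
  fin_cases a <;> simp [cupCoeff]

/-- The contributions of the two ends of an arc cancel if they do so when all the other arcs join
opposite arrows. -/
theorem arc_cancel {f : Fin 2 → Fin 2 → 𝕜} (hf : ∀ a, f a a = 0) {l : ℕ} {s t : Fin l → Fin 2}
    {i : Fin l} {x y : Fin 2} (hxy : x ≠ y) {α β : 𝕜}
    (h : (∀ j ≠ i, (s j : ℕ) + (t j.rev : ℕ) = 1) → s i = x → t i.rev = x →
      α * f y x + β * f x y = 0) :
    (if s i = x then α * ∏ j, f (Function.update s i y j) (t j.rev) else 0)
      + (if t i.rev = x then β * ∏ j : Fin l, f (s j) (Function.update t i.rev y j.rev) else 0)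
      = 0 := by
  rw [prod_arcs_update_left, prod_arcs_update_right]
  by_cases hR : ∏ j ∈ Finset.univ.erase i, f (s j) (t j.rev) = 0
  · simp [hR]
  · have hs : ∀ j ≠ i, (s j : ℕ) + (t j.rev : ℕ) = 1 := fun j hj =>
      add_eq_one_of_ne_zero hf (Finset.prod_ne_zero_iff.mp hR j (by simp [hj]))
    by_cases h1 : s i = x <;> by_cases h2 : t i.rev = x
    · rw [if_pos h1, if_pos h2, h1, h2, ← mul_assoc, ← mul_assoc, ← add_mul, h hs h1 h2, zero_mul]
    · have h3 : t i.rev = y := by omega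
      rw [if_pos h1, if_neg h2, h3, hf]; simp
    · have h3 : s i = y := by omega
      rw [if_neg h1, if_pos h2, h3, hf]; simp
    · simp [h1, h2]

theorem sum_arcs_cancel {l : ℕ} {M : Type*} [AddCommMonoid M] {u v : Fin l → M}
    (h : ∀ i, u i + v i.rev = 0) : ∑ i, u i + ∑ i, v i = 0 := by
  rw [← Equiv.sum_comp Fin.revPerm v, ← Finset.sum_add_distrib]
  exact Finset.sum_eq_zero fun i _ => h i

/-- The nested caps are invariant. For `E` and `F`, the contributions of the two ends of each arc
cancel, because all other arcs have total weight `0`. -/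
theorem nestedEpsilon_gen {q : 𝕜} (hq : q ≠ 0) (l : ℕ) (x : Gen)
    (v : (⨂[𝕜]^l (V 𝕜 1)) ⊗[𝕜] (⨂[𝕜]^l (V 𝕜 1))) :
    nestedEpsilon q l (tensorGen (wordGen q l) (wordGen q l) x v)
      = counitGen x * nestedEpsilon q l v := by
  refine LinearMap.congr_fun (f := nestedEpsilon q l ∘ₗ tensorGen (wordGen q l) (wordGen q l) x)
    (g := (counitGen x : 𝕜) • nestedEpsilon q l) ?_ v
  refine words_ext fun s t => ?_
  rw [LinearMap.comp_apply, LinearMap.smul_apply, smul_eq_mul]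
  have hwt : ∏ i, capCoeff q (s i) (t i.rev) ≠ 0 → wt t = -wt s := fun h =>
    wt_rev fun j => add_eq_one_of_ne_zero (capCoeff_self q)
      (Finset.prod_ne_zero_iff.mp h j (Finset.mem_univ j))
  cases x with
  | K =>
    rw [tensorGen, TensorProduct.map_tmul, wordGen_K, wordGen_K, TensorProduct.smul_tmul_smul,
      map_smul, nestedEpsilon_spinBasis, counitGen, one_mul, smul_eq_mul, ← zpow_add₀ hq]
    by_cases h : ∏ i, capCoeff q (s i) (t i.rev) = 0
    · rw [h, mul_zero]
    · rw [hwt h, add_neg_cancel, zpow_zero, one_mul]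
  | Kinv =>
    rw [tensorGen, TensorProduct.map_tmul, wordGen_Kinv, wordGen_Kinv, TensorProduct.smul_tmul_smul,
      map_smul, nestedEpsilon_spinBasis, counitGen, one_mul, smul_eq_mul, ← zpow_add₀ hq]
    by_cases h : ∏ i, capCoeff q (s i) (t i.rev) = 0
    · rw [h, mul_zero]
    · rw [hwt h, neg_neg, neg_add_cancel, zpow_zero, one_mul]
  | E =>
    rw [tensorGen, LinearMap.add_apply, TensorProduct.map_tmul, TensorProduct.map_tmul, wordGen_E,
      wordGen_K, wordGen_E, TensorProduct.sum_tmul, TensorProduct.tmul_sum, map_add, map_sum,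
      map_sum, counitGen, zero_mul]
    refine sum_arcs_cancel fun i => ?_
    refine Eq.trans ?_ (arc_cancel (capCoeff_self q) (s := s) (t := t) (i := i) (x := 1) (y := 0)
      (α := q ^ wtLt s i) (β := q ^ wt s * q ^ wtLt t i.rev) (by decide) ?_)
    · congr 1
      · split_ifs
        · rw [← TensorProduct.smul_tmul', map_smul, LinearMap.id_apply, nestedEpsilon_spinBasis,
            smul_eq_mul]
        · rw [TensorProduct.zero_tmul, map_zero]
      · split_ifs
        · rw [TensorProduct.smul_tmul_smul, map_smul, nestedEpsilon_spinBasis, smul_eq_mul]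
        · rw [TensorProduct.tmul_zero, map_zero]
    · intro h h1 _
      rw [wtLt_rev h, wt_split s i, h1, ← zpow_add₀ hq]
      have e : wtLt s i + wtGt s i + (1 - 2 * (((1 : Fin 2) : ℕ) : ℤ)) + -wtGt s i
          = wtLt s i - 1 := by simp; ring
      rw [e, zpow_sub₀ hq, zpow_one]
      simp only [capCoeff]
      simp
      field_simp
      ring
  | F =>
    rw [tensorGen, LinearMap.add_apply, TensorProduct.map_tmul, TensorProduct.map_tmul, wordGen_F,
      wordGen_Kinv, wordGen_F, TensorProduct.sum_tmul, TensorProduct.tmul_sum, map_add, map_sum,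
      map_sum, counitGen, zero_mul]
    refine sum_arcs_cancel fun i => ?_
    refine Eq.trans ?_ (arc_cancel (capCoeff_self q) (s := s) (t := t) (i := i) (x := 0) (y := 1)
      (α := q ^ (-wtGt s i) * q ^ (-wt t)) (β := q ^ (-wtGt t i.rev)) (by decide) ?_)
    · congr 1
      · split_ifs
        · rw [TensorProduct.smul_tmul_smul, map_smul, nestedEpsilon_spinBasis, smul_eq_mul]
        · rw [TensorProduct.zero_tmul, map_zero]
      · split_ifs
        · rw [TensorProduct.tmul_smul, map_smul, LinearMap.id_apply, nestedEpsilon_spinBasis,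
            smul_eq_mul]
        · rw [TensorProduct.tmul_zero, map_zero]
    · intro h _ h1
      rw [wt_split t i.rev, wtLt_rev h, wtGt_rev h, h1, ← zpow_add₀ hq]
      have e : -wtGt s i + -(-wtGt s i + -wtLt s i + (1 - 2 * (((0 : Fin 2) : ℕ) : ℤ)))
          = wtLt s i - 1 := by simp; ring
      rw [e, zpow_sub₀ hq, zpow_one, neg_neg]
      simp only [capCoeff]
      simp
      field_simp
      ring

/-- The nested cups are invariant, for the same reason as the nested caps. -/
theorem nestedDelta_gen {q : 𝕜} (hq : q ≠ 0) (l : ℕ) (x : Gen) :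
    tensorGen (wordGen q l) (wordGen q l) x (nestedDelta q l)
      = counitGen (𝕜 := 𝕜) x • nestedDelta q l := by
  have hwt : ∀ s t : Fin l → Fin 2, ∏ i, cupCoeff q (s i) (t i.rev) ≠ 0 → wt t = -wt s :=
    fun s t h => wt_rev fun j => add_eq_one_of_ne_zero (cupCoeff_self q)
      (Finset.prod_ne_zero_iff.mp h j (Finset.mem_univ j))
  -- Reindexed by the words after the arrow at position `i` has been turned, the two sums over `i`
  -- cancel if the contributions of the two ends of each single arc do.
  have split : ∀ (u v : (Fin l → Fin 2) → (Fin l → Fin 2) → Fin l →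
      (⨂[𝕜]^l (V 𝕜 1)) ⊗[𝕜] (⨂[𝕜]^l (V 𝕜 1))) (x y : Fin 2),
      (∀ i s t, (if s i = y then u (Function.update s i x) t i else 0)
        + (if t i.rev = y then v s (Function.update t i.rev x) i.rev else 0) = 0) →
      ∑ s, ∑ t, ((∑ i, if s i = x then u s t i else 0) + ∑ i, if t i = x then v s t i else 0)
        = 0 := by
    intro u v x y h
    simp only [Finset.sum_add_distrib]
    have h1 : ∑ s : Fin l → Fin 2, ∑ t : Fin l → Fin 2, (∑ i, if s i = x then u s t i else 0)
        = ∑ i, ∑ s : Fin l → Fin 2, ∑ t : Fin l → Fin 2,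
          if s i = y then u (Function.update s i x) t i else 0 := by
      simp only [Finset.sum_comm (t := (Finset.univ : Finset (Fin l)))]
      refine Finset.sum_congr rfl fun i _ => ?_
      refine Finset.sum_comm.trans (Eq.trans ?_ Finset.sum_comm)
      exact Finset.sum_congr rfl fun t _ => sum_ite_update i x y fun s => u s t i
    have h2 : ∑ s : Fin l → Fin 2, ∑ t : Fin l → Fin 2, (∑ i, if t i = x then v s t i else 0)
        = ∑ i, ∑ s : Fin l → Fin 2, ∑ t : Fin l → Fin 2,
          if t i = y then v s (Function.update t i x) i else 0 := by
      simp only [Finset.sum_comm (t := (Finset.univ : Finset (Fin l)))]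
      refine Finset.sum_congr rfl fun i _ => Finset.sum_congr rfl fun s _ => ?_
      exact sum_ite_update i x y fun t => v s t i
    rw [h1, h2]
    refine sum_arcs_cancel fun i => ?_
    rw [← Finset.sum_add_distrib]
    refine Finset.sum_eq_zero fun s _ => ?_
    rw [← Finset.sum_add_distrib]
    exact Finset.sum_eq_zero fun t _ => h i s t
  cases x with
  | K =>
    rw [counitGen, one_smul, nestedDelta, map_sum]
    refine Finset.sum_congr rfl fun s _ => ?_
    rw [map_sum]
    refine Finset.sum_congr rfl fun t _ => ?_
    rw [map_smul, tensorGen, TensorProduct.map_tmul, wordGen_K, wordGen_K,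
      TensorProduct.smul_tmul_smul, smul_smul, ← zpow_add₀ hq]
    by_cases h : ∏ i, cupCoeff q (s i) (t i.rev) = 0
    · rw [h, zero_mul]
    · rw [hwt s t h, add_neg_cancel, zpow_zero, mul_one]
  | Kinv =>
    rw [counitGen, one_smul, nestedDelta, map_sum]
    refine Finset.sum_congr rfl fun s _ => ?_
    rw [map_sum]
    refine Finset.sum_congr rfl fun t _ => ?_
    rw [map_smul, tensorGen, TensorProduct.map_tmul, wordGen_Kinv, wordGen_Kinv,
      TensorProduct.smul_tmul_smul, smul_smul, ← zpow_add₀ hq]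
    by_cases h : ∏ i, cupCoeff q (s i) (t i.rev) = 0
    · rw [h, zero_mul]
    · rw [hwt s t h, neg_neg, neg_add_cancel, zpow_zero, mul_one]
  | E =>
    rw [counitGen, zero_smul, nestedDelta, map_sum]
    refine Eq.trans (Finset.sum_congr rfl fun s _ => ?_) (split
      (fun s t i => ((∏ i, cupCoeff q (s i) (t i.rev)) * q ^ wtLt s i) •
        (spinBasis 𝕜 l (Function.update s i 0) ⊗ₜ spinBasis 𝕜 l t))
      (fun s t i => ((∏ i, cupCoeff q (s i) (t i.rev)) * (q ^ wt s * q ^ wtLt t i)) •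
        (spinBasis 𝕜 l s ⊗ₜ spinBasis 𝕜 l (Function.update t i 0))) 1 0 fun i s t => ?_)
    · rw [map_sum]
      refine Finset.sum_congr rfl fun t _ => ?_
      rw [map_smul, tensorGen, LinearMap.add_apply, TensorProduct.map_tmul, TensorProduct.map_tmul,
        wordGen_E, wordGen_K, wordGen_E, TensorProduct.sum_tmul, TensorProduct.tmul_sum, smul_add,
        Finset.smul_sum, Finset.smul_sum]
      congr 1 <;> refine Finset.sum_congr rfl fun i _ => ?_
      · split_ifs
        · rw [← TensorProduct.smul_tmul', smul_smul, LinearMap.id_apply]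
        · rw [TensorProduct.zero_tmul, smul_zero]
      · split_ifs
        · rw [TensorProduct.smul_tmul_smul, smul_smul]
        · rw [TensorProduct.tmul_zero, smul_zero]
    · have key := arc_cancel (cupCoeff_self q) (s := s) (t := t) (i := i) (x := 0) (y := 1)
        (α := q ^ wtLt s i) (β := q ^ wt s * q ^ wtLt t i.rev) (by decide) (by
          intro h h1 _
          rw [wtLt_rev h, wt_split s i, h1, ← zpow_add₀ hq]
          have e : wtLt s i + wtGt s i + (1 - 2 * (((0 : Fin 2) : ℕ) : ℤ)) + -wtGt s i
              = wtLt s i + 1 := by simp; ring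
          rw [e, zpow_add₀ hq, zpow_one]
          simp only [cupCoeff]
          simp
          field_simp
          ring)
      refine Eq.trans ?_ ((congrArg (fun c : 𝕜 => c • (spinBasis 𝕜 l s ⊗ₜ[𝕜] spinBasis 𝕜 l t))
        key).trans (zero_smul _ _))
      simp only [wtLt_update, Function.update_idem, add_smul, ite_smul, zero_smul]
      congr 1
      · refine if_ctx_congr Iff.rfl (fun hi => ?_) fun _ => rfl
        rw [← hi, Function.update_eq_self, mul_comm]
      · refine if_ctx_congr Iff.rfl (fun hi => ?_) fun _ => rfl
        rw [← hi, Function.update_eq_self, mul_comm]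
  | F =>
    rw [counitGen, zero_smul, nestedDelta, map_sum]
    refine Eq.trans (Finset.sum_congr rfl fun s _ => ?_) (split
      (fun s t i => ((∏ i, cupCoeff q (s i) (t i.rev)) * (q ^ (-wtGt s i) * q ^ (-wt t))) •
        (spinBasis 𝕜 l (Function.update s i 1) ⊗ₜ spinBasis 𝕜 l t))
      (fun s t i => ((∏ i, cupCoeff q (s i) (t i.rev)) * q ^ (-wtGt t i)) •
        (spinBasis 𝕜 l s ⊗ₜ spinBasis 𝕜 l (Function.update t i 1))) 0 1 fun i s t => ?_)
    · rw [map_sum]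
      refine Finset.sum_congr rfl fun t _ => ?_
      rw [map_smul, tensorGen, LinearMap.add_apply, TensorProduct.map_tmul, TensorProduct.map_tmul,
        wordGen_F, wordGen_Kinv, wordGen_F, TensorProduct.sum_tmul, TensorProduct.tmul_sum,
        smul_add, Finset.smul_sum, Finset.smul_sum]
      congr 1 <;> refine Finset.sum_congr rfl fun i _ => ?_
      · split_ifs
        · rw [TensorProduct.smul_tmul_smul, smul_smul]
        · rw [TensorProduct.zero_tmul, smul_zero]
      · split_ifs
        · rw [TensorProduct.tmul_smul, smul_smul, LinearMap.id_apply]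
        · rw [TensorProduct.tmul_zero, smul_zero]
    · have key := arc_cancel (cupCoeff_self q) (s := s) (t := t) (i := i) (x := 1) (y := 0)
        (α := q ^ (-wtGt s i) * q ^ (-wt t)) (β := q ^ (-wtGt t i.rev)) (by decide) (by
          intro h _ h1
          rw [wt_split t i.rev, wtLt_rev h, wtGt_rev h, h1, ← zpow_add₀ hq]
          have e : -wtGt s i + -(-wtGt s i + -wtLt s i + (1 - 2 * (((1 : Fin 2) : ℕ) : ℤ)))
              = wtLt s i + 1 := by simp; ring
          rw [e, zpow_add₀ hq, zpow_one, neg_neg]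
          simp only [cupCoeff]
          simp
          field_simp
          ring)
      refine Eq.trans ?_ ((congrArg (fun c : 𝕜 => c • (spinBasis 𝕜 l s ⊗ₜ[𝕜] spinBasis 𝕜 l t))
        key).trans (zero_smul _ _))
      simp only [wtGt_update, Function.update_idem, add_smul, ite_smul, zero_smul]
      congr 1
      · refine if_ctx_congr Iff.rfl (fun hi => ?_) fun _ => rfl
        rw [← hi, Function.update_eq_self, mul_comm]
      · refine if_ctx_congr Iff.rfl (fun hi => ?_) fun _ => rfl
        rw [← hi, Function.update_eq_self, mul_comm]

theorem intertwines_arcs {q : 𝕜} (hq : q ≠ 0) {m n l : ℕ} (hm : l ≤ m) (hn : l ≤ n) :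
    Intertwines (tensorGen (wordGen q m) (wordGen q n)) (tensorGen (wordGen q m) (wordGen q n))
      (arcs q hm hn) :=
  (intertwines_cut hq hm hn).symm.comp ((Intertwines.map Intertwines.id (Intertwines.map
    (Intertwines.smulRight (nestedEpsilon_gen hq l) (nestedDelta_gen hq l))
    Intertwines.id)).comp (intertwines_cut hq hm hn))

end NestedArcs

/-! ### The operators are intertwiners of the quantum group -/

section QuantumIntertwiners
variable {𝕜 : Type*} [Field 𝕜]

theorem intertwines_U {q : 𝕜} (hq : Regular q) {a b c d : ℕ} (h : a + b = c + d) :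
    Intertwines (tensorGen (repGen q a) (repGen q b)) (tensorGen (repGen q c) (repGen q d))
      (U q h) :=
  ((intertwines_T hq.1 c).map (intertwines_T hq.1 d)).comp ((intertwines_regroup hq.1 h).comp
    ((intertwines_Tstar hq a).map (intertwines_Tstar hq b)))

theorem intertwines_cascade {q : 𝕜} (hq : Regular q) (m n : ℕ) (k : ℤ) :
    Intertwines (tensorGen (repGen q m) (repGen q n)) (tensorGen (repGen q m) (repGen q n))
      (cascade q m n k) := by
  rw [cascade]
  split_ifs
  · exact (intertwines_U hq _).comp (intertwines_U hq _)
  · exact fun _ _ => (map_zero _).symm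

theorem intertwines_temperleyLieb {q : 𝕜} (hq : Regular q) (m n l : ℕ) :
    Intertwines (tensorGen (repGen q m) (repGen q n)) (tensorGen (repGen q m) (repGen q n))
      (temperleyLieb q m n l) := by
  rw [temperleyLieb]
  split_ifs with h
  · exact ((intertwines_T hq.1 m).map (intertwines_T hq.1 n)).comp
      ((intertwines_arcs hq.1 h.1 h.2).comp ((intertwines_Tstar hq m).map (intertwines_Tstar hq n)))
  · exact fun _ _ => (map_zero _).symm

theorem tensorRep_gen {q : 𝕜} (hq : Generic q) (m n : ℕ) (x : Gen) :
    tensorRep hq m n (Uq.gen q x) = tensorGen (repGen q m) (repGen q n) x := by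
  have h1 : ∀ n y, rep hq n (Uq.gen q y) = repGen q n y := fun n y => Uq.lift_gen ..
  have h2 : comul hq (Uq.gen q x) = comulGen q x := Uq.lift_gen ..
  rw [tensorRep, AlgHom.comp_apply, AlgHom.comp_apply, h2]
  cases x <;> simp [comulGen, h1, tensorGen, Module.endTensorEndAlgHom_apply] <;> rfl

/-- Commuting with the action of the generators suffices, as these generate `U_q(sl₂)`. -/
theorem mem_intertwiners_iff {q : 𝕜} (hq : Generic q) {m n : ℕ}
    {A : Module.End 𝕜 (V 𝕜 m ⊗[𝕜] V 𝕜 n)} :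
    A ∈ intertwiners hq m n
      ↔ Intertwines (tensorGen (repGen q m) (repGen q n)) (tensorGen (repGen q m) (repGen q n)) A := by
  rw [intertwiners, Subalgebra.mem_toSubmodule, Subalgebra.mem_centralizer_iff]
  constructor
  · intro h x v
    have := h _ ⟨Uq.gen q x, rfl⟩
    rw [tensorRep_gen] at this
    exact (LinearMap.congr_fun this v).symm
  · rintro h _ ⟨u, rfl⟩
    let S : Subalgebra 𝕜 (Uq q) :=
      (Subalgebra.centralizer 𝕜 {A}).comap (tensorRep hq m n)
    suffices hS : u ∈ S from
      ((Subalgebra.mem_centralizer_iff (R := 𝕜)).mp (Subalgebra.mem_comap _ _ _ |>.mp hS) A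
        rfl).symm
    obtain ⟨w, rfl⟩ := RingQuot.mkAlgHom_surjective 𝕜 (UqRel q) u
    suffices hw : w ∈ S.comap (RingQuot.mkAlgHom 𝕜 (UqRel q)) from hw
    induction w using FreeAlgebra.induction with
    | grade0 r => exact Subalgebra.algebraMap_mem _ r
    | grade1 x =>
      refine (Subalgebra.mem_centralizer_iff (R := 𝕜)).mpr ?_
      rintro g (rfl : g = A)
      have e : ∀ w, tensorRep hq m n (RingQuot.mkAlgHom 𝕜 (UqRel q) (FreeAlgebra.ι 𝕜 x)) w
          = tensorGen (repGen q m) (repGen q n) x w := LinearMap.congr_fun (tensorRep_gen hq m n x)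
      exact LinearMap.ext fun v => (congrArg g (e v)).trans ((h x v).trans (e _).symm)
    | mul a b ha hb => exact Subalgebra.mul_mem _ ha hb
    | add a b ha hb => exact Subalgebra.add_mem _ ha hb

end QuantumIntertwiners

/-! ### Evaluation at the tensor product of a highest and a lowest weight vector -/

section Evaluation
variable {𝕜 : Type*} [Field 𝕜]

/-- The values of an operator at `v^m ⊗ v^{-n}`, in the coordinates of the vectors `v_i ⊗ v_{n-i}`
which span the weight space of this vector. -/
noncomputable def ev {m n : ℕ} (h : n ≤ m) :
    Module.End 𝕜 (V 𝕜 m ⊗[𝕜] V 𝕜 n) →ₗ[𝕜] (Fin (n + 1) → 𝕜) :=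
  LinearMap.pi fun i => Finsupp.lapply (Fin.castLE (Nat.succ_le_succ h) i, i.rev) ∘ₗ
    (finsuppTensorFinsupp' 𝕜 _ _).toLinearMap ∘ₗ
      LinearMap.applyₗ (vec 𝕜 m 0 ⊗ₜ[𝕜] vec 𝕜 n (Fin.last n))

theorem ev_apply {m n : ℕ} (h : n ≤ m) (A : Module.End 𝕜 (V 𝕜 m ⊗[𝕜] V 𝕜 n)) (i : Fin (n + 1)) :
    ev h A i = coord (A (vec 𝕜 m 0 ⊗ₜ[𝕜] vec 𝕜 n (Fin.last n)))
      (Fin.castLE (Nat.succ_le_succ h) i, i.rev) := rfl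

theorem downs_zero (n : ℕ) : downs (fun _ : Fin n => (0 : Fin 2)) = 0 := by simp [downs]

theorem downs_one (n : ℕ) : downs (fun _ : Fin n => (1 : Fin 2)) = n := by simp [downs]

theorem normPlus_const (n : ℕ) (x : Fin 2) : normPlus (fun _ : Fin n => x) = 0 := by
  rw [normPlus_eq_sum]
  refine Finset.sum_eq_zero fun i _ => Finset.sum_eq_zero fun j _ => if_neg ?_
  rintro ⟨-, h1, h2⟩
  omega

theorem normMinus_const (n : ℕ) (x : Fin 2) : normMinus (fun _ : Fin n => x) = 0 := by
  rw [normMinus_eq_sum]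
  refine Finset.sum_eq_zero fun i _ => Finset.sum_eq_zero fun j _ => if_neg ?_
  rintro ⟨-, h1, h2⟩
  omega

theorem eq_zero_of_downs {n : ℕ} {s : Fin n → Fin 2} (h : downs s = 0) : s = fun _ => 0 := by
  funext i
  have := (Finset.sum_eq_zero_iff.mp h) i (Finset.mem_univ i)
  omega

theorem eq_one_of_downs {n : ℕ} {s : Fin n → Fin 2} (h : downs s = n) : s = fun _ => 1 := by
  funext i
  by_contra hi
  have h1 := downs_update_one (s := s) (i := i) (by omega)
  have h2 := downs_le (Function.update s i 1)
  omega

theorem Tstar_zero {q : 𝕜} (hq : Regular q) (n : ℕ) :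
    Tstar q n (vec 𝕜 n 0) = spinBasis 𝕜 n fun _ => 0 := by
  rw [Tstar_basis, Fin.val_zero, hq.qBinom_zero, inv_one, one_smul,
    Finset.sum_eq_single_of_mem (fun _ => 0) (by simp [downs_zero])]
  · simp [normMinus_const]
  · exact fun s hs hne => absurd (eq_zero_of_downs (Finset.mem_filter.mp hs).2) hne

theorem Tstar_last {q : 𝕜} (hq : Regular q) (n : ℕ) :
    Tstar q n (vec 𝕜 n (Fin.last n)) = spinBasis 𝕜 n fun _ => 1 := by
  rw [Tstar_basis, Fin.val_last, hq.qBinom_self, inv_one, one_smul,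
    Finset.sum_eq_single_of_mem (fun _ => 1) (by simp [downs_one])]
  · simp [normMinus_const]
  · exact fun s hs hne => absurd (eq_one_of_downs (Finset.mem_filter.mp hs).2) hne

theorem append_const {a b : ℕ} (x : Fin 2) :
    Fin.append (fun _ : Fin a => x) (fun _ : Fin b => x) = fun _ => x := by
  funext i
  refine Fin.addCases (fun i => ?_) (fun i => ?_) i <;> simp

theorem regroup_symm_append {a k d : ℕ} (h : a + (k + d) = a + k + d) (s : Fin a → Fin 2)
    (t : Fin k → Fin 2) (u : Fin d → Fin 2) :
    regroup 𝕜 h.symm (spinBasis 𝕜 (a + k) (Fin.append s t) ⊗ₜ[𝕜] spinBasis 𝕜 d u)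
      = spinBasis 𝕜 a s ⊗ₜ[𝕜] spinBasis 𝕜 (k + d) (Fin.append t u) := by
  rw [regroup, LinearEquiv.trans_apply, LinearEquiv.trans_apply, mulEquiv_spinBasis, cast_spinBasis,
    Fin.append_assoc, ← mulEquiv_symm_spinBasis]
  rfl

theorem regroup_symm {a b c d : ℕ} (h : a + b = c + d) :
    (regroup 𝕜 h).symm = regroup 𝕜 h.symm := by
  rw [regroup, regroup, LinearEquiv.trans_symm, LinearEquiv.trans_symm, TensorPower.cast_symm,
    LinearEquiv.symm_symm, LinearEquiv.trans_assoc]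

theorem regroup_append {a k d : ℕ} (h : a + (k + d) = a + k + d) (s : Fin a → Fin 2)
    (t : Fin k → Fin 2) (u : Fin d → Fin 2) :
    regroup 𝕜 h (spinBasis 𝕜 a s ⊗ₜ[𝕜] spinBasis 𝕜 (k + d) (Fin.append t u))
      = spinBasis 𝕜 (a + k) (Fin.append s t) ⊗ₜ[𝕜] spinBasis 𝕜 d u := by
  rw [← regroup_symm_append h, ← regroup_symm h, LinearEquiv.apply_symm_apply]

/-- `U` maps `v^m ⊗ v^{-n}` to a multiple of a single basis vector, as `T_m^*` and `T_n^*` have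
just one word each at the extremal weights. -/
theorem U_extremal {q : 𝕜} (hq : Regular q) {m k d : ℕ} (h : m + (k + d) = m + k + d) :
    U q h (vec 𝕜 m 0 ⊗ₜ vec 𝕜 (k + d) (Fin.last (k + d)))
      = q ^ (m * k) • (vec 𝕜 (m + k) ⟨k, by omega⟩ ⊗ₜ vec 𝕜 d (Fin.last d)) := by
  rw [U, LinearMap.comp_apply, LinearMap.comp_apply, TensorProduct.map_tmul, Tstar_zero hq,
    Tstar_last hq, LinearEquiv.coe_coe, ← append_const, regroup_append, TensorProduct.map_tmul,
    T_word, T_word, normPlus_append, normPlus_const, normPlus_const, normPlus_const, pow_zero,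
    one_smul, TensorProduct.smul_tmul']
  have e1 : (⟨downs (fun _ : Fin d => (1 : Fin 2)), downs_lt _⟩ : Fin (d + 1)) = Fin.last d :=
    Fin.ext (downs_one d)
  have e2 : (⟨downs (Fin.append (fun _ : Fin m => (0 : Fin 2)) (fun _ : Fin k => 1)), downs_lt _⟩ :
      Fin (m + k + 1)) = ⟨k, by omega⟩ :=
    Fin.ext (by simp only [downs_append, downs_zero, downs_one]; omega)
  rw [e1, e2, downs_zero, downs_one]
  simp

/-- The word of the second factor is fixed; the words of the first factor are cut into two parts,
over which one sums by `Regular.sum_zpow_norm`. -/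
theorem coord_U_last {q : 𝕜} (hq : Regular q) {m k d : ℕ} (h : m + k + d = m + (k + d))
    (i : Fin (m + 1)) (j : Fin (k + d + 1)) (hij : (i : ℕ) + j = k + d) :
    coord (U q h (vec 𝕜 (m + k) ⟨k, by omega⟩ ⊗ₜ vec 𝕜 d (Fin.last d))) (i, j)
      = (qBinom q (m + k) k)⁻¹ * (q ^ (-(i : ℤ) * i + i * d) * (qBinom q m i * qBinom q k i)) := by
  rw [U, LinearMap.comp_apply, LinearMap.comp_apply, TensorProduct.map_tmul, Tstar_last hq,
    Tstar_basis, ← TensorProduct.smul_tmul', map_smul, map_smul, coord, map_smul,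
    Finsupp.smul_apply, smul_eq_mul]
  congr 1
  rw [Finset.sum_filter, sum_append, TensorProduct.sum_tmul, map_sum, map_sum, map_sum,
    Finsupp.finsetSum_apply]
  have term : ∀ (s : Fin m → Fin 2) (t : Fin k → Fin 2),
      (finsuppTensorFinsupp' 𝕜 _ _ ((TensorProduct.map (T q m) (T q (k + d)))
        ((regroup 𝕜 h).toLinearMap ((if downs (Fin.append s t) = k then
          q ^ (-(normMinus (Fin.append s t) : ℤ)) • spinBasis 𝕜 (m + k) (Fin.append s t) else 0)
          ⊗ₜ[𝕜] spinBasis 𝕜 d fun _ => 1)))) (i, j)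
      = q ^ (-(i : ℤ) * i + i * d) *
        ((if downs s = i then q ^ ((normPlus s : ℤ) - normMinus s) else 0) *
          if downs t + i = k then q ^ ((normPlus t : ℤ) - normMinus t) else 0) := by
    intro s t
    have hs := downs_le s
    have ht := downs_le t
    by_cases h1 : downs (Fin.append s t) = k
    · rw [if_pos h1, ← TensorProduct.smul_tmul', map_smul, map_smul, LinearEquiv.coe_coe,
        regroup_symm_append h.symm, TensorProduct.map_tmul, T_word, T_word,
        TensorProduct.smul_tmul_smul, map_smul, map_smul, Finsupp.smul_apply, Finsupp.smul_apply, smul_eq_mul, smul_eq_mul]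
      have e := coord_vec (𝕜 := 𝕜) (⟨_, downs_lt s⟩ : Fin (m + 1)) i
        (⟨_, downs_lt (Fin.append t fun _ : Fin d => (1 : Fin 2))⟩ : Fin (k + d + 1)) j
      rw [coord] at e
      rw [e]
      simp only [Fin.ext_iff]
      rw [downs_append] at h1 ⊢
      rw [downs_one]
      by_cases h2 : downs s = i
      · rw [if_pos ⟨h2, by omega⟩, if_pos h2, if_pos (by omega), normMinus_append, normPlus_append,
          normPlus_const, downs_one, ← zpow_natCast, ← zpow_natCast, mul_one, ← zpow_add₀ hq.1,
          ← zpow_add₀ hq.1, ← zpow_add₀ hq.1, ← zpow_add₀ hq.1]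
        congr 1
        have h3 : k - downs t = i := by omega
        rw [h3, h2]
        push_cast
        ring
      · rw [if_neg fun h3 => h2 h3.1, if_neg h2]
        simp
    · rw [if_neg h1, TensorProduct.zero_tmul, map_zero, map_zero, map_zero, Finsupp.zero_apply]
      rw [downs_append] at h1
      by_cases h2 : downs s = i
      · rw [if_neg (show ¬ downs t + i = k by omega), mul_zero, mul_zero]
      · rw [if_neg h2, zero_mul, mul_zero]
  have hk : ∑ t : Fin k → Fin 2, (if downs t + i = k then q ^ ((normPlus t : ℤ) - normMinus t)
      else 0) = qBinom q k i := by
    by_cases hi : (i : ℕ) ≤ k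
    · rw [← qBinom_symm q hi, ← hq.sum_zpow_norm, Finset.sum_filter]
      refine Finset.sum_congr rfl fun t _ => if_congr ?_ rfl rfl
      omega
    · rw [qBinom_of_lt q (by omega)]
      refine Finset.sum_eq_zero fun t _ => if_neg ?_
      omega
  rw [← hk, ← hq.sum_zpow_norm m, Finset.sum_filter, Finset.sum_mul_sum, Finset.mul_sum]
  refine Finset.sum_congr rfl fun s _ => ?_
  rw [TensorProduct.sum_tmul, map_sum, map_sum, map_sum, Finsupp.finsetSum_apply, Finset.mul_sum]
  exact Finset.sum_congr rfl fun t _ => term s t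

theorem cascade_natCast (q : 𝕜) (m k d : ℕ) (h : m + (k + d) = m + k + d) :
    cascade q m (k + d) k = U q h.symm ∘ₗ U q h := by
  rw [cascade, dif_pos ⟨by omega, by omega⟩]
  exact U_comp_congr q (by omega) (by omega) _ _

theorem ev_cascade {q : 𝕜} (hq : Regular q) {m n k : ℕ} (h : n ≤ m) (hk : k ≤ n)
    (i : Fin (n + 1)) : ev h (cascade q m n k) i
      = q ^ ((m : ℤ) * k - i * i + i * (n - k)) * (qBinom q m i * qBinom q k i)
        / qBinom q (m + k) k := by
  obtain ⟨d, rfl⟩ := Nat.exists_eq_add_of_le hk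
  have e : m + (k + d) = m + k + d := (add_assoc _ _ _).symm
  rw [ev_apply, cascade_natCast q m k d e, LinearMap.comp_apply, U_extremal hq e, map_smul, coord,
    map_smul, Finsupp.smul_apply, smul_eq_mul]
  have := coord_U_last hq e.symm (Fin.castLE (Nat.succ_le_succ h) i) i.rev
    (by simp only [Fin.val_castLE, Fin.val_rev]; omega)
  rw [coord] at this
  rw [this, Fin.val_castLE]
  have e2 : q ^ ((m : ℤ) * k - i * i + i * ((k + d : ℕ) - k))
      = q ^ (m * k) * q ^ (-((i : ℕ) : ℤ) * i + i * d) := by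
    rw [← zpow_natCast, ← zpow_add₀ hq.1]; congr 1; push_cast; ring
  rw [e2]
  ring

theorem cut_symm_spinBasis {m n l : ℕ} (hm : l ≤ m) (hn : l ≤ n) (s₁ : Fin (m - l) → Fin 2)
    (s₂ t₁ : Fin l → Fin 2) (t₂ : Fin (n - l) → Fin 2) :
    (cut 𝕜 hm hn).symm (spinBasis 𝕜 (m - l) s₁ ⊗ₜ[𝕜]
        ((spinBasis 𝕜 l s₂ ⊗ₜ[𝕜] spinBasis 𝕜 l t₁) ⊗ₜ[𝕜] spinBasis 𝕜 (n - l) t₂))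
      = spinBasis 𝕜 m (Fin.append s₁ s₂ ∘ Fin.cast (Nat.sub_add_cancel hm).symm)
        ⊗ₜ[𝕜] spinBasis 𝕜 n (Fin.append t₁ t₂ ∘ Fin.cast (Nat.add_sub_cancel' hn).symm) := by
  rw [LinearEquiv.symm_apply_eq, cut]
  simp only [LinearEquiv.trans_apply, TensorProduct.congr_tmul, cast_spinBasis]
  rw [show (Fin.append s₁ s₂ ∘ Fin.cast (Nat.sub_add_cancel hm).symm)
      ∘ Fin.cast (Nat.sub_add_cancel hm).symm.symm = Fin.append s₁ s₂ from rfl,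
    show (Fin.append t₁ t₂ ∘ Fin.cast (Nat.add_sub_cancel' hn).symm)
      ∘ Fin.cast (Nat.add_sub_cancel' hn).symm.symm = Fin.append t₁ t₂ from rfl,
    mulEquiv_symm_spinBasis, mulEquiv_symm_spinBasis]
  rfl

theorem normPlus_cast {a b : ℕ} (h : b = a) (s : Fin a → Fin 2) :
    normPlus (s ∘ Fin.cast h) = normPlus s := by subst h; rfl

theorem downs_cast {a b : ℕ} (h : b = a) (s : Fin a → Fin 2) :
    downs (s ∘ Fin.cast h) = downs s := by subst h; rfl

/-- The word read backwards, with all arrows reversed. -/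
def revCompl {n : ℕ} (s : Fin n → Fin 2) : Fin n → Fin 2 := fun j => (s j.rev).rev

theorem downs_revCompl {n : ℕ} (s : Fin n → Fin 2) : downs (revCompl s) = n - downs s := by
  have h := wt_rev (s := s) (t := revCompl s) (fun j => by
    simp only [revCompl, Fin.rev_rev, Fin.val_rev]; omega)
  rw [wt_eq, wt_eq] at h
  have := downs_le s
  omega

theorem normPlus_revCompl {n : ℕ} (s : Fin n → Fin 2) : normPlus (revCompl s) = normPlus s := by
  rw [normPlus_eq_sum, normPlus_eq_sum, Finset.sum_comm, ← Equiv.sum_comp Fin.revPerm]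
  refine Finset.sum_congr rfl fun i _ => ?_
  rw [← Equiv.sum_comp Fin.revPerm]
  refine Finset.sum_congr rfl fun j _ => if_congr ?_ rfl rfl
  simp only [Fin.revPerm_apply, Fin.rev_lt_rev, revCompl, Fin.rev_rev]
  have h0 : ∀ a : Fin 2, a.rev = 0 ↔ a = 1 := by decide
  have h1 : ∀ a : Fin 2, a.rev = 1 ↔ a = 0 := by decide
  rw [h0, h1, and_comm (a := s j = 1)]

theorem prod_cupCoeff (q : 𝕜) {l : ℕ} (s t : Fin l → Fin 2) :
    ∏ i, cupCoeff q (s i) (t i.rev) = if t = revCompl s then (-q⁻¹) ^ (l - downs s) else 0 := by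
  split_ifs with h
  · have h1 : ∀ i, cupCoeff q (s i) (t i.rev) = if s i = 0 then -q⁻¹ else 1 := by
      intro i
      rw [h, revCompl, Fin.rev_rev]
      generalize s i = a
      fin_cases a <;> simp [cupCoeff]
    rw [Finset.prod_congr rfl fun i _ => h1 i, Finset.prod_ite, Finset.prod_const,
      Finset.prod_const_one, mul_one, Finset.card_filter, sum_ite_eq_zero]
  · by_contra h1
    refine h (funext fun j => ?_)
    have h2 := add_eq_one_of_ne_zero (cupCoeff_self q)
      (Finset.prod_ne_zero_iff.mp h1 j.rev (Finset.mem_univ _))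
    rw [Fin.rev_rev] at h2
    ext
    rw [revCompl, Fin.val_rev]
    omega

theorem nestedDelta_eq (q : 𝕜) (l : ℕ) :
    nestedDelta q l = ∑ s : Fin l → Fin 2, (-q⁻¹) ^ (l - downs s) •
      (spinBasis 𝕜 l s ⊗ₜ[𝕜] spinBasis 𝕜 l (revCompl s)) := by
  rw [nestedDelta]
  refine Finset.sum_congr rfl fun s _ => ?_
  simp only [prod_cupCoeff, ite_smul, zero_smul]
  rw [Finset.sum_ite_eq' Finset.univ (revCompl s), if_pos (Finset.mem_univ _)]

/-- At `v^m ⊗ v^{-n}` the caps contribute a factor `1`, so that the value is the image of the nested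
cups, flanked by `m - l` up arrows and `n - l` down arrows, under `T_m ⊗ T_n`. -/
theorem ev_temperleyLieb {q : 𝕜} (hq : Regular q) {m n l : ℕ} (h : n ≤ m) (hl : l ≤ n)
    (i : Fin (n + 1)) : ev h (temperleyLieb q m n l) i
      = (-1) ^ (l - (i : ℕ)) * q ^ (((i : ℤ) - 1) * (l - i) + i * (m + n - 2 * l))
        * qBinom q l i := by
  have hlm : l ≤ m := hl.trans h
  have e0 : spinBasis 𝕜 m (fun _ => 0) ⊗ₜ[𝕜] spinBasis 𝕜 n (fun _ => 1)
      = (cut 𝕜 hlm hl).symm (spinBasis 𝕜 (m - l) (fun _ => 0) ⊗ₜ[𝕜]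
        ((spinBasis 𝕜 l (fun _ => 0) ⊗ₜ[𝕜] spinBasis 𝕜 l (fun _ => 1))
          ⊗ₜ[𝕜] spinBasis 𝕜 (n - l) (fun _ => 1))) := by
    rw [cut_symm_spinBasis, append_const, append_const]; rfl
  have e1 : nestedEpsilon q l (spinBasis 𝕜 l (fun _ => 0) ⊗ₜ[𝕜] spinBasis 𝕜 l (fun _ => 1)) = 1 := by
    rw [nestedEpsilon_spinBasis]
    simp [capCoeff]
  rw [ev_apply, temperleyLieb, dif_pos ⟨hlm, hl⟩, LinearMap.comp_apply, LinearMap.comp_apply,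
    TensorProduct.map_tmul, Tstar_zero hq, Tstar_last hq, e0, arcs, LinearMap.comp_apply,
    LinearMap.comp_apply, LinearEquiv.coe_coe, LinearEquiv.coe_coe, LinearEquiv.apply_symm_apply,
    TensorProduct.map_tmul, TensorProduct.map_tmul, LinearMap.smulRight_apply, e1, one_smul,
    nestedDelta_eq, TensorProduct.sum_tmul, TensorProduct.tmul_sum, map_sum, map_sum, coord,
    map_sum, Finsupp.finsetSum_apply, ← hq.sum_zpow_norm, Finset.sum_filter, Finset.mul_sum]
  refine Finset.sum_congr rfl fun s _ => ?_
  have hs := downs_le s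
  rw [LinearMap.id_apply, LinearMap.id_apply, ← TensorProduct.smul_tmul', TensorProduct.tmul_smul,
    map_smul, map_smul, map_smul, cut_symm_spinBasis, TensorProduct.map_tmul, T_word, T_word,
    TensorProduct.smul_tmul_smul, map_smul, Finsupp.smul_apply, Finsupp.smul_apply, smul_eq_mul,
    smul_eq_mul]
  have e := coord_vec (𝕜 := 𝕜)
    (⟨_, downs_lt (Fin.append (fun _ => (0 : Fin 2)) s ∘ Fin.cast (Nat.sub_add_cancel hlm).symm)⟩ :
      Fin (m + 1)) (Fin.castLE (Nat.succ_le_succ h) i)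
    (⟨_, downs_lt (Fin.append (revCompl s) (fun _ => (1 : Fin 2))
      ∘ Fin.cast (Nat.add_sub_cancel' hl).symm)⟩ : Fin (n + 1)) i.rev
  rw [coord] at e
  rw [e]
  simp only [Fin.ext_iff, normPlus_cast, downs_cast, normPlus_append, downs_append, normPlus_const,
    downs_zero, downs_one, downs_revCompl, normPlus_revCompl, Fin.val_castLE, Fin.val_rev]
  by_cases h1 : downs s = i
  · rw [if_pos ⟨by omega, by omega⟩, if_pos h1, mul_one]
    have h2 := normPlus_add_normMinus s
    have h3 : (normMinus s : ℤ) = i * (l - i) - normPlus s := by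
      rw [h1] at h2 hs
      have := congrArg (Nat.cast (R := ℤ)) h2
      push_cast [Nat.cast_sub hs] at this
      linarith
    have h4 : (-q⁻¹) ^ (l - downs s) = (-1) ^ (l - (i : ℕ)) * q ^ (-((l : ℤ) - i)) := by
      rw [neg_pow, h1, inv_pow, zpow_neg, ← Nat.cast_sub (h1 ▸ hs), zpow_natCast]
    rw [h4, h3, h1, Nat.sub_zero, Nat.sub_sub_self (h1 ▸ hs), ← zpow_natCast q (_ + _),
      ← zpow_natCast q (_ + _), ← zpow_add₀ hq.1, mul_assoc, mul_assoc, ← zpow_add₀ hq.1,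
      ← zpow_add₀ hq.1]
    congr 2
    push_cast [Nat.cast_sub hl, Nat.cast_sub hlm]
    ring
  · rw [if_neg (by omega), if_neg h1]
    simp

/-- The coefficients of the change of basis, at the level of values at `v^m ⊗ v^{-n}`. In coordinate
`i` only the terms `l = i + p`, `p ≤ k - i`, are nonzero, and their sum is a q-Vandermonde sum. -/
theorem ev_sum_temperleyLieb {q : 𝕜} (hq : Regular q) {m n k : ℕ} (h : n ≤ m) (hk : k ≤ n) :
    ev h (∑ l ∈ Finset.range (k + 1), changeCoeff q m k l • temperleyLieb q m n l)
      = ev h (cascade q m n k) := by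
  funext i
  rw [map_sum, Finset.sum_apply, ev_cascade hq h hk]
  have e1 : ∀ l ∈ Finset.range (k + 1), ev h (changeCoeff q m k l • temperleyLieb q m n l) i
      = changeCoeff q m k l * ((-1) ^ (l - (i : ℕ))
        * q ^ (((i : ℤ) - 1) * (l - i) + i * (m + n - 2 * l)) * qBinom q l i) := by
    intro l hl
    rw [map_smul, Pi.smul_apply, smul_eq_mul, ev_temperleyLieb hq h]
    have := Finset.mem_range.mp hl
    omega
  rw [Finset.sum_congr rfl e1]
  generalize (i : ℕ) = i
  by_cases hi : i ≤ k
  · obtain ⟨K, rfl⟩ := Nat.exists_eq_add_of_le hi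
    rw [show i + K + 1 = i + (K + 1) by omega, Finset.sum_range_add, Finset.sum_eq_zero, zero_add]
    · have e2 : ∀ p ∈ Finset.range (K + 1), changeCoeff q m (i + K) (i + p) * ((-1) ^ (i + p - i)
          * q ^ (((i : ℤ) - 1) * (((i + p : ℕ) : ℤ) - i) + i * (m + n - 2 * ((i + p : ℕ) : ℤ)))
          * qBinom q (i + p) i)
          = qBinom q (i + K) i / qBinom q (m + (i + K)) (i + K)
            * q ^ ((i : ℤ) * (m + n - 2 * i)) *
            ((-1) ^ p * q ^ (-((i : ℤ) + 1) * p) * qBinom q K p * qBinom q (m + K - p) (K + i)) := by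
        intro p hp
        have hp' : p ≤ K := by have := Finset.mem_range.mp hp; omega
        obtain ⟨r, rfl⟩ := Nat.exists_eq_add_of_le hp'
        obtain ⟨u, rfl⟩ := Nat.exists_eq_add_of_le (show i + (p + r) ≤ m by omega)
        have b1 := qBinom_add q (i + p) (r + u)
        have b2 := qBinom_add q (i + p) r
        have b3 := qBinom_add q (i + p) (i + (p + r) + r + u)
        have b4 := qBinom_add q i p
        have b5 := qBinom_add q i (p + r)
        have b6 := qBinom_add q (i + (p + r)) (i + (p + r) + u)
        have b7 := qBinom_add q p r
        have b8 := qBinom_add q (p + r + i) (r + u)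
        rw [show i + p + (r + u) = i + (p + r) + u by omega] at b1
        rw [show i + p + r = i + (p + r) by omega] at b2
        rw [show i + p + (i + (p + r) + r + u) = i + (p + r) + u + (i + (p + r)) by omega] at b3
        rw [show i + (p + r) + (i + (p + r) + u) = i + (p + r) + u + (i + (p + r)) by omega] at b6
        rw [changeCoeff, show i + (p + r) + u + (p + r) - p = p + r + i + (r + u) by omega,
          b1, b2, b3, b4, b5, b6, b7, b8, Nat.add_sub_cancel_left]
        have e3 : q ^ (((i : ℤ) - 1) * (((i + p : ℕ) : ℤ) - i)
            + i * (((i + (p + r) + u : ℕ) : ℤ) + n - 2 * ((i + p : ℕ) : ℤ)))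
            = q ^ ((i : ℤ) * (((i + (p + r) + u : ℕ) : ℤ) + n - 2 * i))
              * q ^ (-((i : ℤ) + 1) * p) := by
          rw [← zpow_add₀ hq.1]; congr 1; push_cast; ring
        rw [e3, show p + r + i + (r + u) = i + (p + r) + r + u by omega,
          show p + r + i = i + (p + r) by omega]
        have f1 := hq.qFact_ne_zero (i + (p + r) + u)
        have f2 := hq.qFact_ne_zero (i + p)
        have f3 := hq.qFact_ne_zero (r + u)
        have f4 := hq.qFact_ne_zero (i + (p + r))
        have f5 := hq.qFact_ne_zero r
        have f6 := hq.qFact_ne_zero (i + (p + r) + u + (i + (p + r)))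
        have f7 := hq.qFact_ne_zero (i + (p + r) + r + u)
        have f8 := hq.qFact_ne_zero i
        have f9 := hq.qFact_ne_zero p
        have f10 := hq.qFact_ne_zero (p + r)
        field_simp
      rw [Finset.sum_congr rfl e2, ← Finset.mul_sum, hq.sum_qBinom_mul_qBinom]
      have e4 : q ^ ((m : ℤ) * ((i + K : ℕ) : ℤ) - i * i + i * (n - ((i + K : ℕ) : ℤ)))
          = q ^ ((i : ℤ) * (m + n - 2 * i)) * q ^ ((K : ℤ) * (m - i)) := by
        rw [← zpow_add₀ hq.1]; congr 1; push_cast; ring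
      rw [e4]
      ring
    · intro l hl
      rw [qBinom_of_lt q (Finset.mem_range.mp hl)]
      simp
  · rw [qBinom_of_lt q (not_le.mp hi), mul_zero, mul_zero, zero_div]
    refine Finset.sum_eq_zero fun l hl => ?_
    have := Finset.mem_range.mp hl
    rw [qBinom_of_lt q (show l < i by omega), mul_zero, mul_zero]

end Evaluation

/-! ### Bases of spaces of intertwiners -/

section Bases
variable {𝕜 : Type*} [Field 𝕜]

theorem eq_of_map_eq {E F : Type*} [AddCommMonoid E] [Module 𝕜 E] [AddCommMonoid F] [Module 𝕜 F]
    (W : Submodule 𝕜 E) (f : E →ₗ[𝕜] F) (hf : ∀ A ∈ W, f A = 0 → A = 0) {A B : E} (hA : A ∈ W)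
    (hB : B ∈ W) (h : f A = f B) : A = B := by
  let _ : AddCommGroup E := Module.addCommMonoidToAddCommGroup 𝕜
  let _ : AddCommGroup F := Module.addCommMonoidToAddCommGroup 𝕜
  have h1 : f (A - B) = 0 := by rw [map_sub, h, sub_self]
  exact sub_eq_zero.mp (hf _ (W.sub_mem hA hB) h1)

/-- A family of as many vectors as there are coordinates, with triangular matrix of coordinates, is
a basis of any subspace which contains it and on which the coordinates are jointly injective. -/
theorem exists_basis_of_triangular {E : Type*} [AddCommMonoid E] [Module 𝕜 E] {N : ℕ}
    (W : Submodule 𝕜 E) (f : E →ₗ[𝕜] Fin N → 𝕜) (hf : ∀ A ∈ W, f A = 0 → A = 0)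
    (w : Fin N → E) (hw : ∀ k, w k ∈ W) (h0 : ∀ k i, k < i → f (w k) i = 0)
    (h1 : ∀ k, f (w k) k ≠ 0) : ∃ b : Module.Basis (Fin N) 𝕜 W, ∀ k, (b k : E) = w k := by
  let _ : AddCommGroup W := Module.addCommMonoidToAddCommGroup 𝕜
  let g : W →ₗ[𝕜] Fin N → 𝕜 := f ∘ₗ W.subtype
  have hg : Function.Injective g :=
    fun A B h => Subtype.ext (eq_of_map_eq W f hf A.2 B.2 h)
  let v : Fin N → W := fun k => ⟨w k, hw k⟩
  have hdet : (Matrix.of fun k => f (w k)).det ≠ 0 := by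
    have hlow : (Matrix.of fun k => f (w k)).IsLowerTriangular := fun k i hki => h0 k i hki
    rw [Matrix.det_of_isLowerTriangular _ hlow]
    exact Finset.prod_ne_zero_iff.mpr fun k _ => h1 k
  have hrow : LinearIndependent 𝕜 fun k => f (w k) :=
    Matrix.linearIndependent_rows_of_det_ne_zero hdet
  have hv : LinearIndependent 𝕜 v := LinearIndependent.of_comp g hrow
  have : FiniteDimensional 𝕜 W := FiniteDimensional.of_injective g hg
  have hc : Fintype.card (Fin N) = Module.finrank 𝕜 W := by
    refine le_antisymm hv.fintype_card_le_finrank ?_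
    have := LinearMap.finrank_le_finrank_of_injective hg
    rwa [Module.finrank_fintype_fun_eq_card] at this
  exact ⟨basisOfLinearIndependentOfCardEqFinrank' v hv hc, fun k => by
    rw [coe_basisOfLinearIndependentOfCardEqFinrank']⟩

/-- The two bases of a space `W` of operators which contains the cascade operators and the
Temperley–Lieb operators, if its elements are determined by their values at `v^m ⊗ v^{-n}`. -/
theorem exists_bases {q : 𝕜} (hq : Regular q) {m n : ℕ} (h : n ≤ m)
    (W : Submodule 𝕜 (Module.End 𝕜 (V 𝕜 m ⊗[𝕜] V 𝕜 n))) (hW : ∀ A ∈ W, ev h A = 0 → A = 0)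
    (hK : ∀ k : ℕ, cascade q m n k ∈ W) (hL : ∀ l, temperleyLieb q m n l ∈ W) :
    (∃ b : Module.Basis (Fin (n + 1)) 𝕜 W, ∀ k : Fin (n + 1),
      (b k : Module.End 𝕜 (V 𝕜 m ⊗[𝕜] V 𝕜 n)) = cascade q m n ((k : ℕ) : ℤ)) ∧
    (∃ b : Module.Basis (Fin (n + 1)) 𝕜 W, ∀ l : Fin (n + 1),
      (b l : Module.End 𝕜 (V 𝕜 m ⊗[𝕜] V 𝕜 n)) = temperleyLieb q m n (l : ℕ)) ∧
    ∀ k : ℕ, k ≤ n → cascade q m n (k : ℤ)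
      = ∑ l ∈ Finset.range (k + 1), changeCoeff q m k l • temperleyLieb q m n l := by
  refine ⟨?_, ?_, fun k hk => ?_⟩
  · refine exists_basis_of_triangular W (ev h) hW
      (fun k => cascade q m n ((k : ℕ) : ℤ)) (fun k => hK k) (fun k i hki => ?_) fun k => ?_
    · rw [ev_cascade hq h (by omega), qBinom_of_lt q (show (k : ℕ) < i from hki)]
      simp
    · rw [ev_cascade hq h (by omega)]
      exact div_ne_zero (mul_ne_zero (zpow_ne_zero _ hq.1)
        (mul_ne_zero (hq.qBinom_ne_zero (by omega)) (hq.qBinom_ne_zero le_rfl)))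
        (hq.qBinom_ne_zero (by omega))
  · refine exists_basis_of_triangular W (ev h) hW
      (fun l => temperleyLieb q m n l) (fun k => hL k) (fun k i hki => ?_) fun k => ?_
    · rw [ev_temperleyLieb hq h (by omega), qBinom_of_lt q (show (k : ℕ) < i from hki)]
      simp
    · rw [ev_temperleyLieb hq h (by omega)]
      exact mul_ne_zero (mul_ne_zero (pow_ne_zero _ (neg_ne_zero.mpr one_ne_zero))
        (zpow_ne_zero _ hq.1)) (hq.qBinom_ne_zero le_rfl)
  · exact eq_of_map_eq W (ev h) hW (hK k) (W.sum_mem fun l _ => W.smul_mem _ (hL l))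
      (ev_sum_temperleyLieb hq h hk).symm

theorem changeCoeff_self_ne_zero {q : 𝕜} (hq : Regular q) {m k : ℕ} (h : k ≤ m) :
    changeCoeff q m k k ≠ 0 :=
  div_ne_zero (mul_ne_zero (hq.qBinom_ne_zero h) (hq.qBinom_ne_zero le_rfl))
    (hq.qBinom_ne_zero (by omega))

/-! ### Intertwiners of the quantum group are determined by one value -/

theorem coord_map_of_diagonal {m n : ℕ} {f : Module.End 𝕜 (V 𝕜 m)} {g : Module.End 𝕜 (V 𝕜 n)}
    {a : Fin (m + 1) → 𝕜} {b : Fin (n + 1) → 𝕜} (hf : ∀ i, f (vec 𝕜 m i) = a i • vec 𝕜 m i)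
    (hg : ∀ j, g (vec 𝕜 n j) = b j • vec 𝕜 n j) (x : V 𝕜 m ⊗[𝕜] V 𝕜 n) (i : Fin (m + 1))
    (j : Fin (n + 1)) : coord (TensorProduct.map f g x) (i, j) = a i * b j * coord x (i, j) := by
  have h : ∀ i' j', coord (TensorProduct.map f g (vec 𝕜 m i' ⊗ₜ[𝕜] vec 𝕜 n j')) (i, j)
      = a i' * b j' * if i' = i ∧ j' = j then 1 else 0 := fun i' j' => by
    rw [TensorProduct.map_tmul, hf, hg, TensorProduct.smul_tmul_smul, coord, map_smul,
      Finsupp.smul_apply, smul_eq_mul]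
    exact congrArg _ (coord_vec i' i j' j)
  rw [coord_map, Finset.sum_eq_single i, Finset.sum_eq_single j]
  · rw [h, if_pos ⟨rfl, rfl⟩, mul_one, mul_comm]
  · intro j' _ hj
    rw [h, if_neg fun h => hj h.2, mul_zero, mul_zero]
  · simp
  · intro i' _ hi
    exact Finset.sum_eq_zero fun j' _ => by rw [h, if_neg fun h => hi h.1, mul_zero, mul_zero]
  · simp

theorem coord_K (q : 𝕜) (hq : q ≠ 0) {m n : ℕ} (x : V 𝕜 m ⊗[𝕜] V 𝕜 n) (i : Fin (m + 1))
    (j : Fin (n + 1)) :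
    coord (tensorGen (repGen q m) (repGen q n) Gen.K x) (i, j)
      = q ^ ((m : ℤ) - 2 * (i : ℕ) + (n - 2 * (j : ℕ))) * coord x (i, j) := by
  rw [tensorGen, coord_map_of_diagonal (fun i => repGen_K q m i) (fun j => repGen_K q n j),
    zpow_add₀ hq]

/-- The vector `v^m ⊗ v^{-n}` is cyclic: `E` moves only its second factor, which yields all
`v^m ⊗ v_j`, and then `F` yields all `v_i ⊗ v_j`. -/
theorem eq_zero_of_extremal {q : 𝕜} (hq : Regular q) {m n : ℕ}
    {A : Module.End 𝕜 (V 𝕜 m ⊗[𝕜] V 𝕜 n)}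
    (hA : Intertwines (tensorGen (repGen q m) (repGen q n))
      (tensorGen (repGen q m) (repGen q n)) A)
    (h0 : A (vec 𝕜 m 0 ⊗ₜ[𝕜] vec 𝕜 n (Fin.last n)) = 0) : A = 0 := by
  have hE0 : repGen q m Gen.E (vec 𝕜 m 0) = 0 := by
    rw [repGen_E]
    exact if_pos rfl
  have hE : ∀ r : ℕ, ∀ j : Fin (n + 1), (j : ℕ) + r = n →
      A (vec 𝕜 m 0 ⊗ₜ[𝕜] vec 𝕜 n j) = 0 := by
    intro r
    induction r with
    | zero =>
      intro j hj
      rw [show j = Fin.last n from Fin.ext hj, h0]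
    | succ r ih =>
      intro j hj
      have h1 := hA Gen.E (vec 𝕜 m 0 ⊗ₜ[𝕜] vec 𝕜 n ⟨j + 1, by omega⟩)
      rw [ih ⟨j + 1, by omega⟩ (by simp only; omega), map_zero, tensorGen, LinearMap.add_apply,
        TensorProduct.map_tmul, TensorProduct.map_tmul, hE0,
        TensorProduct.zero_tmul, zero_add, repGen_K, repGen_E, if_neg (Nat.succ_ne_zero _),
        TensorProduct.smul_tmul_smul, map_smul] at h1
      exact (smul_eq_zero.mp h1).resolve_left (mul_ne_zero (zpow_ne_zero _ hq.1) (hq.2 _))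
  have hF : ∀ i : ℕ, ∀ (hi : i < m + 1) (j : Fin (n + 1)),
      A (vec 𝕜 m ⟨i, hi⟩ ⊗ₜ[𝕜] vec 𝕜 n j) = 0 := by
    intro i
    induction i with
    | zero => exact fun _ j => hE (n - j) j (by omega)
    | succ i ih =>
      intro hi j
      have h1 := hA Gen.F (vec 𝕜 m ⟨i, by omega⟩ ⊗ₜ[𝕜] vec 𝕜 n j)
      have h2 : A (vec 𝕜 m ⟨i, by omega⟩ ⊗ₜ[𝕜] repGen q n Gen.F (vec 𝕜 n j)) = 0 := by
        rw [repGen_F]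
        split_ifs
        · rw [TensorProduct.tmul_smul, map_smul, ih, smul_zero]
        · rw [TensorProduct.tmul_zero, map_zero]
      rw [ih, map_zero, tensorGen, LinearMap.add_apply, map_add, TensorProduct.map_tmul,
        TensorProduct.map_tmul, LinearMap.id_apply, h2, add_zero, repGen_F, dif_pos hi,
        repGen_Kinv, TensorProduct.smul_tmul_smul, map_smul] at h1
      refine (smul_eq_zero.mp h1).resolve_left (mul_ne_zero ?_ (zpow_ne_zero _ hq.1))
      obtain ⟨r, hr⟩ := Nat.exists_eq_add_of_le (show i + 1 ≤ m by omega)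
      simp only
      rw [show m - i = r + 1 by omega]
      exact hq.2 r
  exact tensor_ext fun i j => hF i i.2 j

theorem quantum_eq_zero {q : 𝕜} (hq : Generic q) {m n : ℕ} (h : n ≤ m)
    {A : Module.End 𝕜 (V 𝕜 m ⊗[𝕜] V 𝕜 n)} (hA : A ∈ intertwiners hq m n) (h0 : ev h A = 0) :
    A = 0 := by
  have hA' := (mem_intertwiners_iff hq).mp hA
  refine eq_zero_of_extremal hq.regular hA' (coord_ext fun i j => ?_)
  rw [coord, coord, map_zero, Finsupp.zero_apply]
  by_cases hij : (i : ℕ) + j = n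
  · have h1 := congrFun h0 ⟨i, by omega⟩
    rw [ev_apply] at h1
    refine Eq.trans ?_ h1
    congr 2
    ext
    simp only [Fin.val_rev]
    omega
  · have h1 := hA' Gen.K (vec 𝕜 m 0 ⊗ₜ[𝕜] vec 𝕜 n (Fin.last n))
    have h2 := coord_K q hq.1 (A (vec 𝕜 m 0 ⊗ₜ[𝕜] vec 𝕜 n (Fin.last n))) i j
    rw [← h1, tensorGen, TensorProduct.map_tmul, repGen_K, repGen_K, TensorProduct.smul_tmul_smul,
      map_smul, coord, coord, map_smul, Finsupp.smul_apply, smul_eq_mul, ← zpow_add₀ hq.1] at h2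
    by_contra h3
    have h4 := mul_right_cancel₀ h3 h2
    rw [← div_eq_one_iff_eq (zpow_ne_zero _ hq.1), ← zpow_sub₀ hq.1] at h4
    refine hq.zpow_ne_one ?_ h4
    simp only [Fin.val_zero, Fin.val_last]
    omega

end Bases

/-! ### The operators commute with `SU(2)` -/

section ClassicalIntertwiners

theorem defRep_vec (g : SU2) (x : Fin 2) :
    defRep g (vec ℂ 1 x) = ∑ y : Fin 2, (g : Matrix (Fin 2) (Fin 2) ℂ) y x • vec ℂ 1 y := by
  have h := Matrix.toLin_self (Finsupp.basisSingleOne (R := ℂ) (ι := Fin 2))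
    (Finsupp.basisSingleOne (R := ℂ) (ι := Fin 2)) (g : Matrix (Fin 2) (Fin 2) ℂ) x
  simp only [Finsupp.coe_basisSingleOne] at h
  exact h

theorem repr_vec (x y : Fin 2) :
    Finsupp.basisSingleOne.repr (vec ℂ 1 x) y = if x = y then (1 : ℂ) else 0 :=
  Finsupp.single_apply

theorem powMap_repr_basis {n : ℕ} (g : SU2) (s t : Fin n → Fin 2) :
    (spinBasis ℂ n).repr (powMap n g (spinBasis ℂ n s)) t
      = ∏ i, (g : Matrix (Fin 2) (Fin 2) ℂ) (t i) (s i) := by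
  rw [spinBasis_eq, powMap, PiTensorProduct.map_tprod, spinBasis,
    Basis.piTensorProduct_repr_tprod_apply]
  refine Finset.prod_congr rfl fun i _ => ?_
  rw [defRep_vec, map_sum, Finsupp.finsetSum_apply, Finset.sum_eq_single (t i)]
  · rw [map_smul, Finsupp.smul_apply, repr_vec, if_pos rfl, smul_eq_mul, mul_one]
  · intro y _ hy
    rw [map_smul, Finsupp.smul_apply, repr_vec, if_neg hy, smul_zero]
  · simp

theorem powMap_basis {n : ℕ} (g : SU2) (s : Fin n → Fin 2) :
    powMap n g (spinBasis ℂ n s)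
      = ∑ t, (∏ i, (g : Matrix (Fin 2) (Fin 2) ℂ) (t i) (s i)) • spinBasis ℂ n t := by
  rw [← (spinBasis ℂ n).sum_repr (powMap n g (spinBasis ℂ n s))]
  exact Finset.sum_congr rfl fun t _ => by rw [powMap_repr_basis]

theorem Tstar_repr {n : ℕ} (j : Fin (n + 1)) (t : Fin n → Fin 2) :
    (spinBasis ℂ n).repr (Tstar 1 n (vec ℂ n j)) t
      = if downs t = j then ((n.choose j : ℕ) : ℂ)⁻¹ else 0 := by
  rw [Tstar_vec, map_smul, Finsupp.smul_apply, map_sum, Finsupp.finsetSum_apply, Finset.sum_filter,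
    Finset.sum_eq_single t]
  · rw [Module.Basis.repr_self, Finsupp.single_eq_same]
    split_ifs <;> simp
  · intro s _ hs
    rw [Module.Basis.repr_self, Finsupp.single_eq_of_ne hs.symm, ite_self]
  · simp

/-- `T_n^* T_n` is the identity on symmetric tensors. -/
theorem Tstar_T_of_symmetric {n : ℕ} (x : ⨂[ℂ]^n (V ℂ 1))
    (hx : ∀ (e : Equiv.Perm (Fin n)) t,
      (spinBasis ℂ n).repr x (t ∘ e) = (spinBasis ℂ n).repr x t) :
    Tstar 1 n (T 1 n x) = x := by
  refine (spinBasis ℂ n).ext_elem fun t => ?_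
  conv_lhs => rw [← (spinBasis ℂ n).sum_repr x]
  have h1 : ∀ s, (spinBasis ℂ n).repr x s *
      (if downs t = downs s then ((n.choose (downs s) : ℕ) : ℂ)⁻¹ else 0)
      = if downs s = downs t then (spinBasis ℂ n).repr x t * ((n.choose (downs t) : ℕ) : ℂ)⁻¹
        else 0 := by
    intro s
    split_ifs with h2 h3 h3
    · obtain ⟨e, he⟩ := exists_perm_of_downs_eq h3
      rw [← hx e t, ← h2]
      congr 2
      funext i
      exact (he i).symm
    · exact absurd h2.symm h3
    · exact absurd h3.symm h2
    · rw [mul_zero]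
  simp only [map_sum, map_smul, Finsupp.finsetSum_apply, Finsupp.smul_apply, T_spinBasis,
    Tstar_repr, smul_eq_mul]
  rw [Finset.sum_congr rfl fun s _ => h1 s, ← Finset.sum_filter, Finset.sum_const, card_downs,
    nsmul_eq_mul, mul_comm, mul_assoc, inv_mul_cancel₀ (choose_ne_zero ⟨downs t, downs_lt t⟩),
    mul_one]

/-- The tensors in the image of `T_n^*` are symmetric, and `g ⊗ ⋯ ⊗ g` preserves symmetric
tensors. -/
theorem Tstar_T_powMap_Tstar (n : ℕ) (g : SU2) (v : V ℂ n) :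
    Tstar 1 n (T 1 n (powMap n g (Tstar 1 n v))) = powMap n g (Tstar 1 n v) := by
  suffices key : Tstar (1 : ℂ) n ∘ₗ T (1 : ℂ) n ∘ₗ powMap n g ∘ₗ Tstar (1 : ℂ) n
      = powMap n g ∘ₗ Tstar (1 : ℂ) n from LinearMap.congr_fun key v
  refine Finsupp.basisSingleOne.ext fun j => ?_
  change Tstar 1 n (T 1 n (powMap n g (Tstar 1 n (vec ℂ n j)))) = powMap n g (Tstar 1 n (vec ℂ n j))
  refine Tstar_T_of_symmetric _ fun e t => ?_
  simp only [Tstar_vec, map_smul, map_sum, Finsupp.smul_apply, Finsupp.finsetSum_apply,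
    powMap_repr_basis]
  congr 1
  rw [Finset.sum_filter, Finset.sum_filter]
  refine Fintype.sum_equiv (e.arrowCongr (Equiv.refl (Fin 2))) _ _ fun s => ?_
  have h1 : e.arrowCongr (Equiv.refl (Fin 2)) s = s ∘ e.symm := rfl
  have h2 : downs (s ∘ e.symm) = downs s := Equiv.sum_comp e.symm fun i => (s i : ℕ)
  rw [h1, h2]
  refine if_congr Iff.rfl ?_ rfl
  exact Fintype.prod_equiv e _ _ fun i => by simp

theorem su2Rep_apply (n : ℕ) (g : SU2) (v : V ℂ n) :
    su2Rep n g v = T 1 n (powMap n g (Tstar 1 n v)) := rfl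

theorem semiconj_T (n : ℕ) (g : SU2) :
    Function.Semiconj (T (1 : ℂ) n) (powMap n g) (su2Rep n g) := fun x =>
  (LinearMap.congr_fun (T_powMap_proj n g) x).symm

theorem semiconj_Tstar (n : ℕ) (g : SU2) :
    Function.Semiconj (Tstar (1 : ℂ) n) (su2Rep n g) (powMap n g) := fun v => by
  rw [su2Rep_apply, Tstar_T_powMap_Tstar]

theorem semiconj_map {A B C D : Type*} [AddCommMonoid A] [Module ℂ A] [AddCommMonoid B]
    [Module ℂ B] [AddCommMonoid C] [Module ℂ C] [AddCommMonoid D] [Module ℂ D]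
    {f : A →ₗ[ℂ] B} {f' : C →ₗ[ℂ] D} {a : Module.End ℂ A} {b : Module.End ℂ B} {c : Module.End ℂ C}
    {d : Module.End ℂ D} (h : Function.Semiconj f a b) (h' : Function.Semiconj f' c d) :
    Function.Semiconj (TensorProduct.map f f') (TensorProduct.map a c) (TensorProduct.map b d) :=
  fun x => by
    induction x using TensorProduct.induction_on with
    | zero => simp only [map_zero]
    | tmul x y => simp only [TensorProduct.map_tmul, h.eq, h'.eq]
    | add x y hx hy => simp only [map_add, hx, hy]

theorem semiconj_equiv_symm {A B : Type*} [AddCommMonoid A] [Module ℂ A] [AddCommMonoid B]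
    [Module ℂ B] {f : A ≃ₗ[ℂ] B} {a : Module.End ℂ A} {b : Module.End ℂ B}
    (h : Function.Semiconj f a b) : Function.Semiconj f.symm b a := fun x => by
  rw [LinearEquiv.symm_apply_eq, h.eq, LinearEquiv.apply_symm_apply]

theorem semiconj_mulEquiv (a b : ℕ) (g : SU2) :
    Function.Semiconj (TensorPower.mulEquiv (R := ℂ) (M := V ℂ 1) (n := a) (m := b))
      (TensorProduct.map (powMap a g) (powMap b g)) (powMap (a + b) g) := fun x => by
  refine LinearMap.congr_fun
    (f := TensorPower.mulEquiv.toLinearMap ∘ₗ TensorProduct.map (powMap a g) (powMap b g))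
    (g := powMap (a + b) g ∘ₗ TensorPower.mulEquiv.toLinearMap) (words_ext fun s t => ?_) x
  simp only [LinearMap.comp_apply, TensorProduct.map_tmul, LinearEquiv.coe_coe, mulEquiv_spinBasis]
  rw [powMap_basis, powMap_basis, powMap_basis, sum_append, TensorProduct.sum_tmul, map_sum]
  refine Finset.sum_congr rfl fun s' _ => ?_
  rw [TensorProduct.tmul_sum, map_sum]
  refine Finset.sum_congr rfl fun t' _ => ?_
  rw [TensorProduct.smul_tmul_smul, map_smul, mulEquiv_spinBasis, Fin.prod_univ_add]
  simp only [Fin.append_left, Fin.append_right]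

theorem semiconj_cast {a b : ℕ} (h : a = b) (g : SU2) :
    Function.Semiconj (TensorPower.cast ℂ (V ℂ 1) h) (powMap a g) (powMap b g) := by
  subst h
  rw [TensorPower.cast_refl]
  exact fun _ => rfl

theorem semiconj_regroup {a b c d : ℕ} (h : a + b = c + d) (g : SU2) :
    Function.Semiconj (regroup ℂ h) (TensorProduct.map (powMap a g) (powMap b g))
      (TensorProduct.map (powMap c g) (powMap d g)) :=
  ((semiconj_mulEquiv a b g).trans (semiconj_cast h g)).trans
    (semiconj_equiv_symm (semiconj_mulEquiv c d g))

theorem semiconj_assoc {A B C : Type*} [AddCommMonoid A] [Module ℂ A] [AddCommMonoid B]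
    [Module ℂ B] [AddCommMonoid C] [Module ℂ C] (a : Module.End ℂ A) (b : Module.End ℂ B)
    (c : Module.End ℂ C) :
    Function.Semiconj (TensorProduct.assoc ℂ A B C)
      (TensorProduct.map (TensorProduct.map a b) c)
      (TensorProduct.map a (TensorProduct.map b c)) := fun x =>
  LinearMap.congr_fun (f := (TensorProduct.assoc ℂ A B C).toLinearMap ∘ₗ
      TensorProduct.map (TensorProduct.map a b) c)
    (g := TensorProduct.map a (TensorProduct.map b c) ∘ₗ (TensorProduct.assoc ℂ A B C).toLinearMap)
    (TensorProduct.ext_threefold fun _ _ _ => rfl) x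

theorem semiconj_cut {m n l : ℕ} (hm : l ≤ m) (hn : l ≤ n) (g : SU2) :
    Function.Semiconj (cut ℂ hm hn) (TensorProduct.map (powMap m g) (powMap n g))
      (TensorProduct.map (powMap (m - l) g)
        (TensorProduct.map (TensorProduct.map (powMap l g) (powMap l g)) (powMap (n - l) g))) := by
  have h1 := semiconj_map (f := (TensorPower.cast ℂ (V ℂ 1) (Nat.sub_add_cancel hm).symm ≪≫ₗ
      TensorPower.mulEquiv.symm).toLinearMap)
    (f' := (TensorPower.cast ℂ (V ℂ 1) (Nat.add_sub_cancel' hn).symm ≪≫ₗ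
      TensorPower.mulEquiv.symm).toLinearMap)
    ((semiconj_cast (Nat.sub_add_cancel hm).symm g).trans
      (semiconj_equiv_symm (semiconj_mulEquiv (m - l) l g)))
    ((semiconj_cast (Nat.add_sub_cancel' hn).symm g).trans
      (semiconj_equiv_symm (semiconj_mulEquiv l (n - l) g)))
  have h2 := semiconj_assoc (powMap (m - l) g) (powMap l g)
    (TensorProduct.map (powMap l g) (powMap (n - l) g))
  have h3 := semiconj_map (f := LinearMap.id) (f' := (TensorProduct.assoc ℂ _ _ _).symm.toLinearMap)
    (a := powMap (m - l) g) (b := powMap (m - l) g) (fun _ => rfl)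
    (semiconj_equiv_symm (semiconj_assoc (powMap l g) (powMap l g) (powMap (n - l) g)))
  exact (h1.trans h2).trans h3

/-- A sum over pairs of words of a product over nested arcs is a product of sums, one for each
arc. -/
theorem sum_sum_prod_rev {l : ℕ} (F : Fin l → Fin 2 → Fin 2 → ℂ) :
    ∑ s : Fin l → Fin 2, ∑ t : Fin l → Fin 2, ∏ i, F i (s i) (t i.rev)
      = ∏ i, ∑ a, ∑ b, F i a b := by
  rw [Finset.prod_univ_sum, Fintype.piFinset_univ]
  refine Finset.sum_congr rfl fun s _ => ?_
  rw [Finset.prod_univ_sum, Fintype.piFinset_univ]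
  exact Fintype.sum_equiv (Fin.revPerm.arrowCongr (Equiv.refl (Fin 2))) _ _ fun t => rfl

theorem su2_det (g : SU2) : (g : Matrix (Fin 2) (Fin 2) ℂ) 0 0 * (g : Matrix (Fin 2) (Fin 2) ℂ) 1 1
    - (g : Matrix (Fin 2) (Fin 2) ℂ) 0 1 * (g : Matrix (Fin 2) (Fin 2) ℂ) 1 0 = 1 := by
  rw [← Matrix.det_fin_two]
  exact (Matrix.mem_specialUnitaryGroup_iff.mp g.2).2

/-- A single cap is invariant under `SU(2)`, as the determinant is `1`. -/
theorem capCoeff_su2 (g : SU2) (x y : Fin 2) :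
    ∑ a, ∑ b, capCoeff 1 a b * ((g : Matrix (Fin 2) (Fin 2) ℂ) a x
      * (g : Matrix (Fin 2) (Fin 2) ℂ) b y) = capCoeff 1 x y := by
  have h := su2_det g
  fin_cases x <;> fin_cases y <;> simp [capCoeff, Fin.sum_univ_two] <;>
    first | ring1 | linear_combination h | linear_combination -h

/-- A single cup is invariant under `SU(2)`, as the determinant is `1`. -/
theorem cupCoeff_su2 (g : SU2) (x y : Fin 2) :
    ∑ a, ∑ b, cupCoeff 1 a b * ((g : Matrix (Fin 2) (Fin 2) ℂ) x a
      * (g : Matrix (Fin 2) (Fin 2) ℂ) y b) = cupCoeff 1 x y := by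
  have h := su2_det g
  fin_cases x <;> fin_cases y <;> simp [cupCoeff, Fin.sum_univ_two] <;>
    first | ring1 | linear_combination h | linear_combination -h

theorem prod_comp_rev {l : ℕ} (f : Fin l → ℂ) : ∏ i : Fin l, f i.rev = ∏ i, f i :=
  Equiv.prod_comp Fin.revPerm f

theorem nestedEpsilon_su2 (l : ℕ) (g : SU2) (v : (⨂[ℂ]^l (V ℂ 1)) ⊗[ℂ] (⨂[ℂ]^l (V ℂ 1))) :
    nestedEpsilon 1 l (TensorProduct.map (powMap l g) (powMap l g) v) = nestedEpsilon 1 l v := by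
  suffices key : nestedEpsilon (1 : ℂ) l ∘ₗ TensorProduct.map (powMap l g) (powMap l g)
      = nestedEpsilon (1 : ℂ) l from LinearMap.congr_fun key v
  refine words_ext fun s t => ?_
  rw [LinearMap.comp_apply, TensorProduct.map_tmul, powMap_basis, powMap_basis,
    nestedEpsilon_spinBasis, ← Finset.prod_congr rfl fun i _ => capCoeff_su2 g (s i) (t i.rev),
    ← sum_sum_prod_rev, TensorProduct.sum_tmul, map_sum]
  refine Finset.sum_congr rfl fun s' _ => ?_
  rw [TensorProduct.tmul_sum, map_sum]
  refine Finset.sum_congr rfl fun t' _ => ?_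
  rw [TensorProduct.smul_tmul_smul, map_smul, nestedEpsilon_spinBasis, smul_eq_mul,
    Finset.prod_mul_distrib, Finset.prod_mul_distrib,
    prod_comp_rev fun i => (g : Matrix (Fin 2) (Fin 2) ℂ) (t' i) (t i), mul_comm]

theorem nestedDelta_su2 (l : ℕ) (g : SU2) :
    TensorProduct.map (powMap l g) (powMap l g) (nestedDelta 1 l) = nestedDelta 1 l := by
  have h1 : TensorProduct.map (powMap l g) (powMap l g) (nestedDelta 1 l)
      = ∑ s : Fin l → Fin 2, ∑ t : Fin l → Fin 2, ∑ s' : Fin l → Fin 2, ∑ t' : Fin l → Fin 2,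
        (∏ i, cupCoeff 1 (s i) (t i.rev) * ((g : Matrix (Fin 2) (Fin 2) ℂ) (s' i) (s i)
          * (g : Matrix (Fin 2) (Fin 2) ℂ) (t' i.rev) (t i.rev))) •
          (spinBasis ℂ l s' ⊗ₜ[ℂ] spinBasis ℂ l t') := by
    rw [nestedDelta, map_sum]
    refine Finset.sum_congr rfl fun s _ => ?_
    rw [map_sum]
    refine Finset.sum_congr rfl fun t _ => ?_
    rw [map_smul, TensorProduct.map_tmul, powMap_basis, powMap_basis, TensorProduct.sum_tmul,
      Finset.smul_sum]
    refine Finset.sum_congr rfl fun s' _ => ?_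
    rw [TensorProduct.tmul_sum, Finset.smul_sum]
    refine Finset.sum_congr rfl fun t' _ => ?_
    rw [TensorProduct.smul_tmul_smul, smul_smul, Finset.prod_mul_distrib, Finset.prod_mul_distrib,
      prod_comp_rev fun i => (g : Matrix (Fin 2) (Fin 2) ℂ) (t' i) (t i)]
  rw [h1, nestedDelta]
  calc _ = ∑ s' : Fin l → Fin 2, ∑ t' : Fin l → Fin 2, ∑ s : Fin l → Fin 2, ∑ t : Fin l → Fin 2,
        (∏ i, cupCoeff 1 (s i) (t i.rev) * ((g : Matrix (Fin 2) (Fin 2) ℂ) (s' i) (s i)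
          * (g : Matrix (Fin 2) (Fin 2) ℂ) (t' i.rev) (t i.rev))) •
          (spinBasis ℂ l s' ⊗ₜ[ℂ] spinBasis ℂ l t') := by
        simp only [← Fintype.sum_prod_type'
          (f := fun s t : Fin l → Fin 2 => ∑ s' : Fin l → Fin 2, ∑ t' : Fin l → Fin 2,
        (∏ i, cupCoeff 1 (s i) (t i.rev) * ((g : Matrix (Fin 2) (Fin 2) ℂ) (s' i) (s i)
          * (g : Matrix (Fin 2) (Fin 2) ℂ) (t' i.rev) (t i.rev))) •
          (spinBasis ℂ l s' ⊗ₜ[ℂ] spinBasis ℂ l t'))]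
        rw [Finset.sum_comm]
        refine Finset.sum_congr rfl fun s' _ => ?_
        rw [Finset.sum_comm]
        refine Finset.sum_congr rfl fun t' _ => ?_
        rw [Fintype.sum_prod_type]
    _ = _ := by
        refine Finset.sum_congr rfl fun s' _ => Finset.sum_congr rfl fun t' _ => ?_
        simp only [← Finset.sum_smul]
        rw [sum_sum_prod_rev (F := fun i a b => cupCoeff 1 a b *
          ((g : Matrix (Fin 2) (Fin 2) ℂ) (s' i) a
            * (g : Matrix (Fin 2) (Fin 2) ℂ) (t' i.rev) b))]
        simp only [cupCoeff_su2]

theorem semiconj_arcs {m n l : ℕ} (hm : l ≤ m) (hn : l ≤ n) (g : SU2) :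
    Function.Semiconj (arcs (1 : ℂ) hm hn) (TensorProduct.map (powMap m g) (powMap n g))
      (TensorProduct.map (powMap m g) (powMap n g)) := by
  have h1 : Function.Semiconj ((nestedEpsilon (1 : ℂ) l).smulRight (nestedDelta 1 l))
      (TensorProduct.map (powMap l g) (powMap l g)) (TensorProduct.map (powMap l g) (powMap l g)) :=
    fun v => by
      rw [LinearMap.smulRight_apply, LinearMap.smulRight_apply, nestedEpsilon_su2, map_smul,
        nestedDelta_su2]
  have h2 := semiconj_map (f := LinearMap.id) (a := powMap (m - l) g) (b := powMap (m - l) g)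
    (fun _ => rfl) (semiconj_map (f' := LinearMap.id) (c := powMap (n - l) g)
      (d := powMap (n - l) g) h1 (fun _ => rfl))
  exact ((semiconj_cut hm hn g).trans h2).trans (semiconj_equiv_symm (semiconj_cut hm hn g))

theorem semiconj_U {a b c d : ℕ} (h : a + b = c + d) (g : SU2) :
    Function.Semiconj (U (1 : ℂ) h) (TensorProduct.map (su2Rep a g) (su2Rep b g))
      (TensorProduct.map (su2Rep c g) (su2Rep d g)) :=
  ((semiconj_map (semiconj_Tstar a g) (semiconj_Tstar b g)).trans (semiconj_regroup h g)).trans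
    (semiconj_map (semiconj_T c g) (semiconj_T d g))

theorem mem_centralizer_tprod_iff {G A B : Type*} [Monoid G] [AddCommMonoid A] [Module ℂ A]
    [AddCommMonoid B] [Module ℂ B] (ρ : Representation ℂ G A) (σ : Representation ℂ G B)
    {X : Module.End ℂ (A ⊗[ℂ] B)} :
    X ∈ Subalgebra.centralizer ℂ (Set.range (ρ.tprod σ)) ↔ ∀ g, Function.Semiconj X
      (TensorProduct.map (ρ g) (σ g)) (TensorProduct.map (ρ g) (σ g)) := by
  rw [Subalgebra.mem_centralizer_iff]
  constructor
  · intro h g v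
    have h1 := DFunLike.congr_fun (h _ ⟨g, rfl⟩) v
    rw [Module.End.mul_apply, Module.End.mul_apply] at h1
    exact h1.symm
  · rintro h _ ⟨g, rfl⟩
    refine LinearMap.ext fun v => ?_
    rw [Module.End.mul_apply, Module.End.mul_apply]
    exact (h g v).symm

theorem mem_su2Intertwiners_iff {m n : ℕ} {A : Module.End ℂ (V ℂ m ⊗[ℂ] V ℂ n)} :
    A ∈ su2Intertwiners m n ↔ ∀ g, Function.Semiconj A
      (TensorProduct.map (su2Rep m g) (su2Rep n g)) (TensorProduct.map (su2Rep m g) (su2Rep n g)) := by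
  rw [su2Intertwiners, Subalgebra.mem_toSubmodule]
  exact mem_centralizer_tprod_iff (su2Rep m) (su2Rep n)

theorem cascade_mem_su2Intertwiners (m n : ℕ) (k : ℤ) :
    cascade 1 m n k ∈ su2Intertwiners m n := by
  rw [cascade]
  split_ifs
  · refine mem_su2Intertwiners_iff.mpr fun g v => ?_
    rw [LinearMap.comp_apply, LinearMap.comp_apply, (semiconj_U _ g).eq, (semiconj_U _ g).eq]
  · exact Submodule.zero_mem _

theorem temperleyLieb_mem_su2Intertwiners (m n l : ℕ) :
    temperleyLieb 1 m n l ∈ su2Intertwiners m n := by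
  rw [temperleyLieb]
  split_ifs with h
  · refine mem_su2Intertwiners_iff.mpr fun g v => ?_
    rw [LinearMap.comp_apply, LinearMap.comp_apply, LinearMap.comp_apply, LinearMap.comp_apply,
      (semiconj_map (semiconj_Tstar m g) (semiconj_Tstar n g)).eq, (semiconj_arcs h.1 h.2 g).eq,
      (semiconj_map (semiconj_T m g) (semiconj_T n g)).eq]
  · exact Submodule.zero_mem _

end ClassicalIntertwiners

/-! ### Intertwiners of `SU(2)` are determined by one value -/

section ClassicalUniqueness

open Polynomial in
theorem polynomial_eq_zero_of_real {p : ℂ[X]} (h : ∀ t : ℝ, p.eval (t : ℂ) = 0) : p = 0 :=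
  p.eq_zero_of_infinite_isRoot (Set.infinite_of_injective_forall_mem Complex.ofReal_injective h)

open Polynomial in
theorem coeff_eq_zero_of_forall_sum {N : ℕ} {a : Fin N → ℂ}
    (h : ∀ x : ℂ, ∑ i, a i * x ^ (i : ℕ) = 0) (i : Fin N) : a i = 0 := by
  have hp : (∑ i, C (a i) * X ^ (i : ℕ) : ℂ[X]) = 0 :=
    polynomial_eq_zero_of_real fun t => by
      rw [eval_finsetSum, ← h t]
      simp
  have hc := congrArg (fun p => coeff p (i : ℕ)) hp
  simp only [finsetSum_coeff, coeff_C_mul_X_pow, coeff_zero] at hc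
  rwa [Finset.sum_eq_single i, if_pos rfl] at hc
  · exact fun j _ hj => if_neg fun h => hj (Fin.ext h.symm)
  · simp

open Polynomial in
/-- The monomials in `z` and its conjugate are linearly independent functions on `ℂ`. -/
theorem coeff_eq_zero_of_forall_sum_conj {M N : ℕ} {c : Fin M → Fin N → ℂ}
    (h : ∀ z : ℂ, ∑ i, ∑ j, c i j * (z ^ (i : ℕ) * starRingEnd ℂ z ^ (j : ℕ)) = 0)
    (i : Fin M) (j : Fin N) : c i j = 0 := by
  -- The polynomial in the real and imaginary parts of `z` vanishes on all of `ℂ²`, which makes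
  -- `z` and its conjugate independent variables.
  have h1 : ∀ (x y : ℝ), ∑ i, ∑ j, c i j *
      (((x : ℂ) + Complex.I * y) ^ (i : ℕ) * ((x : ℂ) - Complex.I * y) ^ (j : ℕ)) = 0 := by
    intro x y
    rw [← h (x + Complex.I * y)]
    simp only [map_add, map_mul, Complex.conj_ofReal, Complex.conj_I, neg_mul, sub_eq_add_neg]
  have h2 : ∀ (x : ℝ) (y : ℂ), ∑ i, ∑ j, c i j *
      (((x : ℂ) + Complex.I * y) ^ (i : ℕ) * ((x : ℂ) - Complex.I * y) ^ (j : ℕ)) = 0 := by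
    intro x y
    have hp : (∑ i, ∑ j, C (c i j) * ((C (x : ℂ) + C Complex.I * X) ^ (i : ℕ) *
        (C (x : ℂ) - C Complex.I * X) ^ (j : ℕ)) : ℂ[X]) = 0 :=
      polynomial_eq_zero_of_real fun t => by
        rw [← h1 x t]
        simp [eval_finsetSum]
    have := congrArg (eval y) hp
    simpa [eval_finsetSum] using this
  have h3 : ∀ x y : ℂ, ∑ i, ∑ j, c i j *
      ((x + Complex.I * y) ^ (i : ℕ) * (x - Complex.I * y) ^ (j : ℕ)) = 0 := by
    intro x y
    have hp : (∑ i, ∑ j, C (c i j) * ((X + C (Complex.I * y)) ^ (i : ℕ) *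
        (X - C (Complex.I * y)) ^ (j : ℕ)) : ℂ[X]) = 0 :=
      polynomial_eq_zero_of_real fun t => by
        rw [← h2 t y]
        simp [eval_finsetSum]
    have := congrArg (eval x) hp
    simpa [eval_finsetSum] using this
  have h4 : ∀ z w : ℂ, ∑ i, ∑ j, c i j * (z ^ (i : ℕ) * w ^ (j : ℕ)) = 0 := by
    intro z w
    rw [← h3 ((z + w) / 2) (-Complex.I * ((z - w) / 2))]
    have hI := Complex.I_mul_I
    have e1 : (z + w) / 2 + Complex.I * (-Complex.I * ((z - w) / 2)) = z := by
      linear_combination (-(z - w) / 2) * hI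
    have e2 : (z + w) / 2 - Complex.I * (-Complex.I * ((z - w) / 2)) = w := by
      linear_combination ((z - w) / 2) * hI
    rw [e1, e2]
  refine coeff_eq_zero_of_forall_sum (fun w => ?_) j
  refine coeff_eq_zero_of_forall_sum (a := fun i => ∑ j, c i j * w ^ (j : ℕ)) (fun z => ?_) i
  rw [← h4 z w]
  refine Finset.sum_congr rfl fun i _ => ?_
  rw [Finset.sum_mul]
  exact Finset.sum_congr rfl fun j _ => by ring

/-- The matrix with first column `(a, b)`, a unit vector, as an element of `SU(2)`. -/
noncomputable def su2Mk (a b : ℂ) (h : a * starRingEnd ℂ a + b * starRingEnd ℂ b = 1) : SU2 :=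
  ⟨!![a, -starRingEnd ℂ b; b, starRingEnd ℂ a], by
    rw [Matrix.mem_specialUnitaryGroup_iff, Matrix.mem_unitaryGroup_iff]
    constructor
    · ext i j
      fin_cases i <;> fin_cases j <;>
        simp [Matrix.mul_apply, Fin.sum_univ_two, Matrix.star_apply] <;>
        first | linear_combination h | ring1
    · rw [Matrix.det_fin_two_of]
      linear_combination h⟩

theorem su2Mk_coe (a b : ℂ) (h : a * starRingEnd ℂ a + b * starRingEnd ℂ b = 1) :
    (su2Mk a b h : Matrix (Fin 2) (Fin 2) ℂ) = !![a, -starRingEnd ℂ b; b, starRingEnd ℂ a] := rfl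

theorem prod_word {n : ℕ} (f : Fin 2 → ℂ) (t : Fin n → Fin 2) :
    ∏ i, f (t i) = f 0 ^ (n - downs t) * f 1 ^ downs t := by
  have h : ∀ i, f (t i) = f 0 ^ (if t i = 0 then 1 else 0) * f 1 ^ (if t i = 1 then 1 else 0) := by
    intro i
    generalize t i = a
    fin_cases a <;> simp
  rw [Finset.prod_congr rfl fun i _ => h i, Finset.prod_mul_distrib, Finset.prod_pow_eq_pow_sum,
    Finset.prod_pow_eq_pow_sum, sum_ite_eq_zero, sum_ite_eq_one]

theorem T_powMap_const (n : ℕ) (g : SU2) (x : Fin 2) :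
    T 1 n (powMap n g (spinBasis ℂ n fun _ => x)) = ∑ j : Fin (n + 1),
      ((n.choose j : ℕ) * ((g : Matrix (Fin 2) (Fin 2) ℂ) 0 x ^ (n - (j : ℕ))
        * (g : Matrix (Fin 2) (Fin 2) ℂ) 1 x ^ (j : ℕ))) • vec ℂ n j := by
  rw [powMap_basis, map_sum, ← Finset.sum_fiberwise Finset.univ
    fun t : Fin n → Fin 2 => (⟨downs t, downs_lt t⟩ : Fin (n + 1))]
  refine Finset.sum_congr rfl fun j _ => ?_
  rw [Finset.sum_congr rfl (g := fun _ => ((g : Matrix (Fin 2) (Fin 2) ℂ) 0 x ^ (n - (j : ℕ))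
        * (g : Matrix (Fin 2) (Fin 2) ℂ) 1 x ^ (j : ℕ)) • vec ℂ n j), Finset.sum_const]
  · simp only [Fin.ext_iff]
    rw [card_downs, ← Nat.cast_smul_eq_nsmul ℂ, smul_smul]
  · intro t ht
    have h := (Finset.mem_filter.mp ht).2
    rw [map_smul, T_spinBasis, prod_word fun y => (g : Matrix (Fin 2) (Fin 2) ℂ) y x, h, ← h]

theorem su2Rep_zero (n : ℕ) (g : SU2) : su2Rep n g (vec ℂ n 0) = ∑ j : Fin (n + 1),
      ((n.choose j : ℕ) * ((g : Matrix (Fin 2) (Fin 2) ℂ) 0 0 ^ (n - (j : ℕ))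
        * (g : Matrix (Fin 2) (Fin 2) ℂ) 1 0 ^ (j : ℕ))) • vec ℂ n j := by
  rw [su2Rep_apply, Tstar_zero regular_one, T_powMap_const]

theorem su2Rep_last (n : ℕ) (g : SU2) : su2Rep n g (vec ℂ n (Fin.last n)) = ∑ j : Fin (n + 1),
      ((n.choose j : ℕ) * ((g : Matrix (Fin 2) (Fin 2) ℂ) 0 1 ^ (n - (j : ℕ))
        * (g : Matrix (Fin 2) (Fin 2) ℂ) 1 1 ^ (j : ℕ))) • vec ℂ n j := by
  rw [su2Rep_apply, Tstar_last regular_one, T_powMap_const]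

/-- The vectors `g v^m ⊗ g v^{-n}`, where the two columns of `g` are proportional to `(z, 1)` and to
`(-1, z̄)`, have polynomial coordinates in `z` and `z̄`, each monomial occurring in exactly one
coordinate. Therefore they span `V(m) ⊗ V(n)`. -/
theorem su2_eq_zero_of_extremal {m n : ℕ} {A : Module.End ℂ (V ℂ m ⊗[ℂ] V ℂ n)}
    (hA : A ∈ su2Intertwiners m n) (h0 : A (vec ℂ m 0 ⊗ₜ[ℂ] vec ℂ n (Fin.last n)) = 0) : A = 0 := by
  have hA' := mem_su2Intertwiners_iff.mp hA
  refine tensor_ext fun i₀ j₀ => coord_ext fun p r => ?_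
  have key : ∀ z : ℂ, ∑ i : Fin (m + 1), ∑ j : Fin (n + 1),
      ((m.choose i.rev : ℕ) * (n.choose j : ℕ) * (-1) ^ (n - (j : ℕ)) *
        coord (A (vec ℂ m i.rev ⊗ₜ[ℂ] vec ℂ n j)) (p, r)) *
        (z ^ (i : ℕ) * starRingEnd ℂ z ^ (j : ℕ)) = 0 := by
    intro z
    have hpos : 0 < 1 + Complex.normSq z := by
      have := Complex.normSq_nonneg z
      linarith
    -- `c` is the normalizing factor of the column `(z, 1)`.
    let c : ℂ := ((Real.sqrt (1 + Complex.normSq z))⁻¹ : ℝ)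
    have hc0 : c ≠ 0 := Complex.ofReal_ne_zero.mpr (inv_ne_zero (Real.sqrt_ne_zero'.mpr hpos))
    have hcc : starRingEnd ℂ c = c := Complex.conj_ofReal _
    have hc : c * c * (1 + z * starRingEnd ℂ z) = 1 := by
      rw [Complex.mul_conj, ← Complex.ofReal_one, ← Complex.ofReal_add, ← Complex.ofReal_mul,
        ← Complex.ofReal_mul, ← mul_inv, Real.mul_self_sqrt hpos.le, inv_mul_cancel₀ hpos.ne']
    have hg : (c * z) * starRingEnd ℂ (c * z) + c * starRingEnd ℂ c = 1 := by
      rw [map_mul, hcc]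
      linear_combination hc
    have h1 := hA' (su2Mk (c * z) c hg) (vec ℂ m 0 ⊗ₜ[ℂ] vec ℂ n (Fin.last n))
    rw [h0, map_zero, TensorProduct.map_tmul, su2Rep_zero, su2Rep_last, TensorProduct.sum_tmul,
      map_sum] at h1
    have h2 := congrArg (fun x => coord x (p, r)) h1
    simp only [TensorProduct.tmul_sum, TensorProduct.smul_tmul_smul, map_sum, map_smul, coord,
      Finsupp.finsetSum_apply, Finsupp.smul_apply, map_zero, Finsupp.zero_apply, smul_eq_mul,
      su2Mk_coe, Matrix.of_apply, Matrix.cons_val', Matrix.cons_val_zero, Matrix.cons_val_one,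
      Matrix.cons_val_fin_one] at h2
    -- Each coordinate of `g v^m ⊗ g v^{-n}` contains `c` to the power `m + n`.
    refine (mul_eq_zero.mp (Eq.trans ?_ h2)).resolve_left (pow_ne_zero (m + n) hc0)
    rw [← Equiv.sum_comp Fin.revPerm, Finset.mul_sum]
    refine Finset.sum_congr rfl fun i _ => ?_
    rw [Finset.mul_sum]
    refine Finset.sum_congr rfl fun j _ => ?_
    have e1 : c ^ (m + n) = c ^ (m - (i : ℕ)) * c ^ (i : ℕ) * (c ^ (n - (j : ℕ)) * c ^ (j : ℕ)) := by
      rw [← pow_add, ← pow_add, ← pow_add]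
      congr 1
      omega
    have e2 : ((Fin.revPerm i : Fin (m + 1)) : ℕ) = m - i := by
      rw [Fin.revPerm_apply, Fin.val_rev]
      omega
    have e3 : (Fin.revPerm i : Fin (m + 1)).rev = i := by rw [Fin.revPerm_apply, Fin.rev_rev]
    rw [e1, e2, e3, coord, map_mul, hcc, neg_pow c, mul_pow, mul_pow]
    ring
  have h := coeff_eq_zero_of_forall_sum_conj key i₀.rev j₀
  rw [Fin.rev_rev] at h
  rw [(mul_eq_zero.mp h).resolve_left (mul_ne_zero (mul_ne_zero (choose_ne_zero i₀)
    (choose_ne_zero j₀)) (pow_ne_zero _ (neg_ne_zero.mpr one_ne_zero)))]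
  simp [coord]

/-- Diagonal elements of `SU(2)` act on weight vectors by scalars. -/
theorem su2Rep_diagonal (n : ℕ) {u : ℂ} (hu : u * starRingEnd ℂ u + 0 * starRingEnd ℂ 0 = 1)
    (j : Fin (n + 1)) :
    su2Rep n (su2Mk u 0 hu) (vec ℂ n j) = u ^ ((n : ℤ) - 2 * (j : ℕ)) • vec ℂ n j := by
  have hu' : u * starRingEnd ℂ u = 1 := by simpa using hu
  have hu0 : u ≠ 0 := left_ne_zero_of_mul_eq_one hu'
  have h1 : ∀ s : Fin n → Fin 2, downs s = j → powMap n (su2Mk u 0 hu) (spinBasis ℂ n s)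
      = u ^ ((n : ℤ) - 2 * (j : ℕ)) • spinBasis ℂ n s := by
    intro s hs
    rw [powMap_basis, Finset.sum_eq_single s]
    · congr 1
      have := prod_word (fun y => (su2Mk u 0 hu : Matrix (Fin 2) (Fin 2) ℂ) y y) s
      rw [this, hs]
      simp only [su2Mk_coe, Matrix.of_apply, Matrix.cons_val', Matrix.cons_val_zero,
        Matrix.cons_val_one, Matrix.cons_val_fin_one]
      rw [eq_inv_of_mul_eq_one_right hu', ← zpow_natCast, inv_pow, ← zpow_natCast, ← zpow_neg,
        ← zpow_add₀ hu0]
      congr 1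
      omega
    · intro t _ hts
      obtain ⟨i, hi⟩ := Function.ne_iff.mp hts
      rw [Finset.prod_eq_zero (Finset.mem_univ i), zero_smul]
      rw [su2Mk_coe]
      generalize t i = a at hi
      generalize s i = b at hi
      fin_cases a <;> fin_cases b <;> simp at hi ⊢
    · simp
  rw [su2Rep_apply, Tstar_vec, map_smul, map_sum,
    Finset.sum_congr rfl fun s hs => h1 s (Finset.mem_filter.mp hs).2, ← Finset.smul_sum,
    smul_comm, ← Tstar_vec, map_smul]
  exact congrArg _ (LinearMap.congr_fun (T_Tstar n) _)

theorem su2_eq_zero {m n : ℕ} (h : n ≤ m) {A : Module.End ℂ (V ℂ m ⊗[ℂ] V ℂ n)}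
    (hA : A ∈ su2Intertwiners m n) (h0 : ev h A = 0) : A = 0 := by
  have hA' := mem_su2Intertwiners_iff.mp hA
  refine su2_eq_zero_of_extremal hA (coord_ext fun i j => ?_)
  rw [coord, coord, map_zero, Finsupp.zero_apply]
  by_cases hij : (i : ℕ) + j = n
  · have h1 := congrFun h0 ⟨i, by omega⟩
    rw [ev_apply] at h1
    refine Eq.trans ?_ h1
    congr 2
    ext
    simp only [Fin.val_rev]
    omega
  · -- The order of `u` exceeds all differences of weights of `V(m) ⊗ V(n)`.
    obtain ⟨u, hu⟩ : ∃ u : ℂ, IsPrimitiveRoot u (2 * (m + n) + 1) :=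
      ⟨_, Complex.isPrimitiveRoot_exp _ (Nat.succ_ne_zero _)⟩
    have hu0 : u ≠ 0 := hu.ne_zero (Nat.succ_ne_zero _)
    have hu1 : u * starRingEnd ℂ u + 0 * starRingEnd ℂ 0 = 1 := by
      rw [← Complex.inv_eq_conj (hu.norm'_eq_one (Nat.succ_ne_zero _)), mul_inv_cancel₀ hu0,
        zero_mul, add_zero]
    have h1 := hA' (su2Mk u 0 hu1) (vec ℂ m 0 ⊗ₜ[ℂ] vec ℂ n (Fin.last n))
    have h2 := coord_map_of_diagonal (su2Rep_diagonal m hu1) (su2Rep_diagonal n hu1)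
      (A (vec ℂ m 0 ⊗ₜ[ℂ] vec ℂ n (Fin.last n))) i j
    rw [← h1, TensorProduct.map_tmul, su2Rep_diagonal, su2Rep_diagonal,
      TensorProduct.smul_tmul_smul, map_smul, coord, coord, map_smul, Finsupp.smul_apply,
      smul_eq_mul, ← zpow_add₀ hu0, ← zpow_add₀ hu0] at h2
    by_contra h3
    have h4 := mul_right_cancel₀ h3 h2
    rw [← div_eq_one_iff_eq (zpow_ne_zero _ hu0), ← zpow_sub₀ hu0, hu.zpow_eq_one_iff_dvd] at h4
    simp only [Fin.val_zero, Fin.val_last] at h4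
    have h5 := Int.eq_zero_of_abs_lt_dvd h4 (by rw [abs_lt]; omega)
    omega

end ClassicalUniqueness

end Cascade

theorem mainTheorem5 {𝕜 : Type*} [Field 𝕜] (q : 𝕜) (hq : Cascade.Generic q) (m n : ℕ) :
    -- the quantum group `U_q(sl₂)`
    ((∀ (a b c d : ℕ) (h : a + b = c + d) (x : Cascade.V 𝕜 a ⊗[𝕜] Cascade.V 𝕜 b)
        (y : Cascade.V 𝕜 c ⊗[𝕜] Cascade.V 𝕜 d),
        Cascade.tensorForm q c d (Cascade.U q h x) y =
          Cascade.tensorForm q a b x (Cascade.U q h.symm y)) ∧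
      (n ≤ m →
        (∃ b : Module.Basis (Fin (n + 1)) 𝕜 (Cascade.intertwiners hq m n),
          ∀ k : Fin (n + 1), (b k : Module.End 𝕜 (Cascade.V 𝕜 m ⊗[𝕜] Cascade.V 𝕜 n)) =
            Cascade.cascade q m n ((k : ℕ) : ℤ)) ∧
        (∃ b : Module.Basis (Fin (n + 1)) 𝕜 (Cascade.intertwiners hq m n),
          ∀ l : Fin (n + 1), (b l : Module.End 𝕜 (Cascade.V 𝕜 m ⊗[𝕜] Cascade.V 𝕜 n)) =
            Cascade.temperleyLieb q m n (l : ℕ)) ∧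
        ∀ k : ℕ, k ≤ n →
          (Cascade.cascade q m n (k : ℤ) =
            ∑ l ∈ Finset.range (k + 1),
              Cascade.changeCoeff q m k l • Cascade.temperleyLieb q m n l) ∧
          Cascade.changeCoeff q m k k ≠ 0)) ∧
    -- the classical group `SU(2)`, that is, `q = 1`
    ((∀ (a b c d : ℕ) (h : a + b = c + d) (x : Cascade.V ℂ a ⊗[ℂ] Cascade.V ℂ b)
        (y : Cascade.V ℂ c ⊗[ℂ] Cascade.V ℂ d),
        Cascade.tensorInner c d (Cascade.U 1 h x) y =
          Cascade.tensorInner a b x (Cascade.U 1 h.symm y)) ∧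
      (n ≤ m →
        (∃ b : Module.Basis (Fin (n + 1)) ℂ (Cascade.su2Intertwiners m n),
          ∀ k : Fin (n + 1), (b k : Module.End ℂ (Cascade.V ℂ m ⊗[ℂ] Cascade.V ℂ n)) =
            Cascade.cascade 1 m n ((k : ℕ) : ℤ)) ∧
        (∃ b : Module.Basis (Fin (n + 1)) ℂ (Cascade.su2Intertwiners m n),
          ∀ l : Fin (n + 1), (b l : Module.End ℂ (Cascade.V ℂ m ⊗[ℂ] Cascade.V ℂ n)) =
            Cascade.temperleyLieb 1 m n (l : ℕ)) ∧
        ∀ k : ℕ, k ≤ n →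
          Cascade.cascade (1 : ℂ) m n (k : ℤ) =
            ∑ l ∈ Finset.range (k + 1),
              ((m.choose l : ℂ) * (k.choose l : ℂ) / ((m + k).choose l : ℂ)) •
                Cascade.temperleyLieb 1 m n l) ∧
      ∀ k : ℤ, -(m : ℤ) ≤ k → k ≤ n →
        (Cascade.flip m n).symm.toLinearMap ∘ₗ Cascade.cascade (1 : ℂ) n m (-k) ∘ₗ
            (Cascade.flip m n).toLinearMap =
          Cascade.cascade 1 m n k) := by
  refine ⟨⟨fun a b c d h x y => Cascade.tensorForm_U hq.regular h x y, fun h => ?_⟩,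
    fun a b c d h x y => Cascade.tensorInner_U h x y, fun h => ?_, Cascade.flip_cascade m n⟩
  · obtain ⟨hK, hL, hc⟩ := Cascade.exists_bases hq.regular h (Cascade.intertwiners hq m n)
      (fun A hA => Cascade.quantum_eq_zero hq h hA)
      (fun k => (Cascade.mem_intertwiners_iff hq).mpr
        (Cascade.intertwines_cascade hq.regular m n k))
      (fun l => (Cascade.mem_intertwiners_iff hq).mpr
        (Cascade.intertwines_temperleyLieb hq.regular m n l))
    exact ⟨hK, hL, fun k hk =>
      ⟨hc k hk, Cascade.changeCoeff_self_ne_zero hq.regular (hk.trans h)⟩⟩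
  · obtain ⟨hK, hL, hc⟩ := Cascade.exists_bases Cascade.regular_one h (Cascade.su2Intertwiners m n)
      (fun A hA => Cascade.su2_eq_zero h hA)
      (fun k => Cascade.cascade_mem_su2Intertwiners m n k)
      (fun l => Cascade.temperleyLieb_mem_su2Intertwiners m n l)
    refine ⟨hK, hL, fun k hk => (hc k hk).trans (Finset.sum_congr rfl fun l _ => ?_)⟩
    rw [Cascade.changeCoeff, Cascade.qBinom_one, Cascade.qBinom_one, Cascade.qBinom_one]
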